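/- Let $N\ge 1$, $0<\alpha<2$, $H=(H_1,\dots,H_N)\in(0,1)^N$. Let $\widetilde M_\alpha$ be a complex-valued rotationally invariant $\alpha$-stable random measure on $\mathbb R^N$ with Lebesgue control measure: an independently scattered, $\sigma$-additive family of complex random variables $\widetilde M_\alpha(A)$, indexed by the Borel sets $A$ of finite Lebesgue measure $|A|$, with $\mathbb E\exp\big(i\,\mathrm{Re}(\overline{\theta}\,\widetilde M_\alpha(A))\big)=\exp(-|\theta|^\alpha|A|)$ for all $\theta\in\mathbb C$. For $f\in L^\alpha(\mathbb R^N)$ the integral $\int f\,d\widetilde M_\alpha$ is the limit in probability of the integrals of simple functions converging to $f$ in $L^\alpha(\mathbb R^N)$. The harmonizable fractional stable sheet (HFSS) with index $H$ is $$Z^H(t)=\mathrm{Re}\int_{\mathbb R^N}\prod_{l=1}^N\frac{e^{it_l\lambda_l}-1}{|\lambda_l|^{H_l+1/\alpha}}\,\widetilde M_\alpha(d\lambda),\qquad t\in\mathbb R^N.$$ Let $\psi$ be a Lemarié–Meyer mother wavelet: a real-valued Schwartz function on $\mathbb R$ whose Fourier transform $\widehat\psi(\xi)=(2\pi)^{-1/2}\int_{\mathbb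 R} e^{-is\xi}\psi(s)\,ds$ is supported in $\{\frac{2\pi}3\le|\xi|\le\frac{8\pi}3\}$ and for which the functions $2^{j/2}\psi(2^jx-k)$, $(j,k)\in\mathbb Z^2$, form an orthonormal basis of $L^2(\mathbb R)$. For $v\in(0,1)$ and $y\in\mathbb R$ put $$\psi^v(y)=\int_{\mathbb R}e^{iy\eta}\,\frac{\widehat\psi(\eta)}{|\eta|^{v+1/\alpha}}\,d\eta ,$$ and for $J=(j_1,\dots,j_N)$, $K=(k_1,\dots,k_N)\in\mathbb Z^N$ put $$\epsilon_{J,K}=\int_{\mathbb R^N}\overline{\prod_{l=1}^N 2^{-j_l/\alpha}e^{-ik_l2^{-j_l}\lambda_l}\,\widehat\psi(2^{-j_l}\lambda_l)}\;\widetilde M_\alpha(d\lambda).$$ Let $M>0$ and, for $n\in\mathbb N$, let $D^N_{n,M}$ be the set of all $(J,K)\in\mathbb Z^N\times\mathbb Z^N$ such that $|j_l|\le n$ and $|k_l|\le M2^{n+1}$ for $l=1,\dots,N$. Define, for $t\in\mathbb R^N$, $$U_n^*(t)=\mathrm{Re}\sum_{(J,K)\in D^N_{n,M}}2^{-\langle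 J,H\rangle}\,\epsilon_{J,K}\prod_{l=1}^N\big\{\psi^{H_l}(2^{j_l}t_l-k_l)-\psi^{H_l}(-k_l)\big\}.$$ Then: (i) with probability $1$, $(U_n^*)_{n\in\mathbb N}$ is a Cauchy sequence in the Hölder space $C^\gamma([-M,M]^N)$, with norm $\sup_t|f(t)|+\sup_{s\ne t}|f(s)-f(t)|/|s-t|^\gamma$, simultaneously for all $\gamma\in(0,\min\{H_1,\dots,H_N\})$; denote its limit by $U^*$; (ii) the random field $\{U^*(t)\}_{t\in[-M,M]^N}$ is a version of $\{Z^H(t)\}_{t\in[-M,M]^N}$, that is, $\mathbb P(U^*(t)=Z^H(t))=1$ for every $t\in[-M,M]^N$. -/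

import Mathlib

open MeasureTheory ProbabilityTheory Filter Topology
open scoped NNReal ENNReal

namespace HFSS

noncomputable section

/-- Euclidean space `ℝ^N`, with the Euclidean norm and Lebesgue measure `volume`. -/
abbrev E (N : ℕ) : Type := EuclideanSpace ℝ (Fin N)

section RandomMeasure

variable {N : ℕ} {Ω : Type*} [MeasurableSpace Ω]

/-- `M` is a complex-valued rotationally invariant `α`-stable random measure on `ℝ^N` with Lebesgue
control measure: a family of complex random variables indexed by the Borel sets of finite Lebesgue
measure (the values of `M` at other sets play no role) that is independently scattered and
`σ`-additive, where `M A` is an isotropic stable variable of scale `volume A ^ (1 / α)`.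
In `ae_tendsto_sum` the partial sums are taken in the given order, as the series need not converge
unconditionally at a given `ω`. -/
structure IsIsotropicStableMeasure (α : ℝ) (P : Measure Ω) (M : Set (E N) → Ω → ℂ) : Prop where
  measurable : ∀ A : Set (E N), MeasurableSet A → volume A < ∞ → Measurable (M A)
  indep : ∀ A : ℕ → Set (E N), (∀ i, MeasurableSet (A i)) → (∀ i, volume (A i) < ∞) →
    Pairwise (fun i j => Disjoint (A i) (A j)) → iIndepFun (fun i => M (A i)) P
  ae_tendsto_sum : ∀ A : ℕ → Set (E N), (∀ i, MeasurableSet (A i)) →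
    Pairwise (fun i j => Disjoint (A i) (A j)) → volume (⋃ i, A i) < ∞ →
    ∀ᵐ ω ∂P, Tendsto (fun n => ∑ i ∈ Finset.range n, M (A i) ω) atTop (𝓝 (M (⋃ i, A i) ω))
  charFun_eq : ∀ A : Set (E N), MeasurableSet A → volume A < ∞ → ∀ θ : ℂ,
    ∫ ω, Complex.exp (Complex.I * ((starRingEnd ℂ θ * M A ω).re : ℂ)) ∂P
      = (Real.exp (-(‖θ‖ ^ α * (volume A).toReal)) : ℂ)

/-- The stochastic integral of a simple function (the value `0` contributes nothing). -/
def simpleIntegral (M : Set (E N) → Ω → ℂ) (g : SimpleFunc (E N) ℂ) (ω : Ω) : ℂ :=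
  ∑ c ∈ g.range, c * M (g ⁻¹' {c}) ω

/-- The random variable `X` is (a version of) the stochastic integral `∫ f dM` of
`f ∈ L^α(ℝ^N)`: it is the limit in probability of the integrals of simple functions that
converge to `f` in `L^α(ℝ^N)`. -/
def IsStableIntegral (α : ℝ) (P : Measure Ω) (M : Set (E N) → Ω → ℂ) (f : E N → ℂ)
    (X : Ω → ℂ) : Prop :=
  MemLp f (ENNReal.ofReal α) volume ∧ Measurable X ∧
    ∃ g : ℕ → SimpleFunc (E N) ℂ,
      (∀ n, MemLp (g n) (ENNReal.ofReal α) volume) ∧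
      Tendsto (fun n => eLpNorm (fun x => g n x - f x) (ENNReal.ofReal α) volume) atTop (𝓝 0) ∧
      TendstoInMeasure P (fun n => simpleIntegral M (g n)) atTop X

open Classical in
/-- The stochastic integral `∫ f dM`, well defined up to almost sure equality. -/
def stableIntegral (α : ℝ) (P : Measure Ω) (M : Set (E N) → Ω → ℂ) (f : E N → ℂ) : Ω → ℂ :=
  if h : ∃ X, IsStableIntegral α P M f X then h.choose else 0

/-- The harmonizable fractional stable sheet
`Z^H(t) = Re ∫ ∏_l (exp(i t_l λ_l) - 1) / |λ_l|^(H_l + 1/α) M(dλ)`. -/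
def sheet (α : ℝ) (H : Fin N → ℝ) (P : Measure Ω) (M : Set (E N) → Ω → ℂ) (t : E N) (ω : Ω) : ℝ :=
  (stableIntegral α P M (fun x => ∏ l, (Complex.exp (Complex.I * (t l * x l : ℝ)) - 1) /
    ((|x l| ^ (H l + 1 / α) : ℝ) : ℂ)) ω).re

end RandomMeasure

section Wavelet

/-- The Fourier transform `(2π)^(-1/2) ∫ exp(-i s ξ) ψ(s) ds`. -/
def hat (ψ : SchwartzMap ℝ ℝ) (ξ : ℝ) : ℂ :=
  ((Real.sqrt (2 * Real.pi))⁻¹ : ℂ) * ∫ s : ℝ, Complex.exp (-(Complex.I * (s * ξ : ℝ))) * (ψ s : ℂ)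

/-- A Lemarié–Meyer mother wavelet: a real-valued Schwartz function whose Fourier transform is
supported in the ring `2π/3 ≤ |ξ| ≤ 8π/3` and whose dilated translates
`2^(j/2) ψ(2^j x - k)` form an orthonormal basis of `L²(ℝ)`. -/
structure IsLemarieMeyer (ψ : SchwartzMap ℝ ℝ) : Prop where
  support_hat : ∀ ξ : ℝ, hat ψ ξ ≠ 0 → 2 * Real.pi / 3 ≤ |ξ| ∧ |ξ| ≤ 8 * Real.pi / 3
  hilbertBasis : ∃ b : HilbertBasis (ℤ × ℤ) ℂ (Lp ℂ 2 (volume : Measure ℝ)),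
    ∀ j k : ℤ, (b (j, k) : ℝ → ℂ) =ᵐ[volume]
      fun x => (((2 : ℝ) ^ ((j : ℝ) / 2) * ψ ((2 : ℝ) ^ j * x - k) : ℝ) : ℂ)

/-- `ψ^v(y) = ∫ exp(i y η) ψ^(η) / |η|^(v + 1/α) dη`. -/
def fracPrim (α : ℝ) (ψ : SchwartzMap ℝ ℝ) (v y : ℝ) : ℂ :=
  ∫ η : ℝ, Complex.exp (Complex.I * (y * η : ℝ)) * (hat ψ η / ((|η| ^ (v + 1 / α) : ℝ) : ℂ))

/-- The Fourier transform of `ψ_{j,k}`, normalized in `L^α`: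
`2^(-j/α) exp(-i k 2^(-j) ξ) ψ^(2^(-j) ξ)`. -/
def hatNormalized (α : ℝ) (ψ : SchwartzMap ℝ ℝ) (j k : ℤ) (ξ : ℝ) : ℂ :=
  (((2 : ℝ) ^ (-((j : ℝ) / α)) : ℝ) : ℂ) *
    Complex.exp (-(Complex.I * ((k : ℝ) * (2 : ℝ) ^ (-j) * ξ : ℝ))) * hat ψ ((2 : ℝ) ^ (-j) * ξ)

variable {N : ℕ} {Ω : Type*} [MeasurableSpace Ω]

/-- The coefficient `ε_{J,K} = ∫ conj (∏_l ψ^_{α,j_l,k_l}(λ_l)) M(dλ)`. -/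
def coeff (α : ℝ) (ψ : SchwartzMap ℝ ℝ) (P : Measure Ω) (M : Set (E N) → Ω → ℂ)
    (J K : Fin N → ℤ) : Ω → ℂ :=
  stableIntegral α P M
    (fun x => starRingEnd ℂ (∏ l, hatNormalized α ψ (J l) (K l) (x l)))

/-- The set of all `(J, K)` with `|j_l| ≤ n` and `|k_l| ≤ R 2^(n+1)` for every `l`;
see `mem_indexSet`. -/
def indexSet (N n : ℕ) (R : ℝ) : Finset ((Fin N → ℤ) × (Fin N → ℤ)) :=
  Fintype.piFinset (fun _ => Finset.Icc (-(n : ℤ)) n) ×ˢ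
    Fintype.piFinset (fun _ => Finset.Icc (-⌊R * 2 ^ (n + 1)⌋) ⌊R * 2 ^ (n + 1)⌋)

theorem mem_indexSet (N n : ℕ) (R : ℝ) (p : (Fin N → ℤ) × (Fin N → ℤ)) :
    p ∈ indexSet N n R ↔ ∀ l, |p.1 l| ≤ n ∧ |(p.2 l : ℝ)| ≤ R * 2 ^ (n + 1) := by
  have h : ∀ (k : ℤ) (x : ℝ), (-⌊x⌋ ≤ k ∧ k ≤ ⌊x⌋) ↔ |(k : ℝ)| ≤ x := fun k x => by
    rw [← abs_le, Int.le_floor, Int.cast_abs]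
  simp only [indexSet, Finset.mem_product, Fintype.mem_piFinset, Finset.mem_Icc, h, ← abs_le,
    ← forall_and]

/-- The truncated random wavelet series `U*_n`. -/
def partialSeries (α : ℝ) (H : Fin N → ℝ) (ψ : SchwartzMap ℝ ℝ) (P : Measure Ω)
    (M : Set (E N) → Ω → ℂ) (R : ℝ) (n : ℕ) (t : E N) (ω : Ω) : ℝ :=
  (∑ p ∈ indexSet N n R, (((2 : ℝ) ^ (-(∑ l, (p.1 l : ℝ) * H l)) : ℝ) : ℂ) *
    coeff α ψ P M p.1 p.2 ω *
      ∏ l, (fracPrim α ψ (H l) ((2 : ℝ) ^ (p.1 l) * t l - p.2 l) -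
        fracPrim α ψ (H l) (-(p.2 l : ℝ)))).re

end Wavelet

/-- The cube `[-R, R]^N`. -/
def cube (N : ℕ) (R : ℝ) : Set (E N) := {t | ∀ l, |t l| ≤ R}

/-- The norm of the Hölder space `C^γ(S)`: the supremum of `|f|` on `S` plus the least `γ`-Hölder
constant of `f` on `S`; it is finite if and only if `f ∈ C^γ(S)`. -/
def holderNorm {N : ℕ} (γ : ℝ≥0) (S : Set (E N)) (f : E N → ℝ) : ℝ≥0∞ :=
  (⨆ t ∈ S, ‖f t‖ₑ) + eHolderNorm γ (fun t : S => f t)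

end

end HFSS

/-!
An integral `∫ f dM` has the characteristic function `θ ↦ exp (-|θ|^α ‖f‖_α^α)`, so its tails are
of order `x^(-α)`. The functions `conj (∏ l, ψ^_{α,j_l,k_l})` all have comparable `L^α` norms, and
for a fixed scale `J` they are supported in one box. Hence the maximum of `|ε_{J,K}|` over many
positions `K` exceeds `x` with a probability controlled by the supports rather than by the
number of positions, and by Borel–Cantelli the coefficients almost surely grow so slowly in
`(J, K)` that the rapid decay of the increments of `ψ^v` makes the series converge in every Hölder
space of exponent smaller than `min H`.

The limit is identified coordinatewise. By Parseval, `2^(-j v) {ψ^v(2^j t - k) - ψ^v(-k)}` is the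
coefficient of the kernel `(exp(itξ) - 1) / |ξ|^(v + 1/α)` along `conj ψ^_{α,j,k}`, so the wavelet
expansion of the kernel converges to it almost everywhere, dominated by a multiple of
`min(1, |ξ|) / |ξ|^(v + 1/α)`, which is in `L^α`. The partial sums of the series are thus the
integrals of functions converging in `L^α(ℝ^N)` to the integrand of the sheet, and converge to it
in probability.
-/

namespace HFSS

/-! ### Isotropic stable random variables -/

section Stable

variable {Ω : Type*} [MeasurableSpace Ω] {P : Measure Ω} {α a : ℝ} {X : Ω → ℂ}

/-- `X` is an isotropic complex `α`-stable random variable. The parameter `a` is the `α`-th power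
of the usual scale parameter, so that it is additive over independent sums. -/
structure IsIsotropicStable (α : ℝ) (P : Measure Ω) (X : Ω → ℂ) (a : ℝ) : Prop where
  measurable : Measurable X
  charFun_eq : ∀ θ : ℂ, charFun (P.map X) θ = (Real.exp (-(‖θ‖ ^ α * a)) : ℂ)

namespace IsIsotropicStable

theorem const_mul (hX : IsIsotropicStable α P X a) (c : ℂ) :
    IsIsotropicStable α P (fun ω => c * X ω) (‖c‖ ^ α * a) where
  measurable := hX.measurable.const_mul c
  charFun_eq θ := by
    have hmul : charFun (P.map fun ω => c * X ω) θ = charFun (P.map X) (starRingEnd ℂ c * θ) := by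
      rw [charFun_apply, charFun_apply,
        integral_map (hX.measurable.const_mul c).aemeasurable (by fun_prop),
        integral_map hX.measurable.aemeasurable (by fun_prop)]
      refine integral_congr_ae (Eventually.of_forall fun ω => ?_)
      simp only [Complex.inner, _root_.map_mul]
      ring_nf
    rw [hmul, hX.charFun_eq, norm_mul, Complex.norm_conj,
      Real.mul_rpow (norm_nonneg _) (norm_nonneg _)]
    ring_nf

theorem sum {ι : Type*} [Fintype ι] {X : ι → Ω → ℂ} {a : ι → ℝ}
    (hX : ∀ i, IsIsotropicStable α P (X i) (a i)) (hindep : iIndepFun X P) :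
    IsIsotropicStable α P (fun ω => ∑ i, X i ω) (∑ i, a i) where
  measurable := Finset.measurable_fun_sum _ fun i _ => (hX i).measurable
  charFun_eq θ := by
    rw [hindep.charFun_map_fun_sum_eq_prod fun i => (hX i).measurable.aemeasurable,
      Finset.prod_apply, Finset.prod_congr rfl fun i _ => (hX i).charFun_eq θ, Finset.mul_sum,
      ← Finset.sum_neg_distrib, Real.exp_sum, Complex.ofReal_prod]

variable [IsProbabilityMeasure P]

theorem isProbabilityMeasure_map (hX : IsIsotropicStable α P X a) :
    IsProbabilityMeasure (P.map X) :=
  Measure.isProbabilityMeasure_map hX.measurable.aemeasurable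

theorem scale_nonneg (hX : IsIsotropicStable α P X a) : 0 ≤ a := by
  have := hX.isProbabilityMeasure_map
  have hle := norm_charFun_le_one (μ := P.map X) 1
  rw [hX.charFun_eq, Complex.norm_real, norm_one, Real.one_rpow, one_mul,
    Real.norm_of_nonneg (Real.exp_nonneg _), Real.exp_le_one_iff] at hle
  linarith

theorem norm_one_sub_charFun_le (hX : IsIsotropicStable α P X a) (θ : ℂ) :
    ‖1 - charFun (P.map X) θ‖ ≤ ‖θ‖ ^ α * a := by
  have hnonneg : 0 ≤ ‖θ‖ ^ α * a := mul_nonneg (by positivity) hX.scale_nonneg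
  have hexp_le : Real.exp (-(‖θ‖ ^ α * a)) ≤ 1 := Real.exp_le_one_iff.2 (neg_nonpos.2 hnonneg)
  rw [hX.charFun_eq, ← Complex.ofReal_one, ← Complex.ofReal_sub, Complex.norm_real,
    Real.norm_of_nonneg (sub_nonneg.2 hexp_le)]
  linarith [Real.add_one_le_exp (-(‖θ‖ ^ α * a))]

theorem measureReal_lt_abs_inner_le (hα : 0 ≤ α) (hX : IsIsotropicStable α P X a) {e : ℂ}
    (he : ‖e‖ = 1) {r : ℝ} (hr : 0 < r) :
    P.real {ω | r < |inner ℝ e (X ω)|} ≤ 2 * (2 / r) ^ α * a := by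
  have := hX.isProbabilityMeasure_map
  have hle := measureReal_abs_inner_gt_le_integral_charFun (μ := P.map X) (a := e) hr
  rw [map_measureReal_apply hX.measurable (measurableSet_lt measurable_const (by fun_prop))] at hle
  have hr' : 0 < r⁻¹ := inv_pos.2 hr
  have hint : ‖∫ t in (-2 * r⁻¹)..(2 * r⁻¹), 1 - charFun (P.map X) (t • e)‖ ≤
      ((2 / r) ^ α * a) * |2 * r⁻¹ - -2 * r⁻¹| := by
    refine intervalIntegral.norm_integral_le_of_norm_le_const fun t ht => ?_
    rw [Set.uIoc_of_le (by linarith)] at ht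
    have ht' : |t| ≤ 2 / r := by
      rw [div_eq_mul_inv]
      exact abs_le.2 ⟨by linarith [ht.1], ht.2⟩
    refine (hX.norm_one_sub_charFun_le _).trans ?_
    rw [norm_smul, he, mul_one, Real.norm_eq_abs]
    have := hX.scale_nonneg
    gcongr
  calc P.real {ω | r < |inner ℝ e (X ω)|}
      ≤ 2⁻¹ * r * (((2 / r) ^ α * a) * |2 * r⁻¹ - -2 * r⁻¹|) := by
        refine hle.trans ?_
        gcongr
    _ = 2 * (2 / r) ^ α * a := by
      rw [abs_of_pos (by linarith)]
      field_simp
      ring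

theorem measureReal_lt_norm_le (hα : 0 ≤ α) (hX : IsIsotropicStable α P X a) {u : ℝ}
    (hu : 0 < u) : P.real {ω | u < ‖X ω‖} ≤ 4 * (4 / u) ^ α * a := by
  have hsub : {ω | u < ‖X ω‖} ⊆
      {ω | u / 2 < |inner ℝ (1 : ℂ) (X ω)|} ∪ {ω | u / 2 < |inner ℝ Complex.I (X ω)|} := by
    intro ω (hω : u < ‖X ω‖)
    by_contra hsmall
    simp only [Set.mem_union, Set.mem_ofPred_eq, not_or, not_lt, Complex.inner, map_one, mul_one,
      Complex.conj_I, Complex.mul_re, Complex.neg_re, Complex.I_re, Complex.I_im, mul_zero, mul_neg,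
      zero_sub, neg_neg] at hsmall
    linarith [Complex.norm_le_abs_re_add_abs_im (X ω), hsmall.1, hsmall.2]
  calc P.real {ω | u < ‖X ω‖}
      ≤ 2 * (2 / (u / 2)) ^ α * a + 2 * (2 / (u / 2)) ^ α * a :=
        (measureReal_mono hsub).trans <| (measureReal_union_le _ _).trans <| add_le_add
          (hX.measureReal_lt_abs_inner_le hα norm_one (half_pos hu))
          (hX.measureReal_lt_abs_inner_le hα Complex.norm_I (half_pos hu))
    _ = 4 * (4 / u) ^ α * a := by
      rw [show 2 / (u / 2) = 4 / u by field_simp; norm_num]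
      ring

theorem ae_eq_zero (hX : IsIsotropicStable α P X 0) : ∀ᵐ ω ∂P, X ω = 0 := by
  have := hX.isProbabilityMeasure_map
  have hmap : P.map X = Measure.dirac 0 := by
    refine Measure.ext_of_charFun (funext fun θ => ?_)
    rw [hX.charFun_eq, charFun_dirac]
    simp
  refine ae_of_ae_map hX.measurable.aemeasurable (p := fun z => z = 0) ?_
  rw [hmap]
  exact (ae_dirac_iff (measurableSet_singleton 0)).2 rfl

theorem map_neg (hX : IsIsotropicStable α P X a) : P.map (fun ω => -X ω) = P.map X := by
  have := hX.isProbabilityMeasure_map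
  have : IsProbabilityMeasure (P.map fun ω => -X ω) :=
    Measure.isProbabilityMeasure_map hX.measurable.neg.aemeasurable
  refine Measure.ext_of_charFun (funext fun θ => ?_)
  have hneg : charFun (P.map fun ω => -X ω) θ = charFun (P.map X) (-θ) := by
    rw [charFun_apply, charFun_apply,
      integral_map (φ := fun ω => -X ω) hX.measurable.neg.aemeasurable (by fun_prop),
      integral_map hX.measurable.aemeasurable (by fun_prop)]
    simp
  rw [hneg, hX.charFun_eq, hX.charFun_eq, norm_neg]

end IsIsotropicStable

end Stable

/-! ### Integrals of simple functions -/

section SimpleIntegral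

variable {N : ℕ} {Ω : Type*} {M : Set (E N) → Ω → ℂ}

theorem simpleIntegral_eq_sum_subtype (g : SimpleFunc (E N) ℂ) (ω : Ω) :
    simpleIntegral M g ω =
      ∑ c : {c ∈ g.range | c ≠ 0}, (c : ℂ) * M (g ⁻¹' {(c : ℂ)}) ω := by
  classical
  rw [Finset.sum_coe_sort {c ∈ g.range | c ≠ 0} fun c => c * M (g ⁻¹' {c}) ω,
    Finset.sum_filter_of_ne (fun c _ hc => left_ne_zero_of_mul hc), simpleIntegral]

variable [MeasurableSpace Ω] {α : ℝ} {P : Measure Ω}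

namespace IsIsotropicStableMeasure

theorem isIsotropicStable (hM : IsIsotropicStableMeasure α P M) {A : Set (E N)}
    (hA : MeasurableSet A) (hA' : volume A < ∞) :
    IsIsotropicStable α P (M A) (volume.real A) where
  measurable := hM.measurable A hA hA'
  charFun_eq θ := by
    rw [charFun_apply, integral_map (hM.measurable A hA hA').aemeasurable (by fun_prop),
      Measure.real, ← hM.charFun_eq A hA hA' θ]
    refine integral_congr_ae (Eventually.of_forall fun ω => ?_)
    simp only [real_inner_comm, Complex.inner, mul_comm]

theorem iIndepFun_of_pairwise_disjoint (hM : IsIsotropicStableMeasure α P M) {ι : Type*}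
    [Countable ι] {A : ι → Set (E N)} (hA : ∀ i, MeasurableSet (A i))
    (hA' : ∀ i, volume (A i) < ∞) (hd : Pairwise (Function.onFun Disjoint A)) :
    iIndepFun (fun i => M (A i)) P := by
  obtain ⟨e, he⟩ := exists_injective_nat ι
  have hB (p : Set (E N) → Prop) (hp : p ∅) (hpA : ∀ i, p (A i)) (n : ℕ) :
      p (Function.extend e A ⊥ n) := by
    by_cases hn : ∃ i, e i = n
    · obtain ⟨i, rfl⟩ := hn
      rw [he.extend_apply]
      exact hpA i
    · rw [Function.extend_apply' _ _ _ hn]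
      exact hp
  have hindep := (hM.indep (Function.extend e A ⊥) (hB _ MeasurableSet.empty hA)
    (hB (volume · < ∞) (by simp) hA') (hd.disjoint_extend_bot (he.factorsThrough A))).precomp he
  simpa only [he.extend_apply] using hindep

variable [IsProbabilityMeasure P]

theorem ae_empty (hM : IsIsotropicStableMeasure α P M) : ∀ᵐ ω ∂P, M ∅ ω = 0 := by
  have hempty := hM.isIsotropicStable (A := ∅) MeasurableSet.empty (by simp)
  rw [measureReal_empty] at hempty
  exact hempty.ae_eq_zero

theorem ae_iUnion (hM : IsIsotropicStableMeasure α P M) {ι : Type*} [Fintype ι]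
    {A : ι → Set (E N)} (hA : ∀ i, MeasurableSet (A i)) (hA' : ∀ i, volume (A i) < ∞)
    (hd : Pairwise (Function.onFun Disjoint A)) :
    ∀ᵐ ω ∂P, M (⋃ i, A i) ω = ∑ i, M (A i) ω := by
  let e : ι → ℕ := fun i => Fintype.equivFin ι i
  have he : Function.Injective e := Fin.val_injective.comp (Fintype.equivFin ι).injective
  let B : ℕ → Set (E N) := Function.extend e A ⊥
  have hB : ∀ n, MeasurableSet (B n) := fun n => by
    by_cases hn : ∃ i, e i = n
    · obtain ⟨i, rfl⟩ := hn
      simpa only [B, he.extend_apply] using hA i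
    · simp only [B, Function.extend_apply' _ _ _ hn, Pi.bot_apply, Set.bot_eq_empty,
        MeasurableSet.empty]
  have hU : ⋃ n, B n = ⋃ i, A i := iSup_extend_bot he A
  have hlim := hM.ae_tendsto_sum B hB (hd.disjoint_extend_bot (he.factorsThrough A))
    (by rw [hU, ← Set.biUnion_univ]; exact measure_biUnion_lt_top Set.finite_univ fun i _ => hA' i)
  rw [hU] at hlim
  filter_upwards [hlim, hM.ae_empty] with ω hlimω hemptyω
  refine tendsto_nhds_unique hlimω (tendsto_const_nhds.congr' ?_)
  filter_upwards [eventually_ge_atTop (Fintype.card ι)] with n hn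
  refine Finset.sum_of_injOn e he.injOn
    (fun i _ => Finset.mem_coe.2 (Finset.mem_range.2 ((Fintype.equivFin ι i).2.trans_le hn)))
    (fun k _ hk => ?_) fun i _ => by simp only [B, he.extend_apply]
  rw [Finset.coe_univ, Set.image_univ, Set.mem_range] at hk
  simp only [B, Function.extend_apply' _ _ _ hk, Pi.bot_apply, Set.bot_eq_empty, hemptyω]

end IsIsotropicStableMeasure

theorem volume_fiber_lt_top (hα0 : 0 < α) {g : SimpleFunc (E N) ℂ}
    (hg : MemLp g (ENNReal.ofReal α) volume) {c : ℂ} (hc : c ≠ 0) : volume (g ⁻¹' {c}) < ∞ :=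
  SimpleFunc.measure_preimage_lt_top_of_memLp (by simpa) (by simp) g hg c hc

theorem pairwise_disjoint_fiber {X β : Type*} (g : X → β) {s : Set β} :
    Pairwise (Function.onFun Disjoint fun b : s => g ⁻¹' {(b : β)}) := fun b b' hbb' =>
  Disjoint.preimage _ (by simpa [Subtype.ext_iff] using hbb')

theorem measurable_simpleIntegral (hM : IsIsotropicStableMeasure α P M) (hα0 : 0 < α)
    {g : SimpleFunc (E N) ℂ} (hg : MemLp g (ENNReal.ofReal α) volume) :
    Measurable (simpleIntegral M g) := by
  refine Finset.measurable_fun_sum _ fun c _ => ?_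
  rcases eq_or_ne c 0 with rfl | hc
  · simp
  · exact (hM.measurable _ (g.measurableSet_fiber c) (volume_fiber_lt_top hα0 hg hc)).const_mul c

theorem integral_norm_rpow_eq_sum (hα0 : 0 < α) {g : SimpleFunc (E N) ℂ}
    (hg : MemLp g (ENNReal.ofReal α) volume) :
    ∫ x, ‖g x‖ ^ α =
      ∑ c : {c ∈ g.range | c ≠ 0}, ‖(c : ℂ)‖ ^ α * volume.real (g ⁻¹' {(c : ℂ)}) := by
  classical
  have hfin : g.FinMeasSupp volume := SimpleFunc.finMeasSupp_iff.2 fun c hc =>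
    volume_fiber_lt_top hα0 hg hc
  rw [Finset.sum_coe_sort {c ∈ g.range | c ≠ 0} fun c => ‖c‖ ^ α * volume.real (g ⁻¹' {c}),
    Finset.sum_filter_of_ne (p := fun c : ℂ => c ≠ 0) (fun c _ hc => by
      rintro rfl
      simp [Real.zero_rpow hα0.ne'] at hc)]
  have hmap := SimpleFunc.map_integral g (fun c => ‖c‖ ^ α)
    ((SimpleFunc.integrable_iff_finMeasSupp).2 hfin) (by simp [Real.zero_rpow hα0.ne'])
  rw [SimpleFunc.integral_eq_integral _ (SimpleFunc.integrable_iff_finMeasSupp.2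
    (hfin.map (by simp [Real.zero_rpow hα0.ne'])))] at hmap
  simpa only [SimpleFunc.map_apply, smul_eq_mul, mul_comm] using hmap

theorem isIsotropicStable_simpleIntegral (hM : IsIsotropicStableMeasure α P M) (hα0 : 0 < α)
    {g : SimpleFunc (E N) ℂ} (hg : MemLp g (ENNReal.ofReal α) volume) :
    IsIsotropicStable α P (simpleIntegral M g) (∫ x, ‖g x‖ ^ α) := by
  let s : Finset ℂ := {c ∈ g.range | c ≠ 0}
  have hfin (c : s) : volume (g ⁻¹' {(c : ℂ)}) < ∞ :=
    volume_fiber_lt_top hα0 hg (Finset.mem_filter.1 c.2).2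
  have hindep : iIndepFun (fun (c : s) ω => (c : ℂ) * M (g ⁻¹' {(c : ℂ)}) ω) P :=
    (hM.iIndepFun_of_pairwise_disjoint (fun c : s => g.measurableSet_fiber c) hfin
      (pairwise_disjoint_fiber g)).comp (fun c z => (c : ℂ) * z) fun c => by fun_prop
  rw [integral_norm_rpow_eq_sum hα0 hg, funext (simpleIntegral_eq_sum_subtype g)]
  exact IsIsotropicStable.sum
    (fun c : s => (hM.isIsotropicStable (g.measurableSet_fiber c) (hfin c)).const_mul (c : ℂ))
    hindep

theorem volume_pair_fiber_lt_top (hα0 : 0 < α) {g h : SimpleFunc (E N) ℂ}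
    (hg : MemLp g (ENNReal.ofReal α) volume) (hh : MemLp h (ENNReal.ofReal α) volume)
    {z : ℂ × ℂ} (hz : z ≠ 0) : volume ((g.pair h) ⁻¹' {z}) < ∞ := by
  obtain ⟨z, w⟩ := z
  rw [SimpleFunc.pair_preimage_singleton]
  rcases eq_or_ne z 0 with rfl | hz'
  · have hw : w ≠ 0 := fun hw => hz (by rw [hw, Prod.mk_zero_zero])
    exact (measure_mono Set.inter_subset_right).trans_lt (volume_fiber_lt_top hα0 hh hw)
  · exact (measure_mono Set.inter_subset_left).trans_lt (volume_fiber_lt_top hα0 hg hz')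

variable [IsProbabilityMeasure P]

theorem simpleIntegral_map (hM : IsIsotropicStableMeasure α P M) {β : Type*}
    (g : SimpleFunc (E N) β) (φ : β → ℂ)
    (hg : ∀ b ∈ g.range, φ b ≠ 0 → volume (g ⁻¹' {b}) < ∞) :
    ∀ᵐ ω ∂P, simpleIntegral M (g.map φ) ω = ∑ b ∈ g.range, φ b * M (g ⁻¹' {b}) ω := by
  classical
  have hfiber (c : ℂ) : ∀ᵐ ω ∂P, c * M ((g.map φ) ⁻¹' {c}) ω =
      ∑ b ∈ g.range with φ b = c, φ b * M (g ⁻¹' {b}) ω := by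
    have hcongr (ω : Ω) : ∑ b ∈ g.range with φ b = c, φ b * M (g ⁻¹' {b}) ω =
        c * ∑ b ∈ g.range with φ b = c, M (g ⁻¹' {b}) ω := by
      rw [Finset.mul_sum]
      exact Finset.sum_congr rfl fun b hb => by rw [(Finset.mem_filter.1 hb).2]
    rcases eq_or_ne c 0 with rfl | hc
    · exact Eventually.of_forall fun ω => by rw [hcongr, zero_mul, zero_mul]
    filter_upwards [hM.ae_iUnion (A := fun b : {b ∈ g.range | φ b = c} => g ⁻¹' {(b : β)})
      (fun b => g.measurableSet_fiber b)
      (fun b => hg b (Finset.mem_filter.1 b.2).1 (by rwa [(Finset.mem_filter.1 b.2).2]))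
      (pairwise_disjoint_fiber g)] with ω hω
    have hpreimage : (g.map φ) ⁻¹' {c} = ⋃ b : {b ∈ g.range | φ b = c}, g ⁻¹' {(b : β)} := by
      rw [SimpleFunc.map_preimage_singleton]
      ext x
      simp
    rw [hcongr, hpreimage, hω, Finset.sum_coe_sort {b ∈ g.range | φ b = c}
      fun b => M (g ⁻¹' {b}) ω]
  filter_upwards [(ae_ball_iff (g.map φ).range.countable_toSet).2 fun c _ => hfiber c] with ω hω
  rw [simpleIntegral, Finset.sum_congr rfl hω]
  refine Finset.sum_fiberwise_of_maps_to (fun b hb => ?_) _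
  rw [SimpleFunc.range_map]
  exact Finset.mem_image_of_mem _ hb

theorem measure_lt_norm_simpleIntegral_le (hM : IsIsotropicStableMeasure α P M) (hα0 : 0 < α)
    {g : SimpleFunc (E N) ℂ} (hg : MemLp g (ENNReal.ofReal α) volume) {u : ℝ} (hu : 0 < u) :
    P {ω | u < ‖simpleIntegral M g ω‖} ≤
      ENNReal.ofReal (4 * (4 / u) ^ α) * eLpNorm g (ENNReal.ofReal α) volume ^ α := by
  have hscale : eLpNorm g (ENNReal.ofReal α) volume ^ α = ENNReal.ofReal (∫ x, ‖g x‖ ^ α) := by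
    rw [hg.eLpNorm_eq_integral_rpow_norm (by simpa) (by simp), ENNReal.toReal_ofReal hα0.le,
      ENNReal.ofReal_rpow_of_nonneg (by positivity) hα0.le,
      Real.rpow_inv_rpow (by positivity) hα0.ne']
  rw [hscale, ← ENNReal.ofReal_mul (by positivity), ← ofReal_measureReal]
  exact ENNReal.ofReal_le_ofReal
    ((isIsotropicStable_simpleIntegral hM hα0 hg).measureReal_lt_norm_le hα0.le hu)

theorem simpleIntegral_linComb (hM : IsIsotropicStableMeasure α P M) (hα0 : 0 < α)
    {g h : SimpleFunc (E N) ℂ} (hg : MemLp g (ENNReal.ofReal α) volume)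
    (hh : MemLp h (ENNReal.ofReal α) volume) (a b : ℂ) :
    ∀ᵐ ω ∂P, simpleIntegral M (a • g + b • h) ω =
      a * simpleIntegral M g ω + b * simpleIntegral M h ω := by
  have hmap (φ : ℂ × ℂ → ℂ) (hφ : φ 0 = 0) : ∀ᵐ ω ∂P, simpleIntegral M ((g.pair h).map φ) ω =
      ∑ z ∈ (g.pair h).range, φ z * M ((g.pair h) ⁻¹' {z}) ω :=
    simpleIntegral_map hM (g.pair h) φ fun z _ hz => volume_pair_fiber_lt_top hα0 hg hh
      (by rintro rfl; exact hz hφ)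
  filter_upwards [hmap Prod.fst rfl, hmap Prod.snd rfl, hmap (fun z => a * z.1 + b * z.2) (by simp)]
    with ω hfst hsnd hcomb
  rw [SimpleFunc.map_fst_pair] at hfst
  rw [SimpleFunc.map_snd_pair] at hsnd
  have hsmul : a • g + b • h = (g.pair h).map fun z => a * z.1 + b * z.2 := by
    ext x
    simp
  rw [hsmul, hfst, hsnd, hcomb, Finset.mul_sum, Finset.mul_sum, ← Finset.sum_add_distrib]
  exact Finset.sum_congr rfl fun z _ => by ring

end SimpleIntegral

/-! ### The stochastic integral -/

section Convergence

variable {Ω : Type*} [MeasurableSpace Ω] {P : Measure Ω}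

theorem tendstoInMeasure_prodMk_comp [IsFiniteMeasure P] {β γ δ : Type*} [PseudoEMetricSpace β]
    [PseudoEMetricSpace γ] [PseudoEMetricSpace δ] {φ : β × γ → δ} (hφ : Continuous φ)
    {f : ℕ → Ω → β} {f' : Ω → β} {g : ℕ → Ω → γ} {g' : Ω → γ}
    (hf : ∀ n, AEStronglyMeasurable (f n) P) (hg : ∀ n, AEStronglyMeasurable (g n) P)
    (hff' : TendstoInMeasure P f atTop f') (hgg' : TendstoInMeasure P g atTop g') :
    TendstoInMeasure P (fun n ω => φ (f n ω, g n ω)) atTop fun ω => φ (f' ω, g' ω) := by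
  refine (exists_seq_tendstoInMeasure_atTop_iff fun n =>
    hφ.comp_aestronglyMeasurable ((hf n).prodMk (hg n))).2 fun ns hns => ?_
  obtain ⟨ms, hms, hlim_f⟩ := (hff'.comp hns.tendsto_atTop).exists_seq_tendsto_ae
  obtain ⟨ks, hks, hlim_g⟩ := (hgg'.comp (hns.comp hms).tendsto_atTop).exists_seq_tendsto_ae
  refine ⟨ms ∘ ks, hms.comp hks, ?_⟩
  filter_upwards [hlim_f, hlim_g] with ω hfω hgω
  exact (hφ.tendsto _).comp ((hfω.comp hks.tendsto_atTop).prodMk_nhds hgω)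

theorem exists_measurable_ae_tendsto_of_tsum_ne_top {F : Type*} [NormedAddCommGroup F]
    [CompleteSpace F] [MeasurableSpace F] [BorelSpace F] {Y : ℕ → Ω → F}
    (hY : ∀ n, Measurable (Y n))
    (hsum : ∑' n, P {ω | (1 / 2 : ℝ) ^ n < ‖Y (n + 1) ω - Y n ω‖} ≠ ∞) :
    ∃ X : Ω → F, Measurable X ∧ ∀ᵐ ω ∂P, Tendsto (fun n => Y n ω) atTop (𝓝 (X ω)) := by
  refine measurable_limit_of_tendsto_metrizable_ae (fun n => (hY n).aemeasurable) ?_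
  filter_upwards [ae_eventually_notMem hsum] with ω hω
  have hsummable : Summable fun n => dist (Y n ω) (Y n.succ ω) := by
    refine summable_geometric_two.of_norm_bounded_eventually_nat ?_
    filter_upwards [hω] with n hn
    rw [Real.norm_of_nonneg dist_nonneg, dist_comm, dist_eq_norm]
    exact not_lt.1 hn
  exact cauchySeq_tendsto_of_complete (cauchySeq_of_summable_dist hsummable)

end Convergence

section LpConvergence

variable {X : Type*} [MeasurableSpace X] {μ : Measure X} {p : ℝ≥0∞}

theorem tendsto_eLpNorm_linComb {u v : ℕ → X → ℂ} {f g : X → ℂ}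
    (hu : ∀ n, AEStronglyMeasurable (u n) μ) (hv : ∀ n, AEStronglyMeasurable (v n) μ)
    (hf : AEStronglyMeasurable f μ) (hg : AEStronglyMeasurable g μ)
    (huf : Tendsto (fun n => eLpNorm (fun x => u n x - f x) p μ) atTop (𝓝 0))
    (hvg : Tendsto (fun n => eLpNorm (fun x => v n x - g x) p μ) atTop (𝓝 0)) (a b : ℂ) :
    Tendsto (fun n => eLpNorm (fun x => (a • u n + b • v n) x - (a * f x + b * g x)) p μ)
      atTop (𝓝 0) := by
  have hbound : Tendsto (fun n => ENNReal.LpAddConst p *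
      (‖a‖ₑ * eLpNorm (fun x => u n x - f x) p μ +
        ‖b‖ₑ * eLpNorm (fun x => v n x - g x) p μ)) atTop (𝓝 0) := by
    have hsum := (ENNReal.Tendsto.const_mul (a := ‖a‖ₑ) huf (Or.inr (by simp))).add
      (ENNReal.Tendsto.const_mul (a := ‖b‖ₑ) hvg (Or.inr (by simp)))
    simpa using ENNReal.Tendsto.const_mul hsum (Or.inr (ENNReal.LpAddConst_lt_top p).ne)
  refine tendsto_of_tendsto_of_tendsto_of_le_of_le tendsto_const_nhds hbound (fun _ => zero_le)
    fun n => ?_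
  have hsplit : (fun x => (a • u n + b • v n) x - (a * f x + b * g x)) =
      (a • fun x => u n x - f x) + b • fun x => v n x - g x := by
    funext x
    simp only [Pi.add_apply, Pi.smul_apply, smul_eq_mul]
    ring
  simp only [hsplit]
  refine (eLpNorm_add_le' (((hu n).sub hf).const_smul a) (((hv n).sub hg).const_smul b) p).trans ?_
  gcongr <;> exact eLpNorm_const_smul_le

theorem eLpNorm_sub_le_of_eLpNorm_sub_le {F : Type*} [NormedAddCommGroup F] {f g h : X → F}
    (hf : AEStronglyMeasurable f μ) (hg : AEStronglyMeasurable g μ) (hh : AEStronglyMeasurable h μ)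
    {δ : ℝ} (hδ : 0 ≤ δ) (hfg : eLpNorm (f - g) p μ ≤ ENNReal.ofReal δ)
    (hfh : eLpNorm (f - h) p μ ≤ ENNReal.ofReal δ) :
    eLpNorm (g - h) p μ ≤ ENNReal.ofReal (2 * (ENNReal.LpAddConst p).toReal * δ) := by
  have hadd := eLpNorm_add_le' (hg.sub hf) (hf.sub hh) p
  rw [sub_add_sub_cancel, eLpNorm_sub_comm g f] at hadd
  refine hadd.trans ?_
  rw [show 2 * (ENNReal.LpAddConst p).toReal * δ = (ENNReal.LpAddConst p).toReal * (δ + δ) by ring,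
    ENNReal.ofReal_mul ENNReal.toReal_nonneg, ENNReal.ofReal_add hδ hδ,
    ENNReal.ofReal_toReal (ENNReal.LpAddConst_lt_top p).ne]
  gcongr

end LpConvergence

section StableIntegral

variable {N : ℕ} {Ω : Type*} [MeasurableSpace Ω] {α : ℝ} {P : Measure Ω} {M : Set (E N) → Ω → ℂ}

theorem measurable_stableIntegral (f : E N → ℂ) : Measurable (stableIntegral α P M f) := by
  rw [stableIntegral]
  split_ifs with h
  · exact h.choose_spec.2.1
  · exact measurable_const

variable [IsProbabilityMeasure P]

theorem IsStableIntegral.linComb (hM : IsIsotropicStableMeasure α P M) (hα0 : 0 < α)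
    {f g : E N → ℂ} {X Y : Ω → ℂ} (hX : IsStableIntegral α P M f X)
    (hY : IsStableIntegral α P M g Y) (a b : ℂ) :
    IsStableIntegral α P M (fun x => a * f x + b * g x) (fun ω => a * X ω + b * Y ω) := by
  obtain ⟨hf, hXm, u, hu, huf, huX⟩ := hX
  obtain ⟨hg, hYm, v, hv, hvg, hvY⟩ := hY
  refine ⟨(hf.const_mul a).add (hg.const_mul b), (hXm.const_mul a).add (hYm.const_mul b),
    fun n => a • u n + b • v n, fun n => ((hu n).const_smul a).add ((hv n).const_smul b),
    tendsto_eLpNorm_linComb (fun n => (hu n).1) (fun n => (hv n).1) hf.1 hg.1 huf hvg a b, ?_⟩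
  refine (tendstoInMeasure_prodMk_comp (φ := fun z => a * z.1 + b * z.2) (by fun_prop)
    (fun n => (measurable_simpleIntegral hM hα0 (hu n)).aestronglyMeasurable)
    (fun n => (measurable_simpleIntegral hM hα0 (hv n)).aestronglyMeasurable) huX hvY).congr_left
    fun n => ?_
  filter_upwards [simpleIntegral_linComb hM hα0 (hu n) (hv n) a b] with ω hω
  exact hω.symm

theorem IsStableIntegral.measure_le_norm_le (hM : IsIsotropicStableMeasure α P M) (hα0 : 0 < α)
    {f : E N → ℂ} {X : Ω → ℂ} (hX : IsStableIntegral α P M f X) {u : ℝ} (hu : 0 < u) :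
    P {ω | u ≤ ‖X ω‖} ≤ ENNReal.ofReal (4 * (8 / u) ^ α) *
      (ENNReal.LpAddConst (ENNReal.ofReal α) * eLpNorm f (ENNReal.ofReal α) volume) ^ α := by
  obtain ⟨hf, -, g, hg, hgf, hgX⟩ := hX
  have hlim : Tendsto (fun n => ENNReal.ofReal (4 * (8 / u) ^ α) *
      (ENNReal.LpAddConst (ENNReal.ofReal α) * (eLpNorm (fun x => g n x - f x) (ENNReal.ofReal α)
        volume + eLpNorm f (ENNReal.ofReal α) volume)) ^ α +
        P {ω | u / 2 ≤ ‖simpleIntegral M (g n) ω - X ω‖}) atTop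
      (𝓝 (ENNReal.ofReal (4 * (8 / u) ^ α) * (ENNReal.LpAddConst (ENNReal.ofReal α) *
        (0 + eLpNorm f (ENNReal.ofReal α) volume)) ^ α + 0)) := by
    refine Tendsto.add ?_ (tendstoInMeasure_iff_norm.1 hgX (u / 2) (by positivity))
    refine ENNReal.Tendsto.const_mul ?_ (Or.inr ENNReal.ofReal_ne_top)
    refine (ENNReal.continuous_rpow_const.tendsto _).comp ?_
    exact ENNReal.Tendsto.const_mul (hgf.add tendsto_const_nhds)
      (Or.inr (ENNReal.LpAddConst_lt_top _).ne)
  rw [zero_add, add_zero] at hlim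
  refine ge_of_tendsto' hlim fun n => ?_
  have hsub : {ω | u ≤ ‖X ω‖} ⊆ {ω | u / 2 < ‖simpleIntegral M (g n) ω‖} ∪
      {ω | u / 2 ≤ ‖simpleIntegral M (g n) ω - X ω‖} := by
    intro ω (hω : u ≤ ‖X ω‖)
    by_contra hsmall
    simp only [Set.mem_union, Set.mem_ofPred_eq, not_or, not_le, not_lt] at hsmall
    have htri := norm_sub_le (simpleIntegral M (g n) ω) (simpleIntegral M (g n) ω - X ω)
    rw [sub_sub_cancel] at htri
    linarith [hsmall.1, hsmall.2]
  refine (measure_mono hsub).trans ((measure_union_le _ _).trans ?_)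
  have htail := measure_lt_norm_simpleIntegral_le hM hα0 (hg n) (half_pos hu)
  rw [show 4 / (u / 2) = 8 / u by field_simp; norm_num] at htail
  gcongr
  refine htail.trans ?_
  gcongr
  have hadd := eLpNorm_add_le' ((hg n).1.sub hf.1) hf.1 (ENNReal.ofReal α)
  rwa [sub_add_cancel] at hadd

theorem IsStableIntegral.tendstoInMeasure (hM : IsIsotropicStableMeasure α P M) (hα0 : 0 < α)
    {f : ℕ → E N → ℂ} {f' : E N → ℂ} {X : ℕ → Ω → ℂ} {X' : Ω → ℂ}
    (hX : ∀ n, IsStableIntegral α P M (f n) (X n)) (hX' : IsStableIntegral α P M f' X')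
    (h : Tendsto (fun n => eLpNorm (fun x => f n x - f' x) (ENNReal.ofReal α) volume) atTop (𝓝 0)) :
    TendstoInMeasure P X atTop X' := by
  rw [tendstoInMeasure_iff_norm]
  intro ε hε
  have hlim : Tendsto (fun n => ENNReal.ofReal (4 * (8 / ε) ^ α) *
      (ENNReal.LpAddConst (ENNReal.ofReal α) *
        eLpNorm (fun x => f n x - f' x) (ENNReal.ofReal α) volume) ^ α) atTop
      (𝓝 (ENNReal.ofReal (4 * (8 / ε) ^ α) *
        (ENNReal.LpAddConst (ENNReal.ofReal α) * 0) ^ α)) := by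
    refine ENNReal.Tendsto.const_mul ?_ (Or.inr ENNReal.ofReal_ne_top)
    refine (ENNReal.continuous_rpow_const.tendsto _).comp ?_
    exact ENNReal.Tendsto.const_mul h (Or.inr (ENNReal.LpAddConst_lt_top _).ne)
  rw [mul_zero, ENNReal.zero_rpow_of_pos hα0, mul_zero] at hlim
  refine tendsto_of_tendsto_of_tendsto_of_le_of_le tendsto_const_nhds hlim (fun _ => zero_le)
    fun n => ?_
  have htail := ((hX n).linComb hM hα0 hX' 1 (-1)).measure_le_norm_le hM hα0 hε
  simpa only [one_mul, neg_one_mul, ← sub_eq_add_neg] using htail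

theorem measure_lt_norm_simpleIntegral_sub_le (hM : IsIsotropicStableMeasure α P M) (hα0 : 0 < α)
    {g h : SimpleFunc (E N) ℂ} (hg : MemLp g (ENNReal.ofReal α) volume)
    (hh : MemLp h (ENNReal.ofReal α) volume) {u : ℝ} (hu : 0 < u) :
    P {ω | u < ‖simpleIntegral M g ω - simpleIntegral M h ω‖} ≤
      ENNReal.ofReal (4 * (4 / u) ^ α) * eLpNorm (⇑g - ⇑h) (ENNReal.ofReal α) volume ^ α := by
  have hcomb : ⇑((1 : ℂ) • g + (-1 : ℂ) • h) = ⇑g - ⇑h := by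
    ext x
    simp [sub_eq_add_neg]
  have htail := measure_lt_norm_simpleIntegral_le hM hα0 (g := (1 : ℂ) • g + (-1 : ℂ) • h)
    (by rw [hcomb]; exact hg.sub hh) hu
  rw [hcomb] at htail
  refine (measure_mono_ae ?_).trans htail
  filter_upwards [simpleIntegral_linComb hM hα0 hg hh 1 (-1)] with ω hω
  intro (hlt : u < _)
  change u < _
  rwa [hω, one_mul, neg_one_mul, ← sub_eq_add_neg]

theorem tsum_measure_lt_norm_simpleIntegral_sub_ne_top (hM : IsIsotropicStableMeasure α P M)
    (hα0 : 0 < α) {g : ℕ → SimpleFunc (E N) ℂ} (hg : ∀ n, MemLp (g n) (ENNReal.ofReal α) volume)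
    {C : ℝ} (hC : 0 ≤ C) (hgC : ∀ n, eLpNorm (⇑(g (n + 1)) - ⇑(g n)) (ENNReal.ofReal α) volume ≤
      ENNReal.ofReal (C * (1 / 4) ^ n)) :
    ∑' n, P {ω | (1 / 2) ^ n < ‖simpleIntegral M (g (n + 1)) ω - simpleIntegral M (g n) ω‖} ≠
      ∞ := by
  have hsummable : Summable fun n : ℕ => 4 * (4 * C) ^ α * ((1 / 2 : ℝ) ^ α) ^ n :=
    (summable_geometric_of_lt_one (by positivity)
      (Real.rpow_lt_one (by norm_num) (by norm_num) hα0)).mul_left _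
  refine ne_top_of_le_ne_top hsummable.tsum_ofReal_ne_top (ENNReal.tsum_le_tsum fun n => ?_)
  have hpow : (4 / (1 / 2 : ℝ) ^ n) ^ α * (C * (1 / 4) ^ n) ^ α =
      (4 * C) ^ α * ((1 / 2 : ℝ) ^ α) ^ n := by
    rw [Real.rpow_pow_comm (by norm_num), ← Real.mul_rpow (by positivity) (by positivity),
      ← Real.mul_rpow (by positivity) (by positivity),
      show (1 / 4 : ℝ) = 1 / 2 * (1 / 2) by norm_num, mul_pow]
    field_simp
  calc P {ω | (1 / 2) ^ n < ‖simpleIntegral M (g (n + 1)) ω - simpleIntegral M (g n) ω‖}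
      ≤ ENNReal.ofReal (4 * (4 / (1 / 2) ^ n) ^ α) * ENNReal.ofReal (C * (1 / 4) ^ n) ^ α := by
        refine (measure_lt_norm_simpleIntegral_sub_le hM hα0 (hg _) (hg _) (by positivity)).trans ?_
        gcongr
        exact hgC n
    _ = ENNReal.ofReal (4 * (4 * C) ^ α * ((1 / 2 : ℝ) ^ α) ^ n) := by
      rw [ENNReal.ofReal_rpow_of_nonneg (by positivity) hα0.le,
        ← ENNReal.ofReal_mul (by positivity), mul_assoc, hpow, mul_assoc]

theorem exists_isStableIntegral (hM : IsIsotropicStableMeasure α P M) (hα0 : 0 < α)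
    {f : E N → ℂ} (hf : MemLp f (ENNReal.ofReal α) volume) : ∃ X, IsStableIntegral α P M f X := by
  have happrox (n : ℕ) : ∃ g : SimpleFunc (E N) ℂ,
      eLpNorm (f - ⇑g) (ENNReal.ofReal α) volume < ENNReal.ofReal ((1 / 4) ^ n) ∧
        MemLp g (ENNReal.ofReal α) volume :=
    hf.exists_simpleFunc_eLpNorm_sub_lt (by simp)
      (by rw [Ne, ENNReal.ofReal_eq_zero, not_le]; positivity)
  choose g hfg hg using happrox
  have hsum := tsum_measure_lt_norm_simpleIntegral_sub_ne_top hM hα0 hg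
    (C := 2 * (ENNReal.LpAddConst (ENNReal.ofReal α)).toReal) (by positivity) fun n =>
      eLpNorm_sub_le_of_eLpNorm_sub_le hf.1 (hg _).1 (hg _).1 (by positivity)
        ((hfg (n + 1)).le.trans (ENNReal.ofReal_le_ofReal
          (pow_le_pow_of_le_one (by norm_num) (by norm_num) n.le_succ))) (hfg n).le
  have hmeas (n : ℕ) := measurable_simpleIntegral hM hα0 (hg n)
  obtain ⟨X, hXm, hX⟩ := exists_measurable_ae_tendsto_of_tsum_ne_top hmeas hsum
  refine ⟨X, hf, hXm, g, hg, ?_, tendstoInMeasure_of_tendsto_ae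
    (fun n => (hmeas n).aestronglyMeasurable) hX⟩
  have hgeom : Tendsto (fun n : ℕ => ENNReal.ofReal ((1 / 4) ^ n)) atTop (𝓝 0) := by
    rw [← ENNReal.ofReal_zero]
    exact ENNReal.tendsto_ofReal
      (tendsto_pow_atTop_nhds_zero_of_lt_one (by norm_num) (by norm_num))
  refine tendsto_of_tendsto_of_tendsto_of_le_of_le tendsto_const_nhds hgeom (fun _ => zero_le)
    fun n => ?_
  exact (eLpNorm_sub_comm (⇑(g n)) f _ _).trans_le (hfg n).le

theorem isStableIntegral_stableIntegral (hM : IsIsotropicStableMeasure α P M) (hα0 : 0 < α)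
    {f : E N → ℂ} (hf : MemLp f (ENNReal.ofReal α) volume) :
    IsStableIntegral α P M f (stableIntegral α P M f) := by
  have hex := exists_isStableIntegral hM hα0 hf
  rw [stableIntegral, dif_pos hex]
  exact hex.choose_spec

theorem isStableIntegral_simpleIntegral (hM : IsIsotropicStableMeasure α P M) (hα0 : 0 < α)
    {g : SimpleFunc (E N) ℂ} (hg : MemLp g (ENNReal.ofReal α) volume) :
    IsStableIntegral α P M g (simpleIntegral M g) :=
  ⟨hg, measurable_simpleIntegral hM hα0 hg, fun _ => g, fun _ => hg, by simp,
    tendstoInMeasure_of_tendsto_ae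
      (fun _ => (measurable_simpleIntegral hM hα0 hg).aestronglyMeasurable)
      (Eventually.of_forall fun _ => tendsto_const_nhds)⟩

theorem isStableIntegral_zero (hM : IsIsotropicStableMeasure α P M) (hα0 : 0 < α) :
    IsStableIntegral α P M (fun _ => 0) (fun _ => 0) := by
  have hzero : simpleIntegral M (0 : SimpleFunc (E N) ℂ) = fun _ => 0 := by
    funext ω
    refine Finset.sum_eq_zero fun c hc => ?_
    obtain ⟨x, rfl⟩ := SimpleFunc.mem_range.1 hc
    rw [SimpleFunc.coe_zero, Pi.zero_apply, zero_mul]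
  rw [← hzero]
  exact isStableIntegral_simpleIntegral hM hα0 (g := 0) MemLp.zero

theorem IsStableIntegral.sum (hM : IsIsotropicStableMeasure α P M) (hα0 : 0 < α) {ι : Type*}
    (s : Finset ι) (c : ι → ℂ) {f : ι → E N → ℂ} {X : ι → Ω → ℂ}
    (h : ∀ i ∈ s, IsStableIntegral α P M (f i) (X i)) :
    IsStableIntegral α P M (fun x => ∑ i ∈ s, c i * f i x) (fun ω => ∑ i ∈ s, c i * X i ω) := by
  classical
  induction s using Finset.induction_on with
  | empty => simpa using isStableIntegral_zero hM hα0
  | insert i s hi ih =>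
    have hinsert := (h i (Finset.mem_insert_self i s)).linComb hM hα0
      (ih fun j hj => h j (Finset.mem_insert_of_mem hj)) (c i) 1
    simpa only [Finset.sum_insert hi, one_mul] using hinsert

end StableIntegral

/-! ### A maximal inequality for bounded integrands -/

section Truncation

variable {F : Type*} [NormedAddCommGroup F]

/-- Truncation of a vector at level `τ`: vectors of norm greater than `τ` are replaced by `0`. It
gives isotropic stable variables finite moments. -/
noncomputable def trunc (τ : ℝ) (z : F) : F := if ‖z‖ ≤ τ then z else 0

theorem norm_trunc_le {τ : ℝ} (hτ : 0 ≤ τ) (z : F) : ‖trunc τ z‖ ≤ τ := by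
  unfold trunc
  split_ifs with h
  · exact h
  · simpa

theorem norm_trunc_le_norm (τ : ℝ) (z : F) : ‖trunc τ z‖ ≤ ‖z‖ := by
  unfold trunc
  split_ifs <;> simp

theorem trunc_neg (τ : ℝ) (z : F) : trunc τ (-z) = -trunc τ z := by
  unfold trunc
  rw [norm_neg]
  split_ifs <;> simp

variable {Ω : Type*} [MeasurableSpace Ω] {P : Measure Ω} {α C τ : ℝ} {X : Ω → F}

theorem lintegral_measure_lt_norm_trunc_le [IsFiniteMeasure P] (hτ : 0 ≤ τ)
    (htail : ∀ u : ℝ, 0 < u → P.real {ω | u < ‖X ω‖} ≤ C * u ^ (-α)) :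
    ∫⁻ t in Set.Ioi (0 : ℝ), P {ω | t < ‖trunc τ (X ω)‖} * ENNReal.ofReal (t ^ ((2 : ℝ) - 1)) ≤
      ∫⁻ t in Set.Ioc (0 : ℝ) τ, ENNReal.ofReal (C * t ^ (1 - α)) := by
  rw [← lintegral_indicator measurableSet_Ioi, ← lintegral_indicator measurableSet_Ioc]
  refine lintegral_mono fun t => ?_
  by_cases ht : 0 < t
  · rw [Set.indicator_of_mem (Set.mem_Ioi.2 ht)]
    by_cases htτ : t ≤ τ
    · have hle : P.real {ω | t < ‖trunc τ (X ω)‖} ≤ C * t ^ (-α) :=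
        (measureReal_mono fun ω hω => hω.trans_le (norm_trunc_le_norm τ _)).trans (htail t ht)
      rw [Set.indicator_of_mem (Set.mem_Ioc.2 ⟨ht, htτ⟩), ← ofReal_measureReal,
        ← ENNReal.ofReal_mul measureReal_nonneg]
      refine ENNReal.ofReal_le_ofReal ((mul_le_mul_of_nonneg_right hle (by positivity)).trans_eq ?_)
      rw [mul_assoc, ← Real.rpow_add ht]
      congr 2
      ring
    · have hempty : {ω | t < ‖trunc τ (X ω)‖} = ∅ :=
        Set.eq_empty_of_forall_notMem fun ω (hω : t < _) =>
          htτ (hω.le.trans (norm_trunc_le hτ _))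
      rw [hempty]
      simp
  · rw [Set.indicator_of_notMem (by simpa using ht)]
    exact zero_le

variable [MeasurableSpace F]

theorem integral_comp_eq_zero_of_odd [MeasurableNeg F] (hX : Measurable X)
    (hsymm : P.map (fun ω => -X ω) = P.map X) {φ : F → ℝ} (hφ : Measurable φ)
    (hodd : ∀ z, φ (-z) = -φ z) : ∫ ω, φ (X ω) ∂P = 0 := by
  have heq : ∫ ω, φ (X ω) ∂P = ∫ ω, φ (-X ω) ∂P := by
    rw [← integral_map hX.aemeasurable hφ.aestronglyMeasurable, ← hsymm,
      integral_map (φ := fun ω => -X ω) hX.neg.aemeasurable hφ.aestronglyMeasurable]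
  simp only [hodd, integral_neg] at heq
  linarith

variable [OpensMeasurableSpace F]

theorem measurable_trunc (τ : ℝ) : Measurable (trunc τ : F → F) :=
  Measurable.ite (measurableSet_le measurable_norm measurable_const) measurable_id measurable_const

theorem integral_norm_trunc_sq_le [IsFiniteMeasure P] (hα2 : α < 2) (hX : Measurable X)
    (hC : 0 ≤ C) (hτ : 0 ≤ τ)
    (htail : ∀ u : ℝ, 0 < u → P.real {ω | u < ‖X ω‖} ≤ C * u ^ (-α)) :
    ∫ ω, ‖trunc τ (X ω)‖ ^ 2 ∂P ≤ 2 * C / (2 - α) * τ ^ (2 - α) := by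
  have hm : Measurable fun ω => ‖trunc τ (X ω)‖ := ((measurable_trunc τ).comp hX).norm
  have hα' : 0 < 2 - α := by linarith
  have hlayer := lintegral_rpow_eq_lintegral_meas_lt_mul P (f := fun ω => ‖trunc τ (X ω)‖)
    (Eventually.of_forall fun ω => norm_nonneg _) hm.aemeasurable (p := 2) (by norm_num)
  simp only [Real.rpow_two] at hlayer
  have hint : IntegrableOn (fun t : ℝ => C * t ^ (1 - α)) (Set.Ioc 0 τ) := by
    rw [← intervalIntegrable_iff_integrableOn_Ioc_of_le hτ]
    exact (intervalIntegral.intervalIntegrable_rpow' (by linarith)).const_mul _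
  rw [integral_eq_lintegral_of_nonneg_ae (Eventually.of_forall fun ω => by positivity)
    (hm.pow_const 2).aestronglyMeasurable, hlayer]
  refine ENNReal.toReal_le_of_le_ofReal (by positivity) ?_
  refine (mul_le_mul_right (lintegral_measure_lt_norm_trunc_le hτ htail) _).trans_eq ?_
  rw [← ofReal_integral_eq_lintegral_ofReal hint
    ((ae_restrict_iff' measurableSet_Ioc).2 (Eventually.of_forall fun t ht => by
      have := ht.1; positivity)), ← intervalIntegral.integral_of_le hτ,
    ← ENNReal.ofReal_mul (by norm_num), intervalIntegral.integral_const_mul,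
    integral_rpow (Or.inl (by linarith)), show 1 - α + 1 = 2 - α by ring, Real.zero_rpow hα'.ne']
  congr 1
  ring

end Truncation

section MaximalInequality

variable {Ω : Type*} [MeasurableSpace Ω] {P : Measure Ω} [IsProbabilityMeasure P]

theorem integral_exp_le_exp_integral_sq {Z : Ω → ℝ} (hZ : Measurable Z) (hb : ∀ ω, |Z ω| ≤ 1)
    (hzero : ∫ ω, Z ω ∂P = 0) : ∫ ω, Real.exp (Z ω) ∂P ≤ Real.exp (∫ ω, Z ω ^ 2 ∂P) := by
  have hint : Integrable Z P := .of_bound hZ.aestronglyMeasurable 1 (Eventually.of_forall hb)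
  have hint_sq : Integrable (fun ω => Z ω ^ 2) P :=
    .of_bound (hZ.pow_const 2).aestronglyMeasurable 1 (Eventually.of_forall fun ω => by
      rw [norm_pow]
      exact pow_le_one₀ (norm_nonneg _) (hb ω))
  have hint_exp : Integrable (fun ω => Real.exp (Z ω)) P :=
    .of_bound hZ.exp.aestronglyMeasurable (Real.exp 1) (Eventually.of_forall fun ω => by
      rw [Real.norm_eq_abs, Real.abs_exp]
      exact Real.exp_le_exp.2 (abs_le.1 (hb ω)).2)
  calc ∫ ω, Real.exp (Z ω) ∂P ≤ ∫ ω, (1 + Z ω + Z ω ^ 2) ∂P := by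
        refine integral_mono hint_exp (((integrable_const 1).add hint).add hint_sq) fun ω => ?_
        have := (abs_le.1 (Real.abs_exp_sub_one_sub_id_le (hb ω))).2
        dsimp only
        linarith
    _ = 1 + ∫ ω, Z ω ^ 2 ∂P := by
        rw [integral_add (by exact (integrable_const 1).add hint) hint_sq,
          integral_add (integrable_const 1) hint, hzero, integral_const, probReal_univ, one_smul,
          add_zero]
    _ ≤ Real.exp (∫ ω, Z ω ^ 2 ∂P) := by
        rw [add_comm]
        exact Real.add_one_le_exp _

theorem measureReal_le_sum_le_exp {ι : Type*} [Fintype ι] {Z : ι → Ω → ℝ}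
    (hZ : ∀ i, Measurable (Z i)) (hindep : iIndepFun Z P) (hb : ∀ i ω, |Z i ω| ≤ 1)
    (hzero : ∀ i, ∫ ω, Z i ω ∂P = 0) (x : ℝ) :
    P.real {ω | x ≤ ∑ i, Z i ω} ≤ Real.exp (-x + ∑ i, ∫ ω, Z i ω ^ 2 ∂P) := by
  have hm : Measurable fun ω => ∑ i, Z i ω := Finset.measurable_sum _ fun i _ => hZ i
  have hint : Integrable (fun ω => Real.exp (1 * (∑ i, Z i) ω)) P := by
    simp only [Finset.sum_apply, one_mul]
    refine .of_bound hm.exp.aestronglyMeasurable (Real.exp (∑ _i : ι, 1))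
      (Eventually.of_forall fun ω => ?_)
    rw [Real.norm_eq_abs, Real.abs_exp]
    exact Real.exp_le_exp.2 (Finset.sum_le_sum fun i _ => (abs_le.1 (hb i ω)).2)
  have hchernoff := measure_ge_le_exp_mul_mgf (μ := P) (X := ∑ i, Z i) x (t := 1) zero_le_one hint
  rw [hindep.mgf_sum hZ] at hchernoff
  simp only [Finset.sum_apply] at hchernoff
  refine hchernoff.trans ?_
  rw [Real.exp_add, Real.exp_sum, neg_one_mul]
  gcongr with i _
  · exact fun i _ => mgf_nonneg
  · simp only [mgf, one_mul]
    exact integral_exp_le_exp_integral_sq (hZ i) (hb i) (hzero i)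

variable {α : ℝ}

theorem IsIsotropicStable.integral_norm_trunc_sq_le (hα0 : 0 ≤ α) (hα2 : α < 2) {X : Ω → ℂ} {a : ℝ}
    (hX : IsIsotropicStable α P X a) {τ : ℝ} (hτ : 0 < τ) :
    ∫ ω, ‖trunc τ (X ω)‖ ^ 2 ∂P ≤ 8 / (2 - α) * (4 / τ) ^ α * a * τ ^ 2 := by
  have ha := hX.scale_nonneg
  refine (HFSS.integral_norm_trunc_sq_le hα2 hX.measurable (C := 4 * 4 ^ α * a) (by positivity)
    hτ.le fun u hu => (hX.measureReal_lt_norm_le hα0 hu).trans_eq ?_).trans_eq ?_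
  · rw [Real.div_rpow (by norm_num) hu.le, Real.rpow_neg hu.le]
    ring
  · rw [Real.div_rpow (by norm_num) hτ.le, Real.rpow_sub hτ, Real.rpow_two]
    ring

theorem measureReal_le_sum_comp_le (hα0 : 0 ≤ α) (hα2 : α < 2) {ι : Type*} [Fintype ι]
    {X : ι → Ω → ℂ} {a : ι → ℝ} (hX : ∀ i, IsIsotropicStable α P (X i) (a i))
    (hindep : iIndepFun X P) {τ : ℝ} (hτ : 0 < τ) {φ : ι → ℂ → ℝ} (hφ : ∀ i, Measurable (φ i))
    (hodd : ∀ i z, φ i (-z) = -φ i z) (hφτ : ∀ i z, |φ i z| ≤ ‖trunc τ z‖ / τ) (y : ℝ) :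
    P.real {ω | y ≤ ∑ i, φ i (X i ω)} ≤
      Real.exp (-y + 8 / (2 - α) * (4 / τ) ^ α * ∑ i, a i) := by
  have htrunc_le (z : ℂ) : ‖trunc τ z‖ ≤ τ := norm_trunc_le hτ.le z
  have hsq_le (i : ι) : ∫ ω, φ i (X i ω) ^ 2 ∂P ≤ 8 / (2 - α) * (4 / τ) ^ α * a i := by
    have hint : Integrable (fun ω => ‖trunc τ (X i ω)‖ ^ 2) P :=
      .of_bound
        (((measurable_trunc τ).comp (hX i).measurable).norm.pow_const 2).aestronglyMeasurable
        (τ ^ 2) (Eventually.of_forall fun ω => by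
          rw [norm_pow, norm_norm]
          exact pow_le_pow_left₀ (norm_nonneg _) (htrunc_le _) 2)
    calc ∫ ω, φ i (X i ω) ^ 2 ∂P
        ≤ ∫ ω, ‖trunc τ (X i ω)‖ ^ 2 / τ ^ 2 ∂P := by
          refine integral_mono_of_nonneg (Eventually.of_forall fun ω => sq_nonneg _)
            (hint.div_const _) (Eventually.of_forall fun ω => ?_)
          dsimp only
          rw [← div_pow, ← sq_abs]
          exact pow_le_pow_left₀ (abs_nonneg _) (hφτ i _) 2
      _ ≤ 8 / (2 - α) * (4 / τ) ^ α * a i := by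
          rw [integral_div, div_le_iff₀ (by positivity)]
          exact (hX i).integral_norm_trunc_sq_le hα0 hα2 hτ
  refine (measureReal_le_sum_le_exp (fun i => (hφ i).comp (hX i).measurable) (hindep.comp _ hφ)
    (fun i ω => (hφτ i _).trans ((div_le_one hτ).2 (htrunc_le _)))
    (fun i => integral_comp_eq_zero_of_odd (hX i).measurable (hX i).map_neg (hφ i) (hodd i))
    y).trans ?_
  rw [Finset.mul_sum]
  gcongr with i _
  exact hsq_le i

theorem exists_half_lt_re_mul {z : ℂ} {x : ℝ} (hx : x < ‖z‖) :
    ∃ u ∈ ({1, -1, Complex.I, -Complex.I} : Finset ℂ), x / 2 < (u * z).re := by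
  by_contra! hle
  have hre : |z.re| ≤ x / 2 :=
    abs_le.2 ⟨by linarith [show -z.re ≤ x / 2 by simpa using hle (-1) (by simp)],
      by simpa using hle 1 (by simp)⟩
  have him : |z.im| ≤ x / 2 :=
    abs_le.2 ⟨by linarith [show -z.im ≤ x / 2 by simpa using hle Complex.I (by simp)],
      by simpa using hle (-Complex.I) (by simp)⟩
  linarith [Complex.norm_le_abs_re_add_abs_im z]

theorem measureReal_lt_re_mul_sum_trunc_le (hα0 : 0 ≤ α) (hα2 : α < 2) {ι : Type*} [Fintype ι]
    {X : ι → Ω → ℂ} {a : ι → ℝ} (hX : ∀ i, IsIsotropicStable α P (X i) (a i))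
    (hindep : iIndepFun X P) {c : ι → ℂ} {b τ : ℝ} (hb : 0 < b) (hτ : 0 < τ)
    (hc : ∀ i, ‖c i‖ ≤ b) {u : ℂ} (hu : ‖u‖ = 1) (x : ℝ) :
    P.real {ω | x < (u * ∑ i, c i * trunc τ (X i ω)).re} ≤
      Real.exp (-(x / (b * τ)) + 8 / (2 - α) * (4 / τ) ^ α * ∑ i, a i) := by
  have hsub : {ω | x < (u * ∑ i, c i * trunc τ (X i ω)).re} ⊆
      {ω | x / (b * τ) ≤ ∑ i, (u * (c i * trunc τ (X i ω))).re / (b * τ)} := by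
    intro ω (hω : x < _)
    rw [Set.mem_ofPred_eq, ← Finset.sum_div, ← Complex.re_sum, ← Finset.mul_sum]
    gcongr
  refine (measureReal_mono hsub).trans (measureReal_le_sum_comp_le hα0 hα2 hX hindep hτ
    (φ := fun i z => (u * (c i * trunc τ z)).re / (b * τ)) (fun i => ?_) (fun i z => ?_)
    (fun i z => ?_) (x / (b * τ)))
  · have := measurable_trunc (F := ℂ) τ
    fun_prop
  · simp only [trunc_neg, mul_neg, Complex.neg_re, neg_div]
  · rw [abs_div, abs_of_pos (mul_pos hb hτ), div_le_div_iff₀ (by positivity) hτ]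
    calc |(u * (c i * trunc τ z)).re| * τ ≤ ‖u * (c i * trunc τ z)‖ * τ := by
          gcongr
          exact Complex.abs_re_le_norm _
      _ ≤ b * ‖trunc τ z‖ * τ := by
          rw [norm_mul, norm_mul, hu, one_mul]
          gcongr
          exact hc i
      _ = ‖trunc τ z‖ * (b * τ) := by ring

theorem measureReal_lt_norm_sum_trunc_le (hα0 : 0 ≤ α) (hα2 : α < 2) {ι : Type*} [Fintype ι]
    {X : ι → Ω → ℂ} {a : ι → ℝ} (hX : ∀ i, IsIsotropicStable α P (X i) (a i))
    (hindep : iIndepFun X P) {c : ι → ℂ} {b τ : ℝ} (hb : 0 < b) (hτ : 0 < τ)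
    (hc : ∀ i, ‖c i‖ ≤ b) (x : ℝ) :
    P.real {ω | x < ‖∑ i, c i * trunc τ (X i ω)‖} ≤
      4 * Real.exp (-(x / (2 * b * τ)) + 8 / (2 - α) * (4 / τ) ^ α * ∑ i, a i) := by
  have hdirection (u : ℂ) (hu : u ∈ ({1, -1, Complex.I, -Complex.I} : Finset ℂ)) :
      P.real {ω | x / 2 < (u * ∑ i, c i * trunc τ (X i ω)).re} ≤
        Real.exp (-(x / (2 * b * τ)) + 8 / (2 - α) * (4 / τ) ^ α * ∑ i, a i) := by
    have hu_norm : ‖u‖ = 1 := by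
      simp only [Finset.mem_insert, Finset.mem_singleton] at hu
      rcases hu with rfl | rfl | rfl | rfl <;> simp
    rw [mul_assoc, ← div_div]
    exact measureReal_lt_re_mul_sum_trunc_le hα0 hα2 hX hindep hb hτ hc hu_norm _
  have hsub : {ω | x < ‖∑ i, c i * trunc τ (X i ω)‖} ⊆
      ⋃ u ∈ ({1, -1, Complex.I, -Complex.I} : Finset ℂ),
        {ω | x / 2 < (u * ∑ i, c i * trunc τ (X i ω)).re} := fun ω hω => by
    simpa only [Set.mem_iUnion, Set.mem_ofPred_eq, exists_prop] using exists_half_lt_re_mul hω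
  refine (measureReal_mono hsub (measure_ne_top P _)).trans
    ((measureReal_biUnion_finset_le _ _).trans
      ((Finset.sum_le_card_nsmul _ _ _ hdirection).trans ?_))
  rw [nsmul_eq_mul]
  gcongr
  exact_mod_cast Finset.card_le_four

theorem measureReal_exists_lt_norm_sum_le (hα0 : 0 ≤ α) (hα2 : α < 2) {ι κ : Type*} [Fintype ι]
    [Fintype κ] {X : ι → Ω → ℂ} {a : ι → ℝ} (hX : ∀ i, IsIsotropicStable α P (X i) (a i))
    (hindep : iIndepFun X P) {c : κ → ι → ℂ} {b τ : ℝ} (hb : 0 < b) (hτ : 0 < τ)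
    (hc : ∀ k i, ‖c k i‖ ≤ b) (x : ℝ) :
    P.real {ω | ∃ k, x < ‖∑ i, c k i * X i ω‖} ≤ 4 * (4 / τ) ^ α * ∑ i, a i + Fintype.card κ *
      (4 * Real.exp (-(x / (2 * b * τ)) + 8 / (2 - α) * (4 / τ) ^ α * ∑ i, a i)) := by
  have hsub : {ω | ∃ k, x < ‖∑ i, c k i * X i ω‖} ⊆
      (⋃ i, {ω | τ < ‖X i ω‖}) ∪ ⋃ k, {ω | x < ‖∑ i, c k i * trunc τ (X i ω)‖} := by
    rintro ω ⟨k, hk⟩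
    by_cases hlarge : ∃ i, τ < ‖X i ω‖
    · exact Or.inl (Set.mem_iUnion.2 hlarge)
    · push Not at hlarge
      refine Or.inr (Set.mem_iUnion.2 ⟨k, ?_⟩)
      simpa only [Set.mem_ofPred_eq, trunc, hlarge, if_true] using hk
  refine (measureReal_mono hsub).trans ((measureReal_union_le _ _).trans (add_le_add ?_ ?_))
  · refine (measureReal_iUnion_fintype_le _).trans ?_
    rw [Finset.mul_sum]
    exact Finset.sum_le_sum fun i _ => (hX i).measureReal_lt_norm_le hα0 hτ
  · refine (measureReal_iUnion_fintype_le _).trans ((Finset.sum_le_card_nsmul _ _ _ fun k _ =>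
      measureReal_lt_norm_sum_trunc_le hα0 hα2 hX hindep hb hτ (hc k) x).trans_eq ?_)
    rw [nsmul_eq_mul, Finset.card_univ]

end MaximalInequality

section MaximalInequalityStableIntegral

theorem sum_measureReal_fiber_le {X β : Type*} [MeasurableSpace X] {μ : Measure X} [Zero β]
    {G : SimpleFunc X β} {S : Set X} (hS : μ S < ∞) (hGS : ∀ x ∉ S, G x = 0) {s : Finset β}
    (hs : 0 ∉ s) : ∑ v ∈ s, μ.real (G ⁻¹' {v}) ≤ μ.real S := by
  have hsub : G ⁻¹' s ⊆ S := fun x hx => by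
    by_contra hxS
    exact hs (hGS x hxS ▸ hx)
  have hfin (v : β) (hv : v ∈ s) : μ (G ⁻¹' {v}) ≠ ∞ := (measure_mono
    ((Set.preimage_mono (Set.singleton_subset_iff.2 hv)).trans hsub) |>.trans_lt hS).ne
  rw [sum_measureReal_preimage_singleton s (fun v _ => G.measurableSet_fiber v) hfin]
  exact measureReal_mono hsub hS.ne

theorem measureReal_exists_lt_norm_le_of_tendstoInMeasure {Ω κ : Type*} [MeasurableSpace Ω]
    {P : Measure Ω} [IsFiniteMeasure P] [Finite κ] {V : Type*} [SeminormedAddCommGroup V]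
    {X : κ → Ω → V} {Y : ℕ → κ → Ω → V}
    (hY : ∀ k, TendstoInMeasure P (fun n => Y n k) atTop (X k)) {x B : ℝ} (hx : 0 < x)
    (hB : ∀ n, P.real {ω | ∃ k, x / 2 < ‖Y n k ω‖} ≤ B) :
    P.real {ω | ∃ k, x < ‖X k ω‖} ≤ B := by
  have := Fintype.ofFinite κ
  have hlim : Tendsto (fun n => B + ∑ k, P.real {ω | x / 2 ≤ ‖Y n k ω - X k ω‖}) atTop
      (𝓝 (B + ∑ _k : κ, 0)) :=
    tendsto_const_nhds.add (tendsto_finsetSum _ fun k _ =>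
      tendstoInMeasure_iff_measureReal_norm.1 (hY k) (x / 2) (by positivity))
  rw [Finset.sum_const_zero, add_zero] at hlim
  refine ge_of_tendsto' hlim fun n => ?_
  have hsub : {ω | ∃ k, x < ‖X k ω‖} ⊆ {ω | ∃ k, x / 2 < ‖Y n k ω‖} ∪
      ⋃ k, {ω | x / 2 ≤ ‖Y n k ω - X k ω‖} := by
    rintro ω ⟨k, hk⟩
    by_contra hc
    simp only [Set.mem_union, Set.mem_iUnion, Set.mem_ofPred_eq, not_or, not_exists, not_le,
      not_lt] at hc
    have := norm_sub_le (Y n k ω) (Y n k ω - X k ω)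
    rw [sub_sub_cancel] at this
    linarith [hc.1 k, hc.2 k]
  exact (measureReal_mono hsub).trans ((measureReal_union_le _ _).trans
    (add_le_add (hB n) (measureReal_iUnion_fintype_le _)))

theorem exists_simpleFunc_tendsto_eLpNorm {X V : Type*} [MeasurableSpace X] {μ : Measure X}
    [NormedAddCommGroup V] [MeasurableSpace V] [BorelSpace V] [SecondCountableTopology V]
    {F : X → V} (hF : Measurable F) {p : ℝ≥0∞} (hp : p ≠ ∞) (hFp : MemLp F p μ) :
    ∃ G : ℕ → SimpleFunc X V, (∀ n y, ‖G n y‖ ≤ 2 * ‖F y‖) ∧ (∀ n, MemLp (G n) p μ) ∧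
      Tendsto (fun n => eLpNorm (⇑(G n) - F) p μ) atTop (𝓝 0) :=
  ⟨SimpleFunc.approxOn F hF Set.univ 0 (Set.mem_univ _),
    fun n y => (SimpleFunc.norm_approxOn_zero_le hF (Set.mem_univ _) y n).trans_eq (two_mul _).symm,
    SimpleFunc.memLp_approxOn hF hFp (Set.mem_univ _) MemLp.zero,
    SimpleFunc.tendsto_approxOn_Lp_eLpNorm hF (Set.mem_univ 0) hp
      (Eventually.of_forall fun y => by simp) (by simpa using hFp.2)⟩

variable {N : ℕ} {Ω : Type*} [MeasurableSpace Ω] {α : ℝ} {P : Measure Ω} [IsProbabilityMeasure P]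
  {M : Set (E N) → Ω → ℂ} {κ : Type*} [Fintype κ]

theorem measureReal_exists_lt_norm_simpleIntegral_le (hM : IsIsotropicStableMeasure α P M)
    (hα0 : 0 ≤ α) (hα2 : α < 2) {G : SimpleFunc (E N) (κ → ℂ)} {b τ : ℝ} (hb : 0 < b)
    (hτ : 0 < τ) (hGb : ∀ y, ‖G y‖ ≤ b) {S : Set (E N)} (hS : volume S < ∞)
    (hGS : ∀ y ∉ S, G y = 0) (x : ℝ) :
    P.real {ω | ∃ k, x < ‖simpleIntegral M (G.map fun v => v k) ω‖} ≤
      4 * (4 / τ) ^ α * volume.real S + Fintype.card κ *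
        (4 * Real.exp (-(x / (2 * b * τ)) + 8 / (2 - α) * (4 / τ) ^ α * volume.real S)) := by
  classical
  let s : Finset (κ → ℂ) := {v ∈ G.range | v ≠ 0}
  have hfin (v : κ → ℂ) (hv : v ≠ 0) : volume (G ⁻¹' {v}) < ∞ :=
    (measure_mono fun y (hy : G y = v) => by_contra fun hyS => hv (hy ▸ hGS y hyS)).trans_lt hS
  have hs (v : s) : volume (G ⁻¹' {(v : κ → ℂ)}) < ∞ := hfin v (Finset.mem_filter.1 v.2).2
  have hsum : ∑ v : s, volume.real (G ⁻¹' {(v : κ → ℂ)}) ≤ volume.real S := by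
    rw [Finset.sum_coe_sort s fun v => volume.real (G ⁻¹' {v})]
    exact sum_measureReal_fiber_le hS hGS fun h => (Finset.mem_filter.1 h).2 rfl
  have hsimple (k : κ) : ∀ᵐ ω ∂P, simpleIntegral M (G.map fun v => v k) ω =
      ∑ v : s, (v : κ → ℂ) k * M (G ⁻¹' {(v : κ → ℂ)}) ω := by
    filter_upwards [simpleIntegral_map hM G (fun v => v k)
      fun v _ hv => hfin v fun h => hv (h ▸ rfl)] with ω hω
    rw [hω, Finset.sum_coe_sort s fun v => v k * M (G ⁻¹' {v}) ω]
    refine (Finset.sum_filter_of_ne (p := (· ≠ 0)) fun v _ hv hv0 => hv ?_).symm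
    rw [hv0, Pi.zero_apply, zero_mul]
  have hmax := measureReal_exists_lt_norm_sum_le hα0 hα2
    (fun v : s => hM.isIsotropicStable (G.measurableSet_fiber v) (hs v))
    (hM.iIndepFun_of_pairwise_disjoint (fun v : s => G.measurableSet_fiber v) hs
      (pairwise_disjoint_fiber G)) (c := fun k v => (v : κ → ℂ) k) hb hτ (fun k v => by
        obtain ⟨y, hy⟩ := SimpleFunc.mem_range.1 (Finset.mem_filter.1 v.2).1
        rw [← hy]
        exact (norm_le_pi_norm _ k).trans (hGb y)) x
  have hae : {ω | ∃ k, x < ‖simpleIntegral M (G.map fun v => v k) ω‖} =ᵐ[P]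
      {ω | ∃ k, x < ‖∑ v : s, (v : κ → ℂ) k * M (G ⁻¹' {(v : κ → ℂ)}) ω‖} := by
    filter_upwards [ae_all_iff.2 hsimple] with ω hω
    simp only [Set.ofPred, hω]
  have := sub_pos.2 hα2
  rw [measureReal_congr hae]
  exact hmax.trans (by gcongr)

theorem measureReal_exists_lt_norm_stableIntegral_le (hM : IsIsotropicStableMeasure α P M)
    (hα0 : 0 < α) (hα2 : α < 2) {F : E N → κ → ℂ} {X : κ → Ω → ℂ} (hF : Measurable F)
    (hX : ∀ k, IsStableIntegral α P M (fun y => F y k) (X k)) {b τ : ℝ} (hb : 0 < b) (hτ : 0 < τ)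
    (hFb : ∀ y, ‖F y‖ ≤ b) {S : Set (E N)} (hS : volume S < ∞) (hFS : ∀ y ∉ S, F y = 0)
    {x : ℝ} (hx : 0 < x) :
    P.real {ω | ∃ k, x < ‖X k ω‖} ≤ 4 * (4 / τ) ^ α * volume.real S + Fintype.card κ *
      (4 * Real.exp (-(x / (8 * b * τ)) + 8 / (2 - α) * (4 / τ) ^ α * volume.real S)) := by
  have hFmem : MemLp F (ENNReal.ofReal α) volume := .of_eval fun k => (hX k).1
  obtain ⟨G, hG_le, hGmem, hG_tendsto⟩ :=
    exists_simpleFunc_tendsto_eLpNorm hF ENNReal.ofReal_ne_top hFmem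
  have hGk (n : ℕ) (k : κ) : MemLp ((G n).map fun v => v k) (ENNReal.ofReal α) volume :=
    (hGmem n).eval k
  have hGk_tendsto (k : κ) : Tendsto (fun n => eLpNorm
      (fun y => ((G n).map fun v => v k) y - F y k) (ENNReal.ofReal α) volume) atTop (𝓝 0) :=
    tendsto_of_tendsto_of_tendsto_of_le_of_le tendsto_const_nhds hG_tendsto (fun _ => zero_le)
      fun n => eLpNorm_mono fun y => norm_le_pi_norm ((⇑(G n) - F) y) k
  have htendsto (k : κ) : TendstoInMeasure P
      (fun n => simpleIntegral M ((G n).map fun v => v k)) atTop (X k) :=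
    IsStableIntegral.tendstoInMeasure hM hα0
      (fun n => isStableIntegral_simpleIntegral hM hα0 (hGk n k)) (hX k) (hGk_tendsto k)
  refine measureReal_exists_lt_norm_le_of_tendstoInMeasure htendsto hx fun n => ?_
  have hsimple := measureReal_exists_lt_norm_simpleIntegral_le hM hα0.le hα2 (G := G n)
    (b := 2 * b) (by positivity) hτ (fun y => (hG_le n y).trans (by gcongr; exact hFb y)) hS
    (fun y hy => norm_le_zero_iff.1 ((hG_le n y).trans (by simp [hFS y hy]))) (x / 2)
  have hdiv : x / 2 / (2 * (2 * b) * τ) = x / (8 * b * τ) := by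
    field_simp
    norm_num
  rwa [hdiv] at hsimple

end MaximalInequalityStableIntegral

/-! ### Almost sure growth of random arrays -/

section Growth

theorem exp_neg_le_factorial_div_pow (p : ℕ) {y : ℝ} (hy : 0 < y) :
    Real.exp (-y) ≤ p.factorial / y ^ p := by
  rw [Real.exp_neg, inv_le_comm₀ (Real.exp_pos _) (by positivity), inv_div]
  exact Real.pow_div_factorial_le_exp y hy.le p

theorem exists_pow_mul_exp_neg_rpow_le (N : ℕ) {c δ : ℝ} (hc : 0 < c) (hδ : 0 < δ) :
    ∃ C : ℝ, ∀ m : ℕ, (2 * 2 ^ m + 1) ^ N * Real.exp (-(c * (2 : ℝ) ^ (δ * m))) ≤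
      C * (1 / 2) ^ m := by
  obtain ⟨p, hp⟩ := exists_nat_ge ((N + 1) / δ)
  rw [div_le_iff₀ hδ] at hp
  refine ⟨3 ^ N * (p.factorial / c ^ p), fun m => ?_⟩
  have hcard : (2 * 2 ^ m + 1 : ℝ) ^ N ≤ 3 ^ N * 2 ^ (m * N) := by
    rw [pow_mul, ← mul_pow]
    gcongr
    have : (1 : ℝ) ≤ 2 ^ m := one_le_pow₀ (by norm_num)
    linarith
  have hpow : (2 : ℝ) ^ ((N + 1) * m) ≤ ((2 : ℝ) ^ (δ * m)) ^ p := by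
    rw [← Real.rpow_natCast, ← Real.rpow_natCast, ← Real.rpow_mul (by norm_num)]
    refine Real.rpow_le_rpow_of_exponent_le (by norm_num) ?_
    push_cast
    calc ((N : ℝ) + 1) * m ≤ p * δ * m := by gcongr
      _ = δ * m * p := by ring
  calc (2 * 2 ^ m + 1) ^ N * Real.exp (-(c * (2 : ℝ) ^ (δ * m)))
      ≤ (3 ^ N * 2 ^ (m * N)) * (p.factorial / (c * (2 : ℝ) ^ (δ * m)) ^ p) := by
        gcongr
        exact exp_neg_le_factorial_div_pow p (by positivity)
    _ ≤ (3 ^ N * 2 ^ (m * N)) * (p.factorial / (c ^ p * 2 ^ ((N + 1) * m))) := by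
        rw [mul_pow]
        gcongr
    _ = 3 ^ N * (p.factorial / c ^ p) * (1 / 2) ^ m := by
        rw [add_mul, one_mul, pow_add, mul_comm m N, one_div, inv_pow]
        field_simp

theorem summable_two_mul_add_one_pow_mul_geometric (N : ℕ) {r : ℝ} (hr0 : 0 ≤ r) (hr1 : r < 1) :
    Summable fun m : ℕ => (2 * (m : ℝ) + 1) ^ N * r ^ m := by
  have hO : (fun m : ℕ => 2 * (m : ℝ) + 1) =O[atTop] fun m : ℕ => (m : ℝ) := by
    refine .of_bound 3 ?_
    filter_upwards [eventually_ge_atTop 1] with m hm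
    have : (1 : ℝ) ≤ m := by exact_mod_cast hm
    rw [Real.norm_of_nonneg (by positivity), Real.norm_of_nonneg (by positivity)]
    linarith
  have hsummable := summable_norm_mul_geometric_of_norm_lt_one (k := N) (r := r)
    (u := fun m => (2 * m + 1) ^ N) (by rwa [Real.norm_of_nonneg hr0])
    (by simpa only [Nat.cast_pow, Nat.cast_add, Nat.cast_mul, Nat.cast_ofNat, Nat.cast_one]
      using hO.pow N)
  simpa only [Nat.cast_pow, Nat.cast_add, Nat.cast_mul, Nat.cast_ofNat, Nat.cast_one]
    using hsummable.of_norm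

theorem summable_pow_mul_rpow_add_pow_mul_exp {α : ℝ} (hα0 : 0 < α) (N : ℕ) {c δ : ℝ} (hc : 0 < c)
    (hδ : 0 < δ) : Summable fun m : ℕ => (2 * (m : ℝ) + 1) ^ N * (((2 : ℝ) ^ (δ * m)) ^ (-α) +
      (2 * 2 ^ m + 1) ^ N * Real.exp (-(c * (2 : ℝ) ^ (δ * m)))) := by
  obtain ⟨C, hC⟩ := exists_pow_mul_exp_neg_rpow_le N hc hδ
  simp only [mul_add]
  refine Summable.add ?_ ?_
  · refine (summable_two_mul_add_one_pow_mul_geometric N (r := (2 : ℝ) ^ (-(δ * α))) (by positivity)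
      (Real.rpow_lt_one_of_one_lt_of_neg (by norm_num) (by nlinarith))).congr fun m => ?_
    rw [← Real.rpow_natCast _ m, ← Real.rpow_mul (by norm_num), ← Real.rpow_mul (by norm_num)]
    ring_nf
  · refine .of_nonneg_of_le (fun m => by positivity) (fun m => ?_)
      ((summable_two_mul_add_one_pow_mul_geometric N (r := 1 / 2) (by norm_num)
        (by norm_num)).mul_left C)
    calc _ ≤ (2 * (m : ℝ) + 1) ^ N * (C * (1 / 2) ^ m) :=
          mul_le_mul_of_nonneg_left (hC m) (by positivity)
      _ = C * ((2 * (m : ℝ) + 1) ^ N * (1 / 2) ^ m) := by ring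

/-- The integer points of `[-q, q]^N`. -/
noncomputable def intBox (N q : ℕ) : Finset (Fin N → ℤ) :=
  Fintype.piFinset fun _ => Finset.Icc (-(q : ℤ)) q

theorem mem_intBox {N q : ℕ} {K : Fin N → ℤ} : K ∈ intBox N q ↔ ∀ l, (K l).natAbs ≤ q := by
  simp only [intBox, Fintype.mem_piFinset, Finset.mem_Icc]
  exact forall_congr' fun l => by omega

theorem card_intBox (N q : ℕ) : (intBox N q).card = (2 * q + 1) ^ N := by
  simp only [intBox, Fintype.card_piFinset, Int.card_Icc, Finset.prod_const, Finset.card_univ,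
    Fintype.card_fin]
  congr 1
  omega

/-- A natural number `m` such that `|j| ≤ m` and `|k| ≤ 2^m`, chosen such that `2^m` is at most
`2^(|j| + 1) * (1 + |k|)`. -/
def dyadicLevel (j k : ℤ) : ℕ := j.natAbs + (Nat.log 2 (k.natAbs + 1) + 1)

theorem natAbs_le_dyadicLevel (j k : ℤ) : j.natAbs ≤ dyadicLevel j k := Nat.le_add_right _ _

theorem natAbs_le_two_pow_dyadicLevel (j k : ℤ) : k.natAbs ≤ 2 ^ dyadicLevel j k :=
  calc k.natAbs ≤ k.natAbs + 1 := Nat.le_succ _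
    _ ≤ 2 ^ (Nat.log 2 (k.natAbs + 1) + 1) := (Nat.lt_pow_succ_log_self (by norm_num) _).le
    _ ≤ 2 ^ dyadicLevel j k := Nat.pow_le_pow_right (by norm_num) (Nat.le_add_left _ _)

theorem two_rpow_mul_dyadicLevel_le {η : ℝ} (hη : 0 ≤ η) (j k : ℤ) :
    (2 : ℝ) ^ (η * dyadicLevel j k) ≤ 2 ^ η * (2 ^ (η * |(j : ℝ)|) * (1 + |(k : ℝ)|) ^ η) := by
  have hlog : (2 : ℝ) ^ Nat.log 2 (k.natAbs + 1) ≤ 1 + |(k : ℝ)| := by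
    rw [← Int.cast_abs, ← Nat.cast_natAbs, add_comm 1]
    exact_mod_cast Nat.pow_log_le_self 2 (Nat.succ_ne_zero k.natAbs)
  calc (2 : ℝ) ^ (η * dyadicLevel j k)
      = 2 ^ η * (2 ^ (η * |(j : ℝ)|) * ((2 : ℝ) ^ Nat.log 2 (k.natAbs + 1)) ^ η) := by
        rw [← Real.rpow_natCast, ← Real.rpow_mul (by norm_num), ← Real.rpow_add (by norm_num),
          ← Real.rpow_add (by norm_num), dyadicLevel]
        push_cast [Nat.cast_natAbs]
        ring_nf
    _ ≤ 2 ^ η * (2 ^ (η * |(j : ℝ)|) * (1 + |(k : ℝ)|) ^ η) := by gcongr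

theorem exists_le_prod_of_eventually_le_on_intBox {N : ℕ} {y : (Fin N → ℤ) → (Fin N → ℤ) → ℝ}
    {η : ℝ} (hη : 0 ≤ η) (hy : ∀ᶠ m : ℕ in atTop, ∀ J ∈ intBox N m, ∀ K ∈ intBox N (2 ^ m),
      y J K ≤ (2 : ℝ) ^ (η * m)) :
    ∃ C : ℝ, 0 ≤ C ∧ ∀ J K, y J K ≤
      C * ∏ l, ((2 : ℝ) ^ (η * |(J l : ℝ)|) * (1 + |(K l : ℝ)|) ^ η) := by
  obtain ⟨m₀, hm₀⟩ := eventually_atTop.1 hy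
  refine ⟨2 ^ (η * m₀) * ∏ _l : Fin N, (2 : ℝ) ^ η, by positivity, fun J K => ?_⟩
  set m := m₀ + ∑ l, dyadicLevel (J l) (K l)
  have hlevel (l : Fin N) : dyadicLevel (J l) (K l) ≤ m :=
    (Finset.single_le_sum (f := fun i => dyadicLevel (J i) (K i)) (fun i _ => Nat.zero_le _)
      (Finset.mem_univ l)).trans (Nat.le_add_left _ _)
  calc y J K ≤ (2 : ℝ) ^ (η * m) :=
        hm₀ m (Nat.le_add_right _ _)
          J (mem_intBox.2 fun l => (natAbs_le_dyadicLevel _ _).trans (hlevel l))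
          K (mem_intBox.2 fun l => (natAbs_le_two_pow_dyadicLevel _ _).trans
            (Nat.pow_le_pow_right (by norm_num) (hlevel l)))
    _ = 2 ^ (η * m₀) * ∏ l, (2 : ℝ) ^ (η * dyadicLevel (J l) (K l)) := by
        rw [← Real.rpow_sum_of_pos (by norm_num), ← Real.rpow_add (by norm_num),
          ← Finset.mul_sum, ← mul_add]
        push_cast [m]
        rfl
    _ ≤ 2 ^ (η * m₀) * ∏ l, ((2 : ℝ) ^ η * (2 ^ (η * |(J l : ℝ)|) * (1 + |(K l : ℝ)|) ^ η)) := by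
        gcongr with l _
        exact two_rpow_mul_dyadicLevel_le hη _ _
    _ = _ := by rw [Finset.prod_mul_distrib, mul_assoc]

variable {N : ℕ} {Ω : Type*} [MeasurableSpace Ω] {P : Measure Ω} [IsFiniteMeasure P] {α A : ℝ}
  {V : Type*} [Norm V] {Y : (Fin N → ℤ) → (Fin N → ℤ) → Ω → V}

theorem ae_eventually_norm_le_of_tail (hα0 : 0 < α)
    (hY : ∀ (J : Fin N → ℤ) (F : Finset (Fin N → ℤ)) (τ x : ℝ), 1 ≤ τ → 0 < x →
      P.real {ω | ∃ K ∈ F, x < ‖Y J K ω‖} ≤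
        A * (τ ^ (-α) + F.card * Real.exp (-(x / (8 * τ))))) {η : ℝ} (hη : 0 < η) :
    ∀ᵐ ω ∂P, ∀ᶠ m : ℕ in atTop, ∀ J ∈ intBox N m, ∀ K ∈ intBox N (2 ^ m),
      ‖Y J K ω‖ ≤ (2 : ℝ) ^ (η * m) := by
  let bad (m : ℕ) : Set Ω := ⋃ J ∈ intBox N m,
    {ω | ∃ K ∈ intBox N (2 ^ m), (2 : ℝ) ^ (η * m) < ‖Y J K ω‖}
  have hbad (m : ℕ) : P (bad m) ≤ ENNReal.ofReal (A * ((2 * (m : ℝ) + 1) ^ N *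
      (((2 : ℝ) ^ (η / 2 * m)) ^ (-α) + (2 * 2 ^ m + 1) ^ N *
        Real.exp (-(1 / 8 * (2 : ℝ) ^ (η / 2 * m)))))) := by
    have hratio : (2 : ℝ) ^ (η * m) / (8 * 2 ^ (η / 2 * m)) = 1 / 8 * 2 ^ (η / 2 * m) := by
      rw [show η * m = η / 2 * m + η / 2 * m by ring, Real.rpow_add (by norm_num)]
      field_simp
    rw [← ENNReal.ofReal_toReal (measure_ne_top P _)]
    refine ENNReal.ofReal_le_ofReal ((measureReal_biUnion_finset_le _ _).trans ((Finset.sum_le_sum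
      fun J _ => hY J (intBox N (2 ^ m)) ((2 : ℝ) ^ (η / 2 * m)) ((2 : ℝ) ^ (η * m))
        (Real.one_le_rpow (by norm_num) (by positivity)) (by positivity)).trans_eq ?_))
    rw [Finset.sum_const, card_intBox, card_intBox, nsmul_eq_mul, hratio]
    push_cast
    ring
  have hsum : ∑' m, P (bad m) ≠ ∞ := ne_top_of_le_ne_top
    ((summable_pow_mul_rpow_add_pow_mul_exp hα0 N (by norm_num) (half_pos hη)).mul_left
      A).tsum_ofReal_ne_top (ENNReal.tsum_le_tsum hbad)
  filter_upwards [ae_eventually_notMem hsum] with ω hω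
  filter_upwards [hω] with m hm J hJ K hK
  by_contra! hlt
  exact hm (Set.mem_biUnion hJ ⟨K, hK, hlt⟩)

theorem ae_exists_norm_le_of_tail (hα0 : 0 < α)
    (hY : ∀ (J : Fin N → ℤ) (F : Finset (Fin N → ℤ)) (τ x : ℝ), 1 ≤ τ → 0 < x →
      P.real {ω | ∃ K ∈ F, x < ‖Y J K ω‖} ≤
        A * (τ ^ (-α) + F.card * Real.exp (-(x / (8 * τ))))) {η : ℝ} (hη : 0 < η) :
    ∀ᵐ ω ∂P, ∃ C : ℝ, 0 ≤ C ∧ ∀ J K, ‖Y J K ω‖ ≤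
      C * ∏ l, ((2 : ℝ) ^ (η * |(J l : ℝ)|) * (1 + |(K l : ℝ)|) ^ η) := by
  filter_upwards [ae_eventually_norm_le_of_tail hα0 hY hη] with ω hω
  exact exists_le_prod_of_eventually_le_on_intBox (y := fun J K => ‖Y J K ω‖) hη.le hω

end Growth

/-! ### The wavelet coefficients -/

section Coefficients

open scoped FourierTransform SchwartzMap

/-- The complex-valued Schwartz function underlying a real-valued one. -/
noncomputable def toComplex (ψ : SchwartzMap ℝ ℝ) : 𝓢(ℝ, ℂ) :=
  SchwartzMap.postcompCLM (𝕜 := ℝ) Complex.ofRealCLM ψ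

theorem toComplex_apply (ψ : SchwartzMap ℝ ℝ) (x : ℝ) : toComplex ψ x = (ψ x : ℂ) := rfl

theorem hat_eq_fourier (ψ : SchwartzMap ℝ ℝ) (ξ : ℝ) : hat ψ ξ =
    ((Real.sqrt (2 * Real.pi))⁻¹ : ℂ) * (𝓕 (toComplex ψ)) ((2 * Real.pi)⁻¹ * ξ) := by
  rw [hat, SchwartzMap.fourier_coe, Real.fourier_real_eq_integral_exp_smul]
  congr 1
  refine integral_congr_ae (Eventually.of_forall fun s => ?_)
  simp only [toComplex_apply, smul_eq_mul]
  congr 2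
  push_cast
  field_simp [Real.pi_ne_zero]

theorem contDiff_hat (ψ : SchwartzMap ℝ ℝ) : ContDiff ℝ (⊤ : ℕ∞) (hat ψ) := by
  rw [funext (hat_eq_fourier ψ)]
  exact contDiff_const.mul
    ((SchwartzMap.smooth (𝓕 (toComplex ψ)) ⊤).comp (contDiff_const.mul contDiff_id))

theorem continuous_hat (ψ : SchwartzMap ℝ ℝ) : Continuous (hat ψ) := (contDiff_hat ψ).continuous

theorem IsLemarieMeyer.hasCompactSupport_hat {ψ : SchwartzMap ℝ ℝ} (hψ : IsLemarieMeyer ψ) :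
    HasCompactSupport (hat ψ) := by
  refine HasCompactSupport.intro (isCompact_closedBall (0 : ℝ) (8 * Real.pi / 3)) fun ξ hξ => ?_
  by_contra hne
  exact hξ (by simpa using (hψ.support_hat ξ hne).2)

theorem IsLemarieMeyer.exists_norm_hat_le {ψ : SchwartzMap ℝ ℝ} (hψ : IsLemarieMeyer ψ) :
    ∃ B : ℝ, 0 < B ∧ ∀ ξ, ‖hat ψ ξ‖ ≤ B := by
  obtain ⟨C, hC⟩ :=
    (continuous_hat ψ).bounded_above_of_compact_support hψ.hasCompactSupport_hat
  exact ⟨max C 1, by positivity, fun ξ => (hC ξ).trans (le_max_left _ _)⟩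

theorem norm_exp_I_mul_ofReal (x : ℝ) : ‖Complex.exp (Complex.I * (x : ℂ))‖ = 1 := by
  rw [mul_comm, Complex.norm_exp_ofReal_mul_I]

variable {α : ℝ}

theorem norm_hatNormalized (ψ : SchwartzMap ℝ ℝ) (j k : ℤ) (ξ : ℝ) :
    ‖hatNormalized α ψ j k ξ‖ = (2 : ℝ) ^ (-((j : ℝ) / α)) * ‖hat ψ ((2 : ℝ) ^ (-j) * ξ)‖ := by
  rw [hatNormalized, norm_mul, norm_mul, Complex.exp_neg, norm_inv, norm_exp_I_mul_ofReal, inv_one,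
    mul_one, Complex.norm_real, Real.norm_of_nonneg (by positivity)]

theorem continuous_hatNormalized (ψ : SchwartzMap ℝ ℝ) (j k : ℤ) :
    Continuous (hatNormalized α ψ j k) := by
  unfold hatNormalized
  have := continuous_hat ψ
  fun_prop

theorem abs_mem_Icc_of_hatNormalized_ne_zero {ψ : SchwartzMap ℝ ℝ} (hψ : IsLemarieMeyer ψ)
    {j k : ℤ} {ξ : ℝ} (hξ : hatNormalized α ψ j k ξ ≠ 0) :
    |ξ| ∈ Set.Icc ((2 : ℝ) ^ j) (9 * 2 ^ j) := by
  have hj : (0 : ℝ) < 2 ^ j := by positivity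
  obtain ⟨hlower, hupper⟩ := hψ.support_hat _ (right_ne_zero_of_mul hξ)
  rw [abs_mul, abs_of_pos (by positivity), zpow_neg] at hlower hupper
  rw [le_inv_mul_iff₀ hj] at hlower
  rw [inv_mul_le_iff₀ hj] at hupper
  constructor
  · nlinarith [Real.pi_gt_three]
  · nlinarith [Real.pi_lt_d2]

theorem hatNormalized_eq_zero {ψ : SchwartzMap ℝ ℝ} (hψ : IsLemarieMeyer ψ) (j k : ℤ) {ξ : ℝ}
    (hξ : ξ ∉ Set.Icc (-(9 * (2 : ℝ) ^ j)) (9 * 2 ^ j)) : hatNormalized α ψ j k ξ = 0 :=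
  of_not_not fun hne => hξ (abs_le.1 (abs_mem_Icc_of_hatNormalized_ne_zero hψ hne).2)

variable {N : ℕ}

/-- The integrand `conj (∏_l ψ^_{α,j_l,k_l}(λ_l))` of the coefficient `ε_{J,K}`. -/
noncomputable def coeffKernel (α : ℝ) (ψ : SchwartzMap ℝ ℝ) (J K : Fin N → ℤ) (x : E N) : ℂ :=
  starRingEnd ℂ (∏ l, hatNormalized α ψ (J l) (K l) (x l))

theorem continuous_coeffKernel (ψ : SchwartzMap ℝ ℝ) (J K : Fin N → ℤ) :
    Continuous (coeffKernel α ψ J K) :=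
  Complex.continuous_conj.comp (continuous_finsetProd _ fun l _ =>
    (continuous_hatNormalized ψ (J l) (K l)).comp (by fun_prop))

/-- A box of frequencies outside of which `coeffKernel α ψ J K` vanishes: `hat ψ` is supported in
`[-8π/3, 8π/3]`, and `8π/3 ≤ 9`. -/
def freqBox (J : Fin N → ℤ) : Set (E N) :=
  {x | ∀ l, x l ∈ Set.Icc (-(9 * (2 : ℝ) ^ J l)) (9 * 2 ^ J l)}

theorem volume_freqBox (J : Fin N → ℤ) :
    volume (freqBox J) = ENNReal.ofReal (∏ l, (18 * (2 : ℝ) ^ J l)) := by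
  have hpreimage : freqBox J = (MeasurableEquiv.toLp 2 (Fin N → ℝ)).symm ⁻¹'
      (Set.univ.pi fun l => Set.Icc (-(9 * (2 : ℝ) ^ J l)) (9 * 2 ^ J l)) := by
    ext x
    simp only [freqBox, Set.mem_ofPred_eq, Set.mem_preimage, Set.mem_univ_pi]
    rfl
  rw [hpreimage, (EuclideanSpace.volume_preserving_symm_measurableEquiv_toLp _).measure_preimage
    (MeasurableSet.univ_pi fun _ => measurableSet_Icc).nullMeasurableSet,
    volume_pi_pi, ENNReal.ofReal_prod_of_nonneg (fun l _ => by positivity)]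
  refine Finset.prod_congr rfl fun l _ => ?_
  rw [Real.volume_Icc]
  ring_nf

theorem isBounded_freqBox (J : Fin N → ℤ) : Bornology.IsBounded (freqBox J) :=
  (PiLp.antilipschitzWith_ofLp 2 (fun _ : Fin N => ℝ)).isBounded_preimage
    (Bornology.IsBounded.pi fun l => Metric.isBounded_Icc (-(9 * (2 : ℝ) ^ J l)) (9 * 2 ^ J l))
    |>.subset fun _ hx => Set.mem_univ_pi.2 hx

theorem coeffKernel_eq_zero {ψ : SchwartzMap ℝ ℝ} (hψ : IsLemarieMeyer ψ) (J K : Fin N → ℤ)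
    {x : E N} (hx : x ∉ freqBox J) : coeffKernel α ψ J K x = 0 := by
  simp only [freqBox, Set.mem_ofPred_eq, not_forall] at hx
  obtain ⟨l, hl⟩ := hx
  rw [coeffKernel, Finset.prod_eq_zero (Finset.mem_univ l) (hatNormalized_eq_zero hψ _ _ hl),
    map_zero]

theorem norm_coeffKernel_le {ψ : SchwartzMap ℝ ℝ} {B : ℝ} (hB : ∀ ξ, ‖hat ψ ξ‖ ≤ B)
    (J K : Fin N → ℤ) (x : E N) :
    ‖coeffKernel α ψ J K x‖ ≤ ∏ l, ((2 : ℝ) ^ (-((J l : ℝ) / α)) * B) := by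
  rw [coeffKernel, Complex.norm_conj, norm_prod]
  refine Finset.prod_le_prod (fun _ _ => norm_nonneg _) fun l _ => ?_
  rw [norm_hatNormalized]
  gcongr
  exact hB _

theorem memLp_coeffKernel {ψ : SchwartzMap ℝ ℝ} (hψ : IsLemarieMeyer ψ) (J K : Fin N → ℤ)
    (p : ℝ≥0∞) : MemLp (coeffKernel α ψ J K) p (volume : Measure (E N)) :=
  (continuous_coeffKernel ψ J K).memLp_of_hasCompactSupport
    (HasCompactSupport.intro (isBounded_freqBox J).isCompact_closure fun _ hx =>
      coeffKernel_eq_zero hψ J K fun h => hx (subset_closure h))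

/-- The normalization in `L^α` makes the scale parameters of all coefficients comparable. -/
theorem prod_rpow_mul_volume_freqBox (hα : α ≠ 0) {B : ℝ} (hB : 0 ≤ B) (J : Fin N → ℤ) :
    (∏ l, ((2 : ℝ) ^ (-((J l : ℝ) / α)) * B)) ^ α * volume.real (freqBox J) =
      (18 * B ^ α) ^ N := by
  rw [measureReal_def, volume_freqBox,
    ENNReal.toReal_ofReal (Finset.prod_nonneg fun l _ => by positivity),
    ← Real.finsetProd_rpow _ _ (fun l _ => by positivity), ← Finset.prod_mul_distrib]
  refine (Finset.prod_congr rfl fun l _ => ?_).trans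
    ((Finset.prod_const (18 * B ^ α)).trans (by rw [Finset.card_univ, Fintype.card_fin]))
  rw [Real.mul_rpow (by positivity) hB, ← Real.rpow_mul (by norm_num),
    show -((J l : ℝ) / α) * α = -(J l : ℝ) by field_simp, Real.rpow_neg (by norm_num),
    Real.rpow_intCast]
  field_simp

variable {Ω : Type*} [MeasurableSpace Ω] {P : Measure Ω} [IsProbabilityMeasure P]
  {M : Set (E N) → Ω → ℂ}

theorem isStableIntegral_coeff (hM : IsIsotropicStableMeasure α P M) (hα0 : 0 < α)
    {ψ : SchwartzMap ℝ ℝ} (hψ : IsLemarieMeyer ψ) (J K : Fin N → ℤ) :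
    IsStableIntegral α P M (coeffKernel α ψ J K) (coeff α ψ P M J K) :=
  isStableIntegral_stableIntegral hM hα0 (memLp_coeffKernel hψ J K _)

theorem measureReal_exists_lt_norm_coeff_le (hM : IsIsotropicStableMeasure α P M) (hα0 : 0 < α)
    (hα2 : α < 2) {ψ : SchwartzMap ℝ ℝ} (hψ : IsLemarieMeyer ψ) {B : ℝ} (hB0 : 0 < B)
    (hB : ∀ ξ, ‖hat ψ ξ‖ ≤ B) (J : Fin N → ℤ) (F : Finset (Fin N → ℤ)) {τ x : ℝ} (hτ : 0 < τ)
    (hx : 0 < x) :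
    P.real {ω | ∃ K ∈ F, x < ‖coeff α ψ P M J K ω‖} ≤
      4 * (4 / τ) ^ α * (18 * B ^ α) ^ N + F.card *
        (4 * Real.exp (-(x / (8 * τ)) + 8 / (2 - α) * (4 / τ) ^ α * (18 * B ^ α) ^ N)) := by
  set b := ∏ l, ((2 : ℝ) ^ (-((J l : ℝ) / α)) * B)
  have hb : 0 < b := Finset.prod_pos fun l _ => by positivity
  have hscale (c : ℝ) : c * (4 / (τ / b)) ^ α * volume.real (freqBox J) =
      c * (4 / τ) ^ α * (18 * B ^ α) ^ N := by
    rw [← prod_rpow_mul_volume_freqBox hα0.ne' hB0.le J, div_div_eq_mul_div, mul_div_right_comm,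
      Real.mul_rpow (by positivity) hb.le]
    ring
  have hmax := measureReal_exists_lt_norm_stableIntegral_le hM hα0 hα2 (κ := F)
    (F := fun y K => coeffKernel α ψ J K y) (X := fun K => coeff α ψ P M J K)
    (measurable_pi_iff.2 fun K => (continuous_coeffKernel ψ J K).measurable)
    (fun K => isStableIntegral_coeff hM hα0 hψ J K) hb (div_pos hτ hb)
    (fun y => (pi_norm_le_iff_of_nonneg hb.le).2 fun K => norm_coeffKernel_le hB J K y)
    (S := freqBox J) (by rw [volume_freqBox]; exact ENNReal.ofReal_lt_top)
    (fun y hy => funext fun K => coeffKernel_eq_zero hψ J K hy) hx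
  have hdiv : x / (8 * b * (τ / b)) = x / (8 * τ) := by field_simp
  rw [hscale, hscale, hdiv, Fintype.card_coe] at hmax
  simpa only [Subtype.exists, exists_prop] using hmax

theorem exists_measureReal_exists_lt_norm_coeff_le (hM : IsIsotropicStableMeasure α P M)
    (hα0 : 0 < α) (hα2 : α < 2) {ψ : SchwartzMap ℝ ℝ} (hψ : IsLemarieMeyer ψ) :
    ∃ A : ℝ, ∀ (J : Fin N → ℤ) (F : Finset (Fin N → ℤ)) (τ x : ℝ), 1 ≤ τ → 0 < x →
      P.real {ω | ∃ K ∈ F, x < ‖coeff α ψ P M J K ω‖} ≤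
        A * (τ ^ (-α) + F.card * Real.exp (-(x / (8 * τ)))) := by
  obtain ⟨B, hB0, hB⟩ := hψ.exists_norm_hat_le
  have := sub_pos.2 hα2
  set C : ℝ := 4 ^ α * (18 * B ^ α) ^ N
  refine ⟨max (4 * C) (4 * Real.exp (8 / (2 - α) * C)), fun J F τ x hτ hx => ?_⟩
  have hτ0 : 0 < τ := by linarith
  have hscale (c : ℝ) : c * (4 / τ) ^ α * (18 * B ^ α) ^ N = c * C * τ ^ (-α) := by
    rw [Real.div_rpow (by norm_num) hτ0.le, Real.rpow_neg hτ0.le]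
    ring
  have htail := measureReal_exists_lt_norm_coeff_le hM hα0 hα2 hψ hB0 hB J F hτ0 hx
  rw [hscale, hscale] at htail
  have hexp : Real.exp (-(x / (8 * τ)) + 8 / (2 - α) * C * τ ^ (-α)) ≤
      Real.exp (8 / (2 - α) * C) * Real.exp (-(x / (8 * τ))) := by
    rw [← Real.exp_add, add_comm]
    exact Real.exp_le_exp.2 (add_le_add_left (mul_le_of_le_one_right (by positivity)
      (Real.rpow_le_one_of_one_le_of_nonpos hτ (by linarith))) _)
  calc P.real {ω | ∃ K ∈ F, x < ‖coeff α ψ P M J K ω‖}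
      ≤ 4 * C * τ ^ (-α) +
          F.card * (4 * (Real.exp (8 / (2 - α) * C) * Real.exp (-(x / (8 * τ))))) :=
        htail.trans (by gcongr)
    _ = 4 * C * τ ^ (-α) +
          4 * Real.exp (8 / (2 - α) * C) * (F.card * Real.exp (-(x / (8 * τ)))) := by ring
    _ ≤ _ := by
        rw [mul_add]
        gcongr
        · exact le_max_left _ _
        · exact le_max_right _ _

theorem ae_exists_norm_coeff_le (hM : IsIsotropicStableMeasure α P M) (hα0 : 0 < α)
    (hα2 : α < 2) {ψ : SchwartzMap ℝ ℝ} (hψ : IsLemarieMeyer ψ) {η : ℝ} (hη : 0 < η) :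
    ∀ᵐ ω ∂P, ∃ C : ℝ, 0 ≤ C ∧ ∀ J K, ‖coeff α ψ P M J K ω‖ ≤
      C * ∏ l, ((2 : ℝ) ^ (η * |(J l : ℝ)|) * (1 + |(K l : ℝ)|) ^ η) := by
  obtain ⟨A, hA⟩ := exists_measureReal_exists_lt_norm_coeff_le hM hα0 hα2 hψ
  exact ae_exists_norm_le_of_tail hα0 hA hη

end Coefficients

/-! ### Decay of the fractional primitives of the wavelet -/

section FracPrim

open scoped FourierTransform SchwartzMap

theorem contDiff_hat_div_rpow {ψ : SchwartzMap ℝ ℝ} (hψ : IsLemarieMeyer ψ) (s : ℝ) :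
    ContDiff ℝ (⊤ : ℕ∞) fun η : ℝ => hat ψ η / ((|η| ^ s : ℝ) : ℂ) := by
  refine contDiff_iff_contDiffAt.2 fun η => ?_
  rcases eq_or_ne η 0 with rfl | hη
  · refine contDiffAt_const (c := (0 : ℂ)) |>.congr_of_eventuallyEq ?_
    filter_upwards [Metric.ball_mem_nhds (0 : ℝ) (ε := 1) one_pos] with η hη
    have hat_eq_zero : hat ψ η = 0 := by
      by_contra hne
      have hlower := (hψ.support_hat η hne).1
      rw [mem_ball_zero_iff, Real.norm_eq_abs] at hη
      linarith [Real.pi_gt_three]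
    rw [hat_eq_zero, zero_div]
  · simp only [div_eq_mul_inv]
    refine (contDiff_hat ψ).contDiffAt.mul (ContDiffAt.inv ?_ ?_)
    · exact Complex.ofRealCLM.contDiff.contDiffAt.comp η
        ((contDiffAt_abs hη).rpow_const_of_ne (abs_ne_zero.2 hη))
    · exact_mod_cast (Real.rpow_pos_of_pos (abs_pos.2 hη) s).ne'

theorem exists_schwartzMap_eq_fracPrim {ψ : SchwartzMap ℝ ℝ} (hψ : IsLemarieMeyer ψ) (α v : ℝ) :
    ∃ Φ : 𝓢(ℝ, ℂ), ∀ y, fracPrim α ψ v y = Φ y := by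
  have hsupp : HasCompactSupport fun η : ℝ => hat ψ η / ((|η| ^ (v + 1 / α) : ℝ) : ℂ) := by
    simp only [div_eq_mul_inv]
    exact hψ.hasCompactSupport_hat.mul_right
  set g : 𝓢(ℝ, ℂ) := hsupp.toSchwartzMap (contDiff_hat_div_rpow hψ _)
  have h2π : (2 * Real.pi)⁻¹ ≠ 0 := inv_ne_zero (by positivity)
  refine ⟨SchwartzMap.compCLMOfContinuousLinearEquiv ℝ
    (ContinuousLinearEquiv.smulLeft (R₁ := ℝ) (M₁ := ℝ) (Units.mk0 _ h2π)) (𝓕⁻ g), fun y => ?_⟩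
  change _ = (𝓕⁻ g) ((2 * Real.pi)⁻¹ * y)
  rw [SchwartzMap.fourierInv_coe, Real.fourierInv_eq', fracPrim]
  refine integral_congr_ae (Eventually.of_forall fun η => ?_)
  simp only [smul_eq_mul, RCLike.inner_apply, conj_trivial]
  congr 2
  push_cast
  field_simp

/-- The model `(1 + |z|)^{-p}` of polynomial decay of order `p`. -/
noncomputable def decay (p : ℕ) (z : ℝ) : ℝ := ((1 + |z|) ^ p)⁻¹

theorem decay_nonneg (p : ℕ) (z : ℝ) : 0 ≤ decay p z := by unfold decay; positivity

theorem decay_succ (p : ℕ) (z : ℝ) : decay (p + 1) z = (1 + |z|)⁻¹ * decay p z := by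
  rw [decay, decay, pow_succ, mul_inv, mul_comm]

theorem decay_le_of_abs_sub_le_one (p : ℕ) {u z : ℝ} (h : |u - z| ≤ 1) :
    decay p z ≤ 2 ^ p * decay p u := by
  unfold decay
  rw [← div_eq_mul_inv, le_div_iff₀ (by positivity), ← div_eq_inv_mul, div_le_iff₀ (by positivity),
    ← mul_pow]
  gcongr
  linarith [abs_nonneg z, abs_sub_abs_le_abs_sub u z]

theorem exists_norm_schwartz_le_decay (Φ : 𝓢(ℝ, ℂ)) (p : ℕ) : ∃ C : ℝ, 0 ≤ C ∧
    ∀ z, ‖Φ z‖ ≤ C * decay p z ∧ ‖deriv Φ z‖ ≤ C * decay p z := by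
  set C : ℝ := 2 ^ p * ((Finset.Iic (p, 1)).sup fun m => SchwartzMap.seminorm ℝ m.1 m.2) Φ
  have hseminorm : ∀ n ≤ 1, ∀ z : ℝ, (1 + |z|) ^ p * ‖iteratedFDeriv ℝ n Φ z‖ ≤ C :=
    fun n hn z => SchwartzMap.one_add_le_sup_seminorm_apply (𝕜 := ℝ) (m := (p, 1)) le_rfl hn Φ z
  have hdecay {b z : ℝ} (h : (1 + |z|) ^ p * b ≤ C) : b ≤ C * decay p z := by
    rwa [decay, ← div_eq_mul_inv, le_div_iff₀' (by positivity)]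
  refine ⟨C, (by positivity : (0 : ℝ) ≤ _).trans (hseminorm 0 zero_le_one 0), fun z => ⟨?_, ?_⟩⟩
  · simpa only [norm_iteratedFDeriv_zero] using hdecay (hseminorm 0 zero_le_one z)
  · simpa only [norm_iteratedFDeriv_one, ← norm_deriv_eq_norm_fderiv]
      using hdecay (hseminorm 1 le_rfl z)

theorem exists_norm_schwartz_sub_le (Φ : 𝓢(ℝ, ℂ)) (p : ℕ) : ∃ C : ℝ, 0 ≤ C ∧
    ∀ u v, ‖Φ u - Φ v‖ ≤ C * min 1 |u - v| * (decay p u + decay p v) := by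
  obtain ⟨C, hC, hdecay⟩ := exists_norm_schwartz_le_decay Φ p
  refine ⟨2 ^ p * C, by positivity, fun u v => ?_⟩
  have one_le_two_pow : (1 : ℝ) ≤ 2 ^ p := one_le_pow₀ (by norm_num)
  have hu := decay_nonneg p u
  have hv := decay_nonneg p v
  rcases le_total 1 |u - v| with hfar | hnear
  · rw [min_eq_left hfar, mul_one]
    calc ‖Φ u - Φ v‖ ≤ ‖Φ u‖ + ‖Φ v‖ := norm_sub_le _ _
      _ ≤ C * decay p u + C * decay p v := add_le_add (hdecay u).1 (hdecay v).1
      _ = 1 * C * (decay p u + decay p v) := by ring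
      _ ≤ _ := by gcongr
  · rw [min_eq_right hnear]
    have hderiv (z : ℝ) (hz : z ∈ Set.uIcc v u) : ‖deriv Φ z‖ ≤ C * (2 ^ p * decay p u) := by
      refine (hdecay z).2.trans ?_
      gcongr
      exact decay_le_of_abs_sub_le_one p ((Set.abs_sub_right_of_mem_uIcc hz).trans hnear)
    calc ‖Φ u - Φ v‖ ≤ C * (2 ^ p * decay p u) * ‖u - v‖ :=
          Convex.norm_image_sub_le_of_norm_deriv_le (fun z _ => Φ.differentiableAt) hderiv
            (convex_uIcc v u) Set.left_mem_uIcc Set.right_mem_uIcc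
      _ = 2 ^ p * C * |u - v| * (decay p u + 0) := by rw [Real.norm_eq_abs]; ring
      _ ≤ _ := by gcongr

end FracPrim

/-! ### Sums over dyadic scales and integer translates -/

section DyadicSums

theorem summable_decay_two_intCast : Summable fun k : ℤ => decay 2 k := by
  have hnat : Summable fun n : ℕ => decay 2 ((n : ℝ)) := by
    refine ((summable_nat_add_iff (f := fun n : ℕ => 1 / (n : ℝ) ^ 2) 1).2
      (Real.summable_one_div_nat_pow.2 (by norm_num))).congr fun n => ?_
    rw [decay, abs_of_nonneg (by positivity)]
    push_cast
    rw [one_div, add_comm]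
  refine Summable.of_nat_of_neg (by simpa using hnat) (hnat.congr fun n => ?_)
  simp [decay]

theorem exists_sum_decay_two_sub_intCast_le : ∃ C : ℝ, 0 ≤ C ∧ ∀ (z : ℝ) (F : Finset ℤ),
    ∑ k ∈ F, decay 2 (z - k) ≤ C := by
  refine ⟨2 ^ 2 * ∑' k : ℤ, decay 2 k, mul_nonneg (by norm_num)
    (tsum_nonneg fun k => decay_nonneg _ _), fun z F => ?_⟩
  have hfloor : ∀ k ∈ F, decay 2 (z - k) ≤ 2 ^ 2 * decay 2 (((⌊z⌋ - k : ℤ) : ℤ) : ℝ) := by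
    refine fun k _ => decay_le_of_abs_sub_le_one 2 ?_
    push_cast
    rw [sub_sub_sub_cancel_right, abs_sub_comm, abs_of_nonneg (by linarith [Int.floor_le z])]
    linarith [Int.lt_floor_add_one z]
  refine (Finset.sum_le_sum hfloor).trans ?_
  rw [← Finset.mul_sum]
  gcongr
  rw [← Finset.sum_image (f := fun k : ℤ => decay 2 (k : ℝ)) (g := fun k => ⌊z⌋ - k)
    (fun a _ b _ hab => by simpa using hab)]
  exact summable_decay_two_intCast.sum_le_tsum _ (fun k _ => decay_nonneg _ _)

theorem two_rpow_neg_mul_natCast (δ : ℝ) (n : ℕ) :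
    (2 : ℝ) ^ (-(δ * n)) = ((2 : ℝ) ^ (-δ)) ^ n := by
  rw [← Real.rpow_natCast, ← Real.rpow_mul (by norm_num), neg_mul]

theorem two_rpow_neg_lt_one {δ : ℝ} (hδ : 0 < δ) : (2 : ℝ) ^ (-δ) < 1 :=
  Real.rpow_lt_one_of_one_lt_of_neg one_lt_two (neg_lt_zero.2 hδ)

theorem summable_two_rpow_neg_mul_abs_intCast {δ : ℝ} (hδ : 0 < δ) :
    Summable fun j : ℤ => (2 : ℝ) ^ (-(δ * |(j : ℝ)|)) := by
  have hnat : Summable fun n : ℕ => (2 : ℝ) ^ (-(δ * |(n : ℝ)|)) :=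
    (summable_geometric_of_lt_one (by positivity) (two_rpow_neg_lt_one hδ)).congr fun n => by
      rw [abs_of_nonneg (by positivity), two_rpow_neg_mul_natCast]
  exact Summable.of_nat_of_neg (by simpa using hnat) (by simpa using hnat)

/-- The model bound for a wavelet indexed by scale and position `q = (j, k)`, evaluated at `x`:
exponential decay of rate `δ` in `|j|` and polynomial decay of order `p` in `2^j x - k`. -/
noncomputable def waveDecay (δ : ℝ) (p : ℕ) (x : ℝ) (q : ℤ × ℤ) : ℝ :=
  (2 : ℝ) ^ (-(δ * |(q.1 : ℝ)|)) * decay p ((2 : ℝ) ^ q.1 * x - q.2)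

theorem waveDecay_nonneg (δ : ℝ) (p : ℕ) (x : ℝ) (q : ℤ × ℤ) : 0 ≤ waveDecay δ p x q :=
  mul_nonneg (by positivity) (decay_nonneg _ _)

theorem waveDecay_anti {δ δ' : ℝ} (hδ : δ ≤ δ') {p p' : ℕ} (hp : p ≤ p') (x : ℝ) (q : ℤ × ℤ) :
    waveDecay δ' p' x q ≤ waveDecay δ p x q := by
  unfold waveDecay decay
  gcongr
  · exact one_le_two
  · exact le_add_of_nonneg_right (abs_nonneg _)

theorem exists_sum_waveDecay_two_le {δ : ℝ} (hδ : 0 < δ) : ∃ C : ℝ, 0 ≤ C ∧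
    ∀ (x : ℝ) (F : Finset (ℤ × ℤ)), ∑ q ∈ F, waveDecay δ 2 x q ≤ C := by
  classical
  obtain ⟨C, hC, hsum⟩ := exists_sum_decay_two_sub_intCast_le
  refine ⟨(∑' j : ℤ, (2 : ℝ) ^ (-(δ * |(j : ℝ)|))) * C,
    mul_nonneg (tsum_nonneg fun j => by positivity) hC, fun x F => ?_⟩
  calc _ ≤ ∑ q ∈ F.image Prod.fst ×ˢ F.image Prod.snd, waveDecay δ 2 x q := by
        refine Finset.sum_le_sum_of_subset_of_nonneg (fun q hq => ?_) fun q _ _ =>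
          waveDecay_nonneg _ _ _ _
        exact Finset.mem_product.2 ⟨Finset.mem_image_of_mem _ hq, Finset.mem_image_of_mem _ hq⟩
    _ = ∑ j ∈ F.image Prod.fst, (2 : ℝ) ^ (-(δ * |(j : ℝ)|)) *
        ∑ k ∈ F.image Prod.snd, decay 2 ((2 : ℝ) ^ j * x - k) := by
        rw [Finset.sum_product]
        simp only [Finset.mul_sum, waveDecay]
    _ ≤ ∑ j ∈ F.image Prod.fst, (2 : ℝ) ^ (-(δ * |(j : ℝ)|)) * C := by
        gcongr
        exact hsum _ _
    _ ≤ _ := by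
        rw [← Finset.sum_mul]
        gcongr
        exact (summable_two_rpow_neg_mul_abs_intCast hδ).sum_le_tsum _ (fun j _ => by positivity)

/-- The index set `D^1_{n,R}` of one coordinate: `|j| ≤ n` and `|k| ≤ R 2^(n+1)`. -/
noncomputable def indexSet₁ (n : ℕ) (R : ℝ) : Finset (ℤ × ℤ) :=
  Finset.Icc (-(n : ℤ)) n ×ˢ Finset.Icc (-⌊R * 2 ^ (n + 1)⌋) ⌊R * 2 ^ (n + 1)⌋

theorem mem_indexSet₁ {n : ℕ} {R : ℝ} {q : ℤ × ℤ} :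
    q ∈ indexSet₁ n R ↔ |(q.1 : ℝ)| ≤ n ∧ |(q.2 : ℝ)| ≤ R * 2 ^ (n + 1) := by
  rw [indexSet₁, Finset.mem_product, Finset.mem_Icc, Finset.mem_Icc, ← abs_le, ← abs_le,
    Int.le_floor, Int.cast_abs]
  exact and_congr (by exact_mod_cast Iff.rfl) Iff.rfl

/-- The gain, from half of the decay in the scale and one order of decay in the position, for a
term of a wavelet series whose index lies outside `indexSet₁ n R`. -/
noncomputable def tailFactor (δ R : ℝ) (n : ℕ) : ℝ := (2 : ℝ) ^ (-(δ * n)) + (R * 2 ^ n)⁻¹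

theorem tailFactor_nonneg (δ : ℝ) {R : ℝ} (hR : 0 ≤ R) (n : ℕ) : 0 ≤ tailFactor δ R n := by
  unfold tailFactor; positivity

theorem tendsto_tailFactor {δ : ℝ} (hδ : 0 < δ) (R : ℝ) :
    Tendsto (tailFactor δ R) atTop (𝓝 0) := by
  have hscale : Tendsto (fun n : ℕ => (2 : ℝ) ^ (-(δ * n))) atTop (𝓝 0) := by
    simp only [two_rpow_neg_mul_natCast]
    exact tendsto_pow_atTop_nhds_zero_of_lt_one (by positivity) (two_rpow_neg_lt_one hδ)
  have hposition : Tendsto (fun n : ℕ => (R * 2 ^ n)⁻¹) atTop (𝓝 0) := by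
    simpa only [mul_inv, one_div, inv_pow, mul_zero] using
      (tendsto_pow_atTop_nhds_zero_of_lt_one (r := (1 / 2 : ℝ)) (by norm_num)
        (by norm_num)).const_mul R⁻¹
  simpa only [add_zero] using! hscale.add hposition

theorem mul_two_pow_le_one_add_abs_two_zpow_mul_sub {n : ℕ} {j : ℤ} (hj : j ≤ n) {R x k : ℝ}
    (hx : |x| ≤ R) (hk : R * 2 ^ (n + 1) ≤ |k|) : R * 2 ^ n ≤ 1 + |2 ^ j * x - k| := by
  have hpoint : |2 ^ j * x| ≤ 2 ^ n * R := by
    rw [abs_mul, abs_of_pos (by positivity)]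
    gcongr
    rw [← zpow_natCast]
    exact zpow_le_zpow_right₀ (by norm_num) hj
  have htriangle := abs_sub_abs_le_abs_sub k (2 ^ j * x)
  rw [abs_sub_comm k] at htriangle
  rw [pow_succ] at hk
  linarith

theorem two_rpow_mul_inv_le_tailFactor {δ R : ℝ} (hδ : 0 < δ) (hR : 0 < R) {n : ℕ} {q : ℤ × ℤ}
    (hq : q ∉ indexSet₁ n R) {x : ℝ} (hx : |x| ≤ R) :
    (2 : ℝ) ^ (-(δ * |(q.1 : ℝ)|)) * (1 + |2 ^ q.1 * x - q.2|)⁻¹ ≤ tailFactor δ R n := by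
  by_cases hj : |(q.1 : ℝ)| ≤ n
  · have hk : R * 2 ^ (n + 1) ≤ |(q.2 : ℝ)| := by
      by_contra hk
      exact hq (mem_indexSet₁.2 ⟨hj, (not_le.1 hk).le⟩)
    have hj' : q.1 ≤ n := by exact_mod_cast (le_abs_self _).trans hj
    calc _ ≤ 1 * (R * 2 ^ n)⁻¹ := by
          gcongr
          · exact Real.rpow_le_one_of_one_le_of_nonpos one_le_two
              (neg_nonpos.2 (by positivity))
          · exact mul_two_pow_le_one_add_abs_two_zpow_mul_sub hj' hx hk
      _ ≤ tailFactor δ R n := by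
          rw [one_mul, tailFactor]
          exact le_add_of_nonneg_left (by positivity)
  · calc _ ≤ (2 : ℝ) ^ (-(δ * n)) * 1 := by
          gcongr
          · exact one_le_two
          · exact (not_le.1 hj).le
          · exact inv_le_one_of_one_le₀ (le_add_of_nonneg_right (abs_nonneg _))
      _ ≤ tailFactor δ R n := by
          rw [mul_one, tailFactor]
          exact le_add_of_nonneg_right (by positivity)

theorem waveDecay_succ_le_tailFactor_mul {δ R : ℝ} (hδ : 0 < δ) (hR : 0 < R) {n : ℕ}
    {q : ℤ × ℤ} (hq : q ∉ indexSet₁ n R) {x : ℝ} (hx : |x| ≤ R) (p : ℕ) :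
    waveDecay (2 * δ) (p + 1) x q ≤ tailFactor δ R n * waveDecay δ p x q := by
  have hsplit : (2 : ℝ) ^ (-(2 * δ * |(q.1 : ℝ)|)) =
      (2 : ℝ) ^ (-(δ * |(q.1 : ℝ)|)) * (2 : ℝ) ^ (-(δ * |(q.1 : ℝ)|)) := by
    rw [← Real.rpow_add two_pos]
    ring_nf
  have := waveDecay_nonneg δ p x q
  calc waveDecay (2 * δ) (p + 1) x q = ((2 : ℝ) ^ (-(δ * |(q.1 : ℝ)|)) *
        (1 + |2 ^ q.1 * x - q.2|)⁻¹) * waveDecay δ p x q := by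
        rw [waveDecay, waveDecay, hsplit, decay_succ]
        ring
    _ ≤ _ := by
        gcongr
        exact two_rpow_mul_inv_le_tailFactor hδ hR hq hx

theorem exists_sum_waveDecay_three_le {δ R : ℝ} (hδ : 0 < δ) (hR : 0 < R) : ∃ C : ℝ, 0 ≤ C ∧
    ∀ (x : ℝ) (F : Finset (ℤ × ℤ)), ∑ q ∈ F, waveDecay (2 * δ) 3 x q ≤ C ∧
      ∀ n, |x| ≤ R → (∀ q ∈ F, q ∉ indexSet₁ n R) →
        ∑ q ∈ F, waveDecay (2 * δ) 3 x q ≤ tailFactor δ R n * C := by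
  obtain ⟨C, hC, hsum⟩ := exists_sum_waveDecay_two_le hδ
  refine ⟨C, hC, fun x F => ⟨?_, fun n hx hF => ?_⟩⟩
  · exact (Finset.sum_le_sum fun q _ => waveDecay_anti (by linarith) (by norm_num) x q).trans
      (hsum x F)
  · refine (Finset.sum_le_sum fun q hq =>
      waveDecay_succ_le_tailFactor_mul hδ hR (hF q hq) hx 2).trans ?_
    rw [← Finset.mul_sum]
    exact mul_le_mul_of_nonneg_left (hsum x F) (tailFactor_nonneg δ hR.le n)

end DyadicSums

/-! ### A majorant for the one-dimensional terms of the series -/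

section Majorant

open scoped SchwartzMap

theorem one_add_abs_rpow_mul_decay_succ_le {η R x : ℝ} (hη0 : 0 ≤ η) (hη1 : η ≤ 1) (hx : |x| ≤ R)
    (j : ℤ) (k : ℝ) (p : ℕ) :
    (1 + |k|) ^ η * decay (p + 1) ((2 : ℝ) ^ j * x - k) ≤
      (1 + R) * (2 : ℝ) ^ (η * |(j : ℝ)|) * decay p ((2 : ℝ) ^ j * x - k) := by
  set u := (2 : ℝ) ^ j * x - k with hu
  have hR : 0 ≤ R := (abs_nonneg x).trans hx
  have one_le_two_rpow : (1 : ℝ) ≤ 2 ^ |(j : ℝ)| := Real.one_le_rpow one_le_two (abs_nonneg _)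
  have two_zpow_le : (2 : ℝ) ^ j ≤ 2 ^ |(j : ℝ)| := by
    rw [← Real.rpow_intCast]
    exact Real.rpow_le_rpow_of_exponent_le one_le_two (le_abs_self _)
  have abs_le : |k| ≤ |u| + 2 ^ |(j : ℝ)| * R := by
    rw [show k = 2 ^ j * x - u by rw [hu]; ring]
    refine (abs_sub _ _).trans ?_
    rw [abs_mul, abs_of_pos (by positivity : (0 : ℝ) < 2 ^ j), add_comm]
    gcongr
  have one_add_abs_le : 1 + |k| ≤ (1 + |u|) * ((1 + R) * 2 ^ |(j : ℝ)|) := by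
    have : 0 ≤ |u| * R * 2 ^ |(j : ℝ)| := by positivity
    nlinarith [abs_nonneg u, mul_le_mul_of_nonneg_left one_le_two_rpow (abs_nonneg u)]
  rw [decay_succ, ← mul_assoc]
  refine mul_le_mul_of_nonneg_right ?_ (decay_nonneg p u)
  rw [← div_eq_mul_inv, div_le_iff₀ (by positivity)]
  calc (1 + |k|) ^ η ≤ ((1 + |u|) * ((1 + R) * 2 ^ |(j : ℝ)|)) ^ η := by gcongr
    _ = (1 + |u|) ^ η * ((1 + R) ^ η * (2 : ℝ) ^ (η * |(j : ℝ)|)) := by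
      rw [Real.mul_rpow (by positivity) (by positivity), Real.mul_rpow (by positivity)
        (by positivity), ← Real.rpow_mul (by norm_num), mul_comm η]
    _ ≤ (1 + |u|) * ((1 + R) * (2 : ℝ) ^ (η * |(j : ℝ)|)) := by
      gcongr
      · exact Real.rpow_le_self_of_one_le (by linarith [abs_nonneg u]) hη1
      · exact Real.rpow_le_self_of_one_le (by linarith) hη1
    _ = _ := by ring

theorem min_one_le_rpow {z γ : ℝ} (hz : 0 ≤ z) (hγ0 : 0 ≤ γ) (hγ1 : γ ≤ 1) : min 1 z ≤ z ^ γ := by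
  rcases le_total 1 z with h | h
  · exact (min_le_left _ _).trans (Real.one_le_rpow h hγ0)
  · exact (min_le_right _ _).trans (Real.self_le_rpow_of_le_one hz h hγ1)

theorem le_one_add_mul_rpow {d D γ : ℝ} (hd : 0 ≤ d) (hdD : d ≤ D) (hγ0 : 0 ≤ γ) (hγ1 : γ ≤ 1) :
    d ≤ (1 + D) * d ^ γ := by
  have hrpow : d ^ (1 - γ) ≤ 1 + D := by
    calc d ^ (1 - γ) ≤ (1 + D) ^ (1 - γ) := by gcongr; linarith
      _ ≤ 1 + D := Real.rpow_le_self_of_one_le (by linarith) (by linarith)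
  calc d = d ^ (1 - γ) * d ^ γ := by
        rw [← Real.rpow_add_of_nonneg hd (by linarith) hγ0, sub_add_cancel, Real.rpow_one]
    _ ≤ _ := by gcongr

theorem two_rpow_mul_min_le_of_nonneg {H γ κ δ d : ℝ} (hγ0 : 0 ≤ γ) (hγ1 : γ ≤ 1)
    (hH : γ + κ + δ ≤ H) {j : ℤ} (hj : 0 ≤ j) (hd : 0 ≤ d) :
    (2 : ℝ) ^ (-((j : ℝ) * H)) * (2 : ℝ) ^ (κ * |(j : ℝ)|) * min 1 ((2 : ℝ) ^ j * d) ≤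
      (2 : ℝ) ^ (-(δ * |(j : ℝ)|)) * d ^ γ := by
  have hj' : (0 : ℝ) ≤ j := by exact_mod_cast hj
  rw [abs_of_nonneg hj']
  calc _ ≤ (2 : ℝ) ^ (-((j : ℝ) * H)) * (2 : ℝ) ^ (κ * j) * ((2 : ℝ) ^ j * d) ^ γ := by
        gcongr
        exact min_one_le_rpow (by positivity) hγ0 hγ1
    _ = (2 : ℝ) ^ (-((j : ℝ) * H) + κ * j + j * γ) * d ^ γ := by
        rw [Real.mul_rpow (by positivity) hd, ← Real.rpow_intCast 2 j,
          ← Real.rpow_mul (by norm_num), Real.rpow_add (by norm_num), Real.rpow_add (by norm_num)]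
        ring
    _ ≤ (2 : ℝ) ^ (-(δ * j)) * d ^ γ := by
        gcongr
        · exact one_le_two
        · nlinarith

theorem two_rpow_mul_min_le_of_nonpos {H κ δ d : ℝ} (hH : H + κ + δ ≤ 1) {j : ℤ} (hj : j ≤ 0)
    (hd : 0 ≤ d) :
    (2 : ℝ) ^ (-((j : ℝ) * H)) * (2 : ℝ) ^ (κ * |(j : ℝ)|) * min 1 ((2 : ℝ) ^ j * d) ≤
      (2 : ℝ) ^ (-(δ * |(j : ℝ)|)) * d := by
  have hj' : (j : ℝ) ≤ 0 := by exact_mod_cast hj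
  rw [abs_of_nonpos hj']
  calc _ ≤ (2 : ℝ) ^ (-((j : ℝ) * H)) * (2 : ℝ) ^ (κ * -j) * ((2 : ℝ) ^ j * d) := by
        gcongr
        exact min_le_right _ _
    _ = (2 : ℝ) ^ (-((j : ℝ) * H) + κ * -j + j) * d := by
        rw [← Real.rpow_intCast 2 j, Real.rpow_add (by norm_num), Real.rpow_add (by norm_num)]
        ring
    _ ≤ _ := by
        gcongr
        · exact one_le_two
        · nlinarith

theorem two_rpow_mul_min_le {H γ κ δ d D : ℝ} (hγ0 : 0 ≤ γ) (hγ1 : γ ≤ 1) (hlo : γ + κ + δ ≤ H)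
    (hhi : H + κ + δ ≤ 1) (j : ℤ) (hd : 0 ≤ d) (hdD : d ≤ D) :
    (2 : ℝ) ^ (-((j : ℝ) * H)) * (2 : ℝ) ^ (κ * |(j : ℝ)|) * min 1 ((2 : ℝ) ^ j * d) ≤
      (1 + D) * (2 : ℝ) ^ (-(δ * |(j : ℝ)|)) * d ^ γ := by
  have := hd.trans hdD
  rcases le_total 0 j with hj | hj
  · refine (two_rpow_mul_min_le_of_nonneg hγ0 hγ1 hlo hj hd).trans ?_
    rw [mul_assoc]
    exact le_mul_of_one_le_left (by positivity) (by linarith)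
  · calc _ ≤ (2 : ℝ) ^ (-(δ * |(j : ℝ)|)) * d := two_rpow_mul_min_le_of_nonpos hhi hj hd
      _ ≤ (2 : ℝ) ^ (-(δ * |(j : ℝ)|)) * ((1 + D) * d ^ γ) := by
          gcongr
          exact le_one_add_mul_rpow hd hdD hγ0 hγ1
      _ = _ := by ring

/-- The weight `2^{-jH}` of the term `(j, k)` of the series times the almost sure growth rate
`2^{η|j|} (1 + |k|)^η` of its random coefficient. -/
noncomputable def weight (H η : ℝ) (q : ℤ × ℤ) : ℝ :=
  (2 : ℝ) ^ (-((q.1 : ℝ) * H)) * ((2 : ℝ) ^ (η * |(q.1 : ℝ)|) * (1 + |(q.2 : ℝ)|) ^ η)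

theorem weight_nonneg (H η : ℝ) (q : ℤ × ℤ) : 0 ≤ weight H η q := by unfold weight; positivity

/-- The increment `Φ(2^j x - k) - Φ(-k)` of a wavelet with index `q = (j, k)` between `0`
and `x`. -/
noncomputable def waveInc (Φ : ℝ → ℂ) (q : ℤ × ℤ) (x : ℝ) : ℂ :=
  Φ ((2 : ℝ) ^ q.1 * x - q.2) - Φ (-(q.2 : ℝ))

theorem waveInc_zero (Φ : ℝ → ℂ) (q : ℤ × ℤ) : waveInc Φ q 0 = 0 := by
  rw [waveInc, mul_zero, zero_sub, sub_self]

theorem exists_norm_waveInc_sub_le (Φ : 𝓢(ℝ, ℂ)) (p : ℕ) : ∃ C : ℝ, 0 ≤ C ∧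
    ∀ (q : ℤ × ℤ) (x y : ℝ), ‖waveInc Φ q x - waveInc Φ q y‖ ≤ C * min 1 ((2 : ℝ) ^ q.1 * |x - y|) *
      (decay p ((2 : ℝ) ^ q.1 * x - q.2) + decay p ((2 : ℝ) ^ q.1 * y - q.2)) := by
  obtain ⟨C, hC, hΦ⟩ := exists_norm_schwartz_sub_le Φ p
  refine ⟨C, hC, fun q x y => ?_⟩
  have hpoints := hΦ ((2 : ℝ) ^ q.1 * x - q.2) ((2 : ℝ) ^ q.1 * y - q.2)
  rw [sub_sub_sub_cancel_right, ← mul_sub, abs_mul,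
    abs_of_pos (by positivity : (0 : ℝ) < 2 ^ q.1)] at hpoints
  rwa [waveInc, waveInc, sub_sub_sub_cancel_right]

theorem exists_weight_mul_norm_waveInc_sub_le (Φ : 𝓢(ℝ, ℂ)) {H γ η δ R : ℝ} (hγ : 0 ≤ γ)
    (hη : 0 ≤ η) (hδ : 0 ≤ δ) (hR : 0 ≤ R) (hlo : γ + 2 * η + δ ≤ H) (hhi : H + 2 * η + δ ≤ 1) :
    ∃ C : ℝ, 0 ≤ C ∧ ∀ (q : ℤ × ℤ) (x y : ℝ), |x| ≤ R → |y| ≤ R →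
      weight H η q * ‖waveInc Φ q x - waveInc Φ q y‖ ≤
        C * (waveDecay δ 3 x q + waveDecay δ 3 y q) * |x - y| ^ γ := by
  obtain ⟨C, hC, hΦ⟩ := exists_norm_waveInc_sub_le Φ 4
  refine ⟨C * (1 + R) * (1 + 2 * R), by positivity, fun q x y hx hy => ?_⟩
  set j : ℝ := (q.1 : ℝ)
  set k : ℝ := (q.2 : ℝ)
  set u := (2 : ℝ) ^ q.1 * x - k
  set v := (2 : ℝ) ^ q.1 * y - k
  set m := min 1 ((2 : ℝ) ^ q.1 * |x - y|)
  have : 0 ≤ m := le_min zero_le_one (by positivity)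
  have hshift {z : ℝ} (hz : |z| ≤ R) := one_add_abs_rpow_mul_decay_succ_le hη
    (by linarith : η ≤ 1) hz q.1 k 3
  have hscale := two_rpow_mul_min_le hγ (by linarith) hlo hhi q.1 (abs_nonneg (x - y))
    ((abs_sub x y).trans (by linarith) : |x - y| ≤ 2 * R)
  have := decay_nonneg 3 u
  have := decay_nonneg 3 v
  calc weight H η q * ‖waveInc Φ q x - waveInc Φ q y‖
      ≤ weight H η q * (C * m * (decay 4 u + decay 4 v)) :=
        mul_le_mul_of_nonneg_left (hΦ q x y) (weight_nonneg _ _ _)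
    _ = C * ((2 : ℝ) ^ (-(j * H)) * (2 : ℝ) ^ (η * |j|) * m) *
          ((1 + |k|) ^ η * decay 4 u + (1 + |k|) ^ η * decay 4 v) := by
        rw [weight]
        ring
    _ ≤ C * ((2 : ℝ) ^ (-(j * H)) * (2 : ℝ) ^ (η * |j|) * m) *
          ((1 + R) * (2 : ℝ) ^ (η * |j|) * decay 3 u +
            (1 + R) * (2 : ℝ) ^ (η * |j|) * decay 3 v) := by
        gcongr C * _ * (?_ + ?_)
        exacts [hshift hx, hshift hy]
    _ = C * (1 + R) * ((2 : ℝ) ^ (-(j * H)) * (2 : ℝ) ^ (2 * η * |j|) * m) *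
          (decay 3 u + decay 3 v) := by
        rw [two_mul η, add_mul η η, Real.rpow_add two_pos]
        ring
    _ ≤ C * (1 + R) * ((1 + 2 * R) * (2 : ℝ) ^ (-(δ * |j|)) * |x - y| ^ γ) *
          (decay 3 u + decay 3 v) := by gcongr
    _ = _ := by
        rw [waveDecay, waveDecay]
        ring

/-- A majorant `a x q` for the weighted increments of the wavelets on `[-R, R]` and, in the manner
of Hölder continuity, for their increments between two points; its sums over `q` are bounded by
`S`, and by `ε n` outside the index set `indexSet₁ n R`, uniformly in `x`. -/
structure IsIncrementMajorant (Φ : ℝ → ℂ) (H η γ R : ℝ) (a : ℝ → ℤ × ℤ → ℝ) (S : ℝ) (ε : ℕ → ℝ) :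
    Prop where
  norm_le : ∀ {x : ℝ} (q : ℤ × ℤ), |x| ≤ R → weight H η q * ‖waveInc Φ q x‖ ≤ a x q
  norm_sub_le : ∀ {x y : ℝ} (q : ℤ × ℤ), |x| ≤ R → |y| ≤ R →
    weight H η q * ‖waveInc Φ q x - waveInc Φ q y‖ ≤ (a x q + a y q) * |x - y| ^ γ
  sum_le : ∀ {x : ℝ} (F : Finset (ℤ × ℤ)), |x| ≤ R → ∑ q ∈ F, a x q ≤ S
  sum_le_of_notMem : ∀ {x : ℝ} (n : ℕ) (F : Finset (ℤ × ℤ)), |x| ≤ R →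
    (∀ q ∈ F, q ∉ indexSet₁ n R) → ∑ q ∈ F, a x q ≤ ε n

theorem exists_rate_of_lt {H γ κ : ℝ} (hlo : γ + κ < H) (hhi : H + κ < 1) :
    ∃ δ > 0, γ + κ + 2 * δ ≤ H ∧ H + κ + 2 * δ ≤ 1 := by
  have := min_le_left (H - (γ + κ)) (1 - (H + κ))
  have := min_le_right (H - (γ + κ)) (1 - (H + κ))
  exact ⟨min (H - (γ + κ)) (1 - (H + κ)) / 2, half_pos (lt_min (by linarith) (by linarith)),
    by linarith, by linarith⟩

theorem exists_isIncrementMajorant (Φ : 𝓢(ℝ, ℂ)) {H γ η R : ℝ} (hγ : 0 ≤ γ) (hη : 0 ≤ η)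
    (hR : 0 < R) (hlo : γ + 2 * η < H) (hhi : H + 2 * η < 1) :
    ∃ (a : ℝ → ℤ × ℤ → ℝ) (S : ℝ) (ε : ℕ → ℝ), Tendsto ε atTop (𝓝 0) ∧
      IsIncrementMajorant Φ H η γ R a S ε := by
  obtain ⟨δ, hδ, hδlo, hδhi⟩ := exists_rate_of_lt hlo hhi
  obtain ⟨C, hC, hinc⟩ := exists_weight_mul_norm_waveInc_sub_le Φ (δ := 2 * δ) hγ hη
    (by linarith) hR.le hδlo hδhi
  obtain ⟨D, _, hsum⟩ := exists_sum_waveDecay_three_le hδ hR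
  have hzero : |(0 : ℝ)| ≤ R := by simpa only [abs_zero] using hR.le
  have hg := waveDecay_nonneg (2 * δ) 3
  refine ⟨fun x q => C * (1 + R) * (waveDecay (2 * δ) 3 x q + waveDecay (2 * δ) 3 0 q),
    C * (1 + R) * (D + D), fun n => C * (1 + R) * (tailFactor δ R n * D + tailFactor δ R n * D),
    ?_, fun {x} q hx => ?_, fun {x y} q hx hy => ?_, fun {x} F _ => ?_, fun {x} n F hx hF => ?_⟩
  · have hlim := (tendsto_tailFactor hδ R).mul_const D
    simpa only [zero_mul, add_zero, mul_zero] using (hlim.add hlim).const_mul (C * (1 + R))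
  · have hpow : |x| ^ γ ≤ 1 + R :=
      (Real.rpow_le_rpow (abs_nonneg x) (by linarith) hγ).trans
        (Real.rpow_le_self_of_one_le (by linarith) (by linarith))
    have hx0 := hinc q x 0 hx hzero
    rw [waveInc_zero, sub_zero, sub_zero] at hx0
    refine hx0.trans ((mul_le_mul_of_nonneg_left hpow
      (mul_nonneg hC (add_nonneg (hg x q) (hg 0 q)))).trans_eq (by ring))
  · refine (hinc q x y hx hy).trans (mul_le_mul_of_nonneg_right ?_ (by positivity))
    have := mul_nonneg hC (hg 0 q)
    have := mul_nonneg (mul_nonneg hC hR.le) (add_nonneg (add_nonneg (hg x q) (hg y q)) (hg 0 q))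
    have := mul_nonneg (mul_nonneg hC hR.le) (hg 0 q)
    linarith
  · rw [← Finset.mul_sum, Finset.sum_add_distrib]
    exact mul_le_mul_of_nonneg_left (add_le_add (hsum x F).1 (hsum 0 F).1) (by positivity)
  · rw [← Finset.mul_sum, Finset.sum_add_distrib]
    exact mul_le_mul_of_nonneg_left
      (add_le_add ((hsum x F).2 n hx hF) ((hsum 0 F).2 n hzero hF)) (by positivity)

end Majorant

/-! ### Uniform convergence of the series in Hölder norm -/

section Products

variable {N : ℕ}

theorem sum_indexSet_prod {A : Type*} [CommSemiring A] (n : ℕ) (R : ℝ) (f : Fin N → ℤ × ℤ → A) :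
    ∑ p ∈ indexSet N n R, ∏ l, f l (p.1 l, p.2 l) = ∏ l, ∑ q ∈ indexSet₁ n R, f l q := by
  rw [Finset.prod_univ_sum]
  refine Finset.sum_equiv (Equiv.arrowProdEquivProdArrow (Fin N) (fun _ => ℤ) fun _ => ℤ).symm
    (fun p => ?_) fun p _ => rfl
  simp only [indexSet, indexSet₁, Finset.mem_product, Fintype.mem_piFinset,
    Equiv.arrowProdEquivProdArrow_symm_apply, forall_and]

theorem indexSet₁_mono {R : ℝ} (hR : 0 ≤ R) {m n : ℕ} (hnm : n ≤ m) :
    indexSet₁ n R ⊆ indexSet₁ m R := by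
  intro q hq
  rw [mem_indexSet₁] at *
  refine ⟨hq.1.trans (by exact_mod_cast hnm), hq.2.trans ?_⟩
  gcongr
  exact one_le_two

theorem indexSet_mono {R : ℝ} (hR : 0 ≤ R) {m n : ℕ} (hnm : n ≤ m) :
    indexSet N n R ⊆ indexSet N m R := by
  intro p hp
  rw [mem_indexSet] at *
  refine fun l => ⟨(hp l).1.trans (by exact_mod_cast hnm), (hp l).2.trans ?_⟩
  gcongr
  exact one_le_two

theorem norm_prod_sub_prod_le {ι A : Type*} [NormedCommRing A] [NormOneClass A] (s : Finset ι)
    {x y : ι → A} {b : ι → ℝ} {D : ℝ} (hD : 0 ≤ D) (hx : ∀ i, ‖x i‖ ≤ b i)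
    (hy : ∀ i, ‖y i‖ ≤ b i) (hxy : ∀ i, ‖x i - y i‖ ≤ b i * D) :
    ‖∏ i ∈ s, x i - ∏ i ∈ s, y i‖ ≤ s.card * D * ∏ i ∈ s, b i := by
  classical
  have hb : ∀ i, 0 ≤ b i := fun i => (norm_nonneg _).trans (hx i)
  induction s using Finset.induction_on with
  | empty => simp
  | insert i s his ih =>
    rw [Finset.prod_insert his, Finset.prod_insert his, Finset.card_insert_of_notMem his,
      Finset.prod_insert his]
    have hprod : ‖∏ i ∈ s, x i‖ ≤ ∏ i ∈ s, b i :=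
      (Finset.norm_prod_le s x).trans
        (Finset.prod_le_prod (fun i _ => norm_nonneg _) fun i _ => hx i)
    have := mul_nonneg (hb i) hD
    calc ‖x i * ∏ i ∈ s, x i - y i * ∏ i ∈ s, y i‖
        = ‖(x i - y i) * ∏ i ∈ s, x i + y i * (∏ i ∈ s, x i - ∏ i ∈ s, y i)‖ := by
          congr 1; ring
      _ ≤ ‖x i - y i‖ * ‖∏ i ∈ s, x i‖ + ‖y i‖ * ‖∏ i ∈ s, x i - ∏ i ∈ s, y i‖ :=
          (norm_add_le _ _).trans (add_le_add (norm_mul_le _ _) (norm_mul_le _ _))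
      _ ≤ (b i * D) * ∏ i ∈ s, b i + b i * (s.card * D * ∏ i ∈ s, b i) := by
          gcongr
          exacts [hxy i, hb i, hy i]
      _ = _ := by push_cast; ring

theorem sum_indexSet_prod_le {f : Fin N → ℤ × ℤ → ℝ} (hf : ∀ l q, 0 ≤ f l q) {n : ℕ} {R T : ℝ}
    (hT : ∀ l, ∑ q ∈ indexSet₁ n R, f l q ≤ T) :
    ∑ p ∈ indexSet N n R, ∏ l, f l (p.1 l, p.2 l) ≤ T ^ N := by
  rw [sum_indexSet_prod]
  exact (Finset.prod_le_prod (fun l _ => Finset.sum_nonneg fun q _ => hf l q)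
    fun l _ => hT l).trans_eq (Fin.prod_const N T)

theorem sum_indexSet_sdiff_prod_le {f : Fin N → ℤ × ℤ → ℝ} (hf : ∀ l q, 0 ≤ f l q) {m n : ℕ}
    (hnm : n ≤ m) {R T e : ℝ} (hR : 0 ≤ R) (hT : 1 ≤ T) (he : 0 ≤ e)
    (hsum : ∀ l, ∑ q ∈ indexSet₁ m R, f l q ≤ T)
    (htail : ∀ l, ∑ q ∈ indexSet₁ m R \ indexSet₁ n R, f l q ≤ e) :
    ∑ p ∈ indexSet N m R \ indexSet N n R, ∏ l, f l (p.1 l, p.2 l) ≤ N * e * T ^ N := by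
  have norm_sum (l) (F : Finset (ℤ × ℤ)) : ‖∑ q ∈ F, f l q‖ = ∑ q ∈ F, f l q :=
    Real.norm_of_nonneg (Finset.sum_nonneg fun q _ => hf l q)
  have hprod := norm_prod_sub_prod_le (Finset.univ : Finset (Fin N)) (b := fun _ => T) he
    (x := fun l => ∑ q ∈ indexSet₁ m R, f l q) (y := fun l => ∑ q ∈ indexSet₁ n R, f l q)
    (fun l => (norm_sum l _).trans_le (hsum l))
    (fun l => (norm_sum l _).trans_le ((Finset.sum_le_sum_of_subset_of_nonneg
      (indexSet₁_mono hR hnm) fun q _ _ => hf l q).trans (hsum l)))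
    (fun l => by
      rw [← Finset.sum_sdiff_eq_sub (indexSet₁_mono hR hnm), norm_sum]
      exact (htail l).trans (le_mul_of_one_le_left he hT))
  rw [Finset.sum_sdiff_eq_sub (indexSet_mono hR hnm), sum_indexSet_prod, sum_indexSet_prod]
  simpa only [Finset.card_univ, Fintype.card_fin, Finset.prod_const] using
    (le_abs_self _).trans hprod

theorem IsIncrementMajorant.nonneg {Φ : ℝ → ℂ} {H η γ R S : ℝ} {a : ℝ → ℤ × ℤ → ℝ} {ε : ℕ → ℝ}
    (ha : IsIncrementMajorant Φ H η γ R a S ε) {x : ℝ} (hx : |x| ≤ R) (q : ℤ × ℤ) : 0 ≤ a x q :=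
  (mul_nonneg (weight_nonneg H η q) (norm_nonneg _)).trans (ha.norm_le q hx)

theorem IsIncrementMajorant.mono {Φ : ℝ → ℂ} {H η γ R S S' : ℝ} {a : ℝ → ℤ × ℤ → ℝ}
    {ε ε' : ℕ → ℝ} (ha : IsIncrementMajorant Φ H η γ R a S ε) (hS : S ≤ S') (hε : ∀ n, ε n ≤ ε' n) :
    IsIncrementMajorant Φ H η γ R a S' ε' where
  norm_le := ha.norm_le
  norm_sub_le := ha.norm_sub_le
  sum_le F hx := (ha.sum_le F hx).trans hS
  sum_le_of_notMem n F hx hF := (ha.sum_le_of_notMem n F hx hF).trans (hε n)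

open scoped SchwartzMap in
theorem exists_forall_isIncrementMajorant {ι : Type*} [Finite ι] (Φ : ι → 𝓢(ℝ, ℂ)) {H : ι → ℝ}
    {γ η R : ℝ} (hγ : 0 ≤ γ) (hη : 0 ≤ η) (hR : 0 < R) (hlo : ∀ i, γ + 2 * η < H i)
    (hhi : ∀ i, H i + 2 * η < 1) :
    ∃ (a : ι → ℝ → ℤ × ℤ → ℝ) (T : ℝ) (e : ℕ → ℝ), 1 ≤ T ∧ (∀ n, 0 ≤ e n) ∧ Tendsto e atTop (𝓝 0) ∧
      ∀ i, IsIncrementMajorant (Φ i) (H i) η γ R (a i) T e := by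
  cases nonempty_fintype ι
  choose a S ε hε ha using fun i => exists_isIncrementMajorant (Φ i) hγ hη hR (hlo i) (hhi i)
  have le_sum_abs (z : ι → ℝ) (i : ι) : z i ≤ ∑ i, |z i| :=
    (le_abs_self _).trans (Finset.single_le_sum (fun i _ => abs_nonneg (z i)) (Finset.mem_univ i))
  refine ⟨a, 1 + ∑ i, |S i|, fun n => ∑ i, |ε i n|,
    le_add_of_nonneg_right (Finset.sum_nonneg fun i _ => abs_nonneg _),
    fun n => Finset.sum_nonneg fun i _ => abs_nonneg _, ?_,
    fun i => (ha i).mono ?_ fun n => le_sum_abs (ε · n) i⟩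
  · simpa only [abs_zero, Finset.sum_const_zero] using
      tendsto_finsetSum Finset.univ fun i _ => (hε i).abs
  · linarith [le_sum_abs S i]

end Products

section HolderBound

variable {X V : Type*} [PseudoMetricSpace X] [SeminormedAddCommGroup V] {γ : ℝ} {S : Set X} {C : ℝ}

/-- On `S`, the function `f` is bounded by `C` and `γ`-Hölder with constant `C`; here `γ` is a real
exponent and `C` a real constant, as both arise from estimates in `ℝ`. -/
def IsHolderBound (γ : ℝ) (S : Set X) (f : X → V) (C : ℝ) : Prop :=
  (∀ t ∈ S, ‖f t‖ ≤ C) ∧ ∀ t ∈ S, ∀ s ∈ S, ‖f t - f s‖ ≤ C * dist t s ^ γ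

theorem IsHolderBound.neg {f : X → V} (hf : IsHolderBound γ S f C) :
    IsHolderBound γ S (fun t => -f t) C :=
  ⟨fun t ht => (norm_neg (f t)).trans_le (hf.1 t ht), fun t ht s hs => by
    rw [neg_sub_neg, norm_sub_rev]
    exact hf.2 t ht s hs⟩

theorem IsHolderBound.sub_comm {f g : X → V} (hfg : IsHolderBound γ S (fun t => f t - g t) C) :
    IsHolderBound γ S (fun t => g t - f t) C := by
  simpa only [neg_sub] using hfg.neg

theorem IsHolderBound.re {f : X → ℂ} (hf : IsHolderBound γ S f C) :
    IsHolderBound γ S (fun t => (f t).re) C :=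
  ⟨fun t ht => (Complex.abs_re_le_norm _).trans (hf.1 t ht), fun t ht s hs => by
    rw [← Complex.sub_re]
    exact (Complex.abs_re_le_norm _).trans (hf.2 t ht s hs)⟩

theorem IsHolderBound.of_tendsto {f : ℕ → X → V} {g : X → V}
    (hlim : ∀ t ∈ S, Tendsto (fun n => f n t) atTop (𝓝 (g t)))
    (hf : ∀ᶠ n in atTop, IsHolderBound γ S (f n) C) : IsHolderBound γ S g C :=
  ⟨fun t ht => le_of_tendsto (hlim t ht).norm (hf.mono fun _ hn => hn.1 t ht),
    fun t ht s hs => le_of_tendsto ((hlim t ht).sub (hlim s hs)).norm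
      (hf.mono fun _ hn => hn.2 t ht s hs)⟩

theorem IsHolderBound.holderNorm_le {N : ℕ} {γ : ℝ≥0} {S : Set (E N)} {f : E N → ℝ}
    (hf : IsHolderBound γ S f C) (hC : 0 ≤ C) :
    holderNorm γ S f ≤ ENNReal.ofReal C + ENNReal.ofReal C := by
  refine add_le_add (iSup₂_le fun t ht => ?_) ?_
  · rw [← ofReal_norm]
    exact ENNReal.ofReal_le_ofReal (hf.1 t ht)
  · have hholder : HolderWith C.toNNReal γ fun t : S => f t := fun t s => by
      rw [edist_dist, Real.dist_eq, edist_dist, Subtype.dist_eq,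
        ENNReal.ofReal_rpow_of_nonneg dist_nonneg γ.coe_nonneg]
      change _ ≤ ENNReal.ofReal C * _
      rw [← ENNReal.ofReal_mul hC]
      exact ENNReal.ofReal_le_ofReal (hf.2 t t.2 s s.2)
    exact hholder.eHolderNorm_le

theorem IsHolderBound.holderNorm_lt_top {N : ℕ} {γ : ℝ≥0} {S : Set (E N)} {f : E N → ℝ}
    (hf : IsHolderBound γ S f C) (hC : 0 ≤ C) : holderNorm γ S f < ∞ :=
  (hf.holderNorm_le hC).trans_lt
    (ENNReal.add_lt_top.2 ⟨ENNReal.ofReal_lt_top, ENNReal.ofReal_lt_top⟩)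

theorem tendsto_ofReal_add_ofReal {ε : ℕ → ℝ} (hε : Tendsto ε atTop (𝓝 0)) :
    Tendsto (fun n => ENNReal.ofReal (ε n) + ENNReal.ofReal (ε n)) atTop (𝓝 0) := by
  have hofReal := ENNReal.tendsto_ofReal hε
  simpa only [ENNReal.ofReal_zero, add_zero] using hofReal.add hofReal

end HolderBound

section WaveSum

variable {N : ℕ}

/-- The finite wavelet sum over the index set `F`, with coefficients `2^{-⟨J,H⟩} c J K` and the
products of the increments `waveInc (Φ l)`. -/
noncomputable def waveSum (Φ : Fin N → ℝ → ℂ) (H : Fin N → ℝ)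
    (c : (Fin N → ℤ) → (Fin N → ℤ) → ℂ) (F : Finset ((Fin N → ℤ) × (Fin N → ℤ))) (t : E N) : ℂ :=
  ∑ p ∈ F, (((2 : ℝ) ^ (-(∑ l, (p.1 l : ℝ) * H l)) : ℝ) : ℂ) * c p.1 p.2 *
    ∏ l, waveInc (Φ l) (p.1 l, p.2 l) (t l)

variable {Φ : Fin N → ℝ → ℂ} {H : Fin N → ℝ} {η C γ R : ℝ} {c : (Fin N → ℤ) → (Fin N → ℤ) → ℂ}

theorem waveSum_sub_waveSum_of_subset {F G : Finset ((Fin N → ℤ) × (Fin N → ℤ))} (hFG : F ⊆ G)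
    (t : E N) : waveSum Φ H c G t - waveSum Φ H c F t = waveSum Φ H c (G \ F) t :=
  sub_eq_of_eq_add (Finset.sum_sdiff hFG).symm

theorem norm_mul_le_prod_weight {z : ℂ} {J K : Fin N → ℤ}
    (hz : ‖z‖ ≤ C * ∏ l, ((2 : ℝ) ^ (η * |(J l : ℝ)|) * (1 + |(K l : ℝ)|) ^ η)) :
    ‖(((2 : ℝ) ^ (-(∑ l, (J l : ℝ) * H l)) : ℝ) : ℂ) * z‖ ≤ C * ∏ l, weight (H l) η (J l, K l) := by
  have prod_weight : ∏ l, weight (H l) η (J l, K l) = (2 : ℝ) ^ (-(∑ l, (J l : ℝ) * H l)) *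
      ∏ l, ((2 : ℝ) ^ (η * |(J l : ℝ)|) * (1 + |(K l : ℝ)|) ^ η) := by
    rw [← Finset.sum_neg_distrib, Real.rpow_sum_of_pos two_pos, ← Finset.prod_mul_distrib]
    rfl
  rw [norm_mul, Complex.norm_real, Real.norm_of_nonneg (by positivity), prod_weight,
    mul_left_comm]
  gcongr

theorem norm_waveSum_le (hC : 0 ≤ C)
    (hc : ∀ J K, ‖c J K‖ ≤ C * ∏ l, ((2 : ℝ) ^ (η * |(J l : ℝ)|) * (1 + |(K l : ℝ)|) ^ η))
    {t : E N} {b : Fin N → ℤ × ℤ → ℝ}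
    (hb : ∀ l q, weight (H l) η q * ‖waveInc (Φ l) q (t l)‖ ≤ b l q)
    (F : Finset ((Fin N → ℤ) × (Fin N → ℤ))) :
    ‖waveSum Φ H c F t‖ ≤ C * ∑ p ∈ F, ∏ l, b l (p.1 l, p.2 l) := by
  rw [waveSum, Finset.mul_sum]
  refine norm_sum_le_of_le _ fun p _ => ?_
  rw [norm_mul, norm_prod]
  calc _ ≤ (C * ∏ l, weight (H l) η (p.1 l, p.2 l)) *
        ∏ l, ‖waveInc (Φ l) (p.1 l, p.2 l) (t l)‖ := by
        gcongr
        exact norm_mul_le_prod_weight (hc _ _)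
    _ = C * ∏ l, (weight (H l) η (p.1 l, p.2 l) * ‖waveInc (Φ l) (p.1 l, p.2 l) (t l)‖) := by
        rw [Finset.prod_mul_distrib, mul_assoc]
    _ ≤ _ := by
        gcongr with l _
        · exact fun l _ => mul_nonneg (weight_nonneg _ _ _) (norm_nonneg _)
        · exact hb l _

theorem prod_weight_mul_norm_prod_sub_prod_le {x y : Fin N → ℂ} {b : Fin N → ℝ} {D : ℝ}
    (hD : 0 ≤ D) {q : Fin N → ℤ × ℤ} (hx : ∀ l, weight (H l) η (q l) * ‖x l‖ ≤ b l)
    (hy : ∀ l, weight (H l) η (q l) * ‖y l‖ ≤ b l)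
    (hxy : ∀ l, weight (H l) η (q l) * ‖x l - y l‖ ≤ b l * D) :
    (∏ l, weight (H l) η (q l)) * ‖∏ l, x l - ∏ l, y l‖ ≤ N * D * ∏ l, b l := by
  have norm_weight_mul (l) (z : ℂ) :
      ‖(weight (H l) η (q l) : ℂ) * z‖ = weight (H l) η (q l) * ‖z‖ := by
    rw [norm_mul, Complex.norm_real, Real.norm_of_nonneg (weight_nonneg _ _ _)]
  have hprod := norm_prod_sub_prod_le Finset.univ hD
    (fun l => (norm_weight_mul l _).trans_le (hx l))
    (fun l => (norm_weight_mul l _).trans_le (hy l))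
    (fun l => by rw [← mul_sub]; exact (norm_weight_mul l _).trans_le (hxy l))
  rwa [Finset.prod_mul_distrib, Finset.prod_mul_distrib, ← mul_sub, norm_mul, ← Complex.ofReal_prod,
    Complex.norm_real, Real.norm_of_nonneg (Finset.prod_nonneg fun l _ => weight_nonneg _ _ _),
    Finset.card_univ, Fintype.card_fin] at hprod

theorem norm_waveSum_sub_le (hC : 0 ≤ C)
    (hc : ∀ J K, ‖c J K‖ ≤ C * ∏ l, ((2 : ℝ) ^ (η * |(J l : ℝ)|) * (1 + |(K l : ℝ)|) ^ η))
    {t s : E N} {b : Fin N → ℤ × ℤ → ℝ} {D : ℝ} (hD : 0 ≤ D)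
    (ht : ∀ l q, weight (H l) η q * ‖waveInc (Φ l) q (t l)‖ ≤ b l q)
    (hs : ∀ l q, weight (H l) η q * ‖waveInc (Φ l) q (s l)‖ ≤ b l q)
    (hts : ∀ l q, weight (H l) η q * ‖waveInc (Φ l) q (t l) - waveInc (Φ l) q (s l)‖ ≤ b l q * D)
    (F : Finset ((Fin N → ℤ) × (Fin N → ℤ))) :
    ‖waveSum Φ H c F t - waveSum Φ H c F s‖ ≤
      C * (N * D * ∑ p ∈ F, ∏ l, b l (p.1 l, p.2 l)) := by
  rw [waveSum, waveSum, ← Finset.sum_sub_distrib, Finset.mul_sum, Finset.mul_sum]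
  refine norm_sum_le_of_le _ fun p _ => ?_
  rw [← mul_sub, norm_mul]
  calc _ ≤ (C * ∏ l, weight (H l) η (p.1 l, p.2 l)) *
        ‖∏ l, waveInc (Φ l) (p.1 l, p.2 l) (t l) - ∏ l, waveInc (Φ l) (p.1 l, p.2 l) (s l)‖ := by
        gcongr
        exact norm_mul_le_prod_weight (hc _ _)
    _ ≤ _ := by
        rw [mul_assoc]
        exact mul_le_mul_of_nonneg_left (prod_weight_mul_norm_prod_sub_prod_le hD
          (fun l => ht l _) (fun l => hs l _) fun l => hts l _) hC

theorem isHolderBound_waveSum (hC : 0 ≤ C) (hγ : 0 ≤ γ)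
    (hc : ∀ J K, ‖c J K‖ ≤ C * ∏ l, ((2 : ℝ) ^ (η * |(J l : ℝ)|) * (1 + |(K l : ℝ)|) ^ η))
    {a : Fin N → ℝ → ℤ × ℤ → ℝ} {T : ℝ} {e : ℕ → ℝ}
    (ha : ∀ l, IsIncrementMajorant (Φ l) (H l) η γ R (a l) T e)
    {F : Finset ((Fin N → ℤ) × (Fin N → ℤ))} {B : ℝ} (hB : 0 ≤ B)
    (hsum : ∀ t ∈ cube N R, ∀ s ∈ cube N R,
      ∑ p ∈ F, ∏ l, (a l (t l) (p.1 l, p.2 l) + a l (s l) (p.1 l, p.2 l)) ≤ B) :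
    IsHolderBound γ (cube N R) (waveSum Φ H c F) (C * (1 + N) * B) := by
  have norm_le {t s : E N} (ht : t ∈ cube N R) (hs : s ∈ cube N R) (l q) :
      weight (H l) η q * ‖waveInc (Φ l) q (t l)‖ ≤ a l (t l) q + a l (s l) q :=
    ((ha l).norm_le q (ht l)).trans (le_add_of_nonneg_right ((ha l).nonneg (hs l) q))
  refine ⟨fun t ht => ?_, fun t ht s hs => ?_⟩
  · calc _ ≤ C * B := (norm_waveSum_le hC hc (norm_le ht ht) F).trans
          (mul_le_mul_of_nonneg_left (hsum t ht t ht) hC)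
      _ ≤ C * (1 + N) * B := by
          gcongr
          exact le_mul_of_one_le_right hC (le_add_of_nonneg_right N.cast_nonneg)
  · have abs_sub_le (l) : |t l - s l| ≤ dist t s := by
      rw [dist_eq_norm, ← Real.norm_eq_abs, ← PiLp.sub_apply]
      exact PiLp.norm_apply_le (t - s) l
    calc _ ≤ C * (N * dist t s ^ γ * B) :=
          (norm_waveSum_sub_le hC hc (D := dist t s ^ γ) (by positivity) (norm_le ht hs)
            (fun l q => (norm_le hs ht l q).trans_eq (add_comm _ _))
            (fun l q => ((ha l).norm_sub_le q (ht l) (hs l)).trans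
              (mul_le_mul_of_nonneg_left
                (Real.rpow_le_rpow (abs_nonneg _) (abs_sub_le l) hγ)
                (add_nonneg ((ha l).nonneg (ht l) q) ((ha l).nonneg (hs l) q)))) F).trans
          (by gcongr; exact hsum t ht s hs)
      _ ≤ C * ((1 + N) * dist t s ^ γ * B) := by
          gcongr
          exact le_add_of_nonneg_left zero_le_one
      _ = _ := by ring

open scoped SchwartzMap in
theorem exists_isHolderBound_waveSum (Φ : Fin N → 𝓢(ℝ, ℂ)) (hC : 0 ≤ C) (hγ : 0 ≤ γ)
    (hη : 0 ≤ η) (hR : 0 < R) (hlo : ∀ l, γ + 2 * η < H l) (hhi : ∀ l, H l + 2 * η < 1)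
    (hc : ∀ J K, ‖c J K‖ ≤ C * ∏ l, ((2 : ℝ) ^ (η * |(J l : ℝ)|) * (1 + |(K l : ℝ)|) ^ η)) :
    ∃ (S : ℝ) (ε : ℕ → ℝ), 0 ≤ S ∧ (∀ n, 0 ≤ ε n) ∧ Tendsto ε atTop (𝓝 0) ∧
      (∀ n, IsHolderBound γ (cube N R) (waveSum (fun l => Φ l) H c (indexSet N n R)) S) ∧
      ∀ n m, n ≤ m → IsHolderBound γ (cube N R) (fun t =>
        waveSum (fun l => Φ l) H c (indexSet N m R) t -
          waveSum (fun l => Φ l) H c (indexSet N n R) t) (ε n) := by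
  obtain ⟨a, T, e, hT, he0, he, ha⟩ := exists_forall_isIncrementMajorant Φ hγ hη hR hlo hhi
  have hnonneg {t s : E N} (ht : t ∈ cube N R) (hs : s ∈ cube N R) (l) (q : ℤ × ℤ) :
      0 ≤ a l (t l) q + a l (s l) q :=
    add_nonneg ((ha l).nonneg (ht l) q) ((ha l).nonneg (hs l) q)
  have hsum {t s : E N} (ht : t ∈ cube N R) (hs : s ∈ cube N R) (l) (F : Finset (ℤ × ℤ)) :
      ∑ q ∈ F, (a l (t l) q + a l (s l) q) ≤ 2 * T := by
    rw [Finset.sum_add_distrib, two_mul]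
    exact add_le_add ((ha l).sum_le F (ht l)) ((ha l).sum_le F (hs l))
  have htail {t s : E N} (ht : t ∈ cube N R) (hs : s ∈ cube N R) (l) (n m : ℕ) :
      ∑ q ∈ indexSet₁ m R \ indexSet₁ n R, (a l (t l) q + a l (s l) q) ≤ 2 * e n := by
    have hnotMem : ∀ q ∈ indexSet₁ m R \ indexSet₁ n R, q ∉ indexSet₁ n R :=
      fun q hq => (Finset.mem_sdiff.1 hq).2
    rw [Finset.sum_add_distrib, two_mul]
    exact add_le_add ((ha l).sum_le_of_notMem n _ (ht l) hnotMem)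
      ((ha l).sum_le_of_notMem n _ (hs l) hnotMem)
  refine ⟨C * (1 + N) * (2 * T) ^ N, fun n => C * (1 + N) * (N * (2 * e n) * (2 * T) ^ N),
    by positivity, fun n => by have := he0 n; positivity, ?_, fun n => ?_, fun n m hnm => ?_⟩
  · simpa only [mul_zero, zero_mul] using
      (((he.const_mul 2).const_mul (N : ℝ)).mul_const ((2 * T) ^ N)).const_mul (C * (1 + N))
  · exact isHolderBound_waveSum hC hγ hc ha (by positivity) fun t ht s hs =>
      sum_indexSet_prod_le (hnonneg ht hs) fun l => hsum ht hs l _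
  · have := he0 n
    simp only [waveSum_sub_waveSum_of_subset (indexSet_mono hR.le hnm)]
    exact isHolderBound_waveSum hC hγ hc ha (by positivity) fun t ht s hs =>
      sum_indexSet_sdiff_prod_le (hnonneg ht hs) hnm hR.le (by linarith) (by positivity)
        (fun l => hsum ht hs l _) fun l => htail ht hs l n m

end WaveSum

section PartialSeries

variable {N : ℕ} {α : ℝ} {Ω : Type*} [MeasurableSpace Ω] {P : Measure Ω} {M : Set (E N) → Ω → ℂ}

theorem partialSeries_eq_waveSum (H : Fin N → ℝ) (ψ : SchwartzMap ℝ ℝ) (R : ℝ) (n : ℕ) (t : E N)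
    (ω : Ω) : partialSeries α H ψ P M R n t ω = (waveSum (fun l => fracPrim α ψ (H l)) H
      (fun J K => coeff α ψ P M J K ω) (indexSet N n R) t).re := rfl

theorem exists_nat_rate {ι : Type*} [Finite ι] {γ : ℝ} {H : ι → ℝ} (hH : ∀ l, H l < 1)
    (hγ : ∀ l, γ < H l) : ∃ i : ℕ, ∀ l,
      γ + 2 * (1 / ((i : ℝ) + 1)) < H l ∧ H l + 2 * (1 / ((i : ℝ) + 1)) < 1 := by
  have hlim : Tendsto (fun i : ℕ => 2 * (1 / ((i : ℝ) + 1))) atTop (𝓝 0) := by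
    simpa only [mul_zero] using (tendsto_one_div_add_atTop_nhds_zero_nat (𝕜 := ℝ)).const_mul 2
  refine (eventually_all.2 fun l => ?_).exists (f := atTop)
  filter_upwards [hlim.eventually_lt_const (sub_pos.2 (hγ l)),
    hlim.eventually_lt_const (sub_pos.2 (hH l))] with i hi_lo hi_hi
  exact ⟨by linarith, by linarith⟩

theorem measurable_partialSeries (H : Fin N → ℝ) (ψ : SchwartzMap ℝ ℝ) (R : ℝ) (n : ℕ) (t : E N) :
    Measurable (partialSeries α H ψ P M R n t) :=
  Complex.measurable_re.comp (Finset.measurable_sum _ fun _ _ =>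
    ((measurable_stableIntegral _).const_mul _).mul_const _)

/-- The field `U^*`, the limit of the truncated series. Since the limit exists only almost surely,
it is encoded as a `limsup`, which is measurable for every `t`. -/
noncomputable def limitField (α : ℝ) (H : Fin N → ℝ) (ψ : SchwartzMap ℝ ℝ) (P : Measure Ω)
    (M : Set (E N) → Ω → ℂ) (R : ℝ) (t : E N) (ω : Ω) : ℝ :=
  limsup (fun n => partialSeries α H ψ P M R n t ω) atTop

theorem measurable_limitField (H : Fin N → ℝ) (ψ : SchwartzMap ℝ ℝ) (R : ℝ) (t : E N) :
    Measurable (limitField α H ψ P M R t) :=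
  Measurable.limsup fun n => measurable_partialSeries H ψ R n t

variable [IsProbabilityMeasure P] {ψ : SchwartzMap ℝ ℝ} {H : Fin N → ℝ} {R : ℝ}

theorem ae_exists_isHolderBound_partialSeries (hM : IsIsotropicStableMeasure α P M)
    (hα0 : 0 < α) (hα2 : α < 2) (hψ : IsLemarieMeyer ψ) (hH : ∀ l, H l < 1) (hR : 0 < R) :
    ∀ᵐ ω ∂P, ∀ γ : ℝ, 0 ≤ γ → (∀ l, γ < H l) → ∃ (S : ℝ) (ε : ℕ → ℝ), 0 ≤ S ∧ (∀ n, 0 ≤ ε n) ∧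
      Tendsto ε atTop (𝓝 0) ∧
      (∀ n, IsHolderBound γ (cube N R) (fun t => partialSeries α H ψ P M R n t ω) S) ∧
      ∀ n m, n ≤ m → IsHolderBound γ (cube N R) (fun t =>
        partialSeries α H ψ P M R m t ω - partialSeries α H ψ P M R n t ω) (ε n) := by
  choose Φ hΦ using fun l => exists_schwartzMap_eq_fracPrim hψ α (H l)
  have fracPrim_eq : (fun l => fracPrim α ψ (H l)) = fun l => ⇑(Φ l) :=
    funext fun l => funext (hΦ l)
  -- countably many growth exponents serve all Hölder exponents at once
  filter_upwards [ae_all_iff.2 fun i : ℕ => ae_exists_norm_coeff_le hM hα0 hα2 hψ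
    (by positivity : 0 < 1 / ((i : ℝ) + 1))] with ω hω γ hγ hγH
  obtain ⟨i, hi⟩ := exists_nat_rate hH hγH
  obtain ⟨C, hC, hc⟩ := hω i
  obtain ⟨S, ε, hS, hε, hlim, hbound, hdiff⟩ := exists_isHolderBound_waveSum Φ hC hγ
    (by positivity) hR (fun l => (hi l).1) (fun l => (hi l).2) hc
  simp only [partialSeries_eq_waveSum, fracPrim_eq, ← Complex.sub_re]
  exact ⟨S, ε, hS, hε, hlim, fun n => (hbound n).re, fun n m hnm => (hdiff n m hnm).re⟩

theorem ae_tendsto_limitField (hM : IsIsotropicStableMeasure α P M)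
    (hα0 : 0 < α) (hα2 : α < 2) (hψ : IsLemarieMeyer ψ) (hH : ∀ l, 0 < H l ∧ H l < 1)
    (hR : 0 < R) :
    ∀ᵐ ω ∂P, ∀ t ∈ cube N R, Tendsto (fun n => partialSeries α H ψ P M R n t ω) atTop
      (𝓝 (limitField α H ψ P M R t ω)) := by
  filter_upwards [ae_exists_isHolderBound_partialSeries hM hα0 hα2 hψ (fun l => (hH l).2) hR]
    with ω hω t ht
  obtain ⟨-, ε, -, -, hε, -, hdiff⟩ := hω 0 le_rfl fun l => (hH l).1
  have hcauchy : CauchySeq fun n => partialSeries α H ψ P M R n t ω := by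
    refine cauchySeq_of_le_tendsto_0' ε (fun n m hnm => ?_) hε
    rw [dist_comm]
    exact (hdiff n m hnm).1 t ht
  obtain ⟨z, hz⟩ := cauchySeq_tendsto_of_complete hcauchy
  rwa [limitField, hz.limsup_eq]

theorem ae_limitField_holder (hM : IsIsotropicStableMeasure α P M)
    (hα0 : 0 < α) (hα2 : α < 2) (hψ : IsLemarieMeyer ψ) (hH : ∀ l, 0 < H l ∧ H l < 1)
    (hR : 0 < R) :
    ∀ᵐ ω ∂P, ∀ γ : ℝ≥0, (∀ l, (γ : ℝ) < H l) →
      holderNorm γ (cube N R) (fun t => limitField α H ψ P M R t ω) < ∞ ∧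
      Tendsto (fun n => holderNorm γ (cube N R)
        (fun t => partialSeries α H ψ P M R n t ω - limitField α H ψ P M R t ω)) atTop (𝓝 0) := by
  filter_upwards [ae_exists_isHolderBound_partialSeries hM hα0 hα2 hψ (fun l => (hH l).2) hR,
    ae_tendsto_limitField hM hα0 hα2 hψ hH hR] with ω hω hlim γ hγ
  obtain ⟨S, ε, hS, hε0, hε, hbound, hdiff⟩ := hω γ γ.coe_nonneg hγ
  refine ⟨(IsHolderBound.of_tendsto hlim (.of_forall hbound)).holderNorm_lt_top hS,
    tendsto_of_tendsto_of_tendsto_of_le_of_le tendsto_const_nhds (tendsto_ofReal_add_ofReal hε)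
      (fun _ => zero_le) fun n => IsHolderBound.holderNorm_le (.sub_comm ?_) (hε0 n)⟩
  exact IsHolderBound.of_tendsto (fun t ht => (hlim t ht).sub_const _)
    ((eventually_ge_atTop n).mono fun m hnm => hdiff n m hnm)

theorem ae_partialSeries_cauchy (hM : IsIsotropicStableMeasure α P M)
    (hα0 : 0 < α) (hα2 : α < 2) (hψ : IsLemarieMeyer ψ) (hH : ∀ l, H l < 1) (hR : 0 < R) :
    ∀ᵐ ω ∂P, ∀ γ : ℝ≥0, (∀ l, (γ : ℝ) < H l) →
      (∀ n, holderNorm γ (cube N R) (fun t => partialSeries α H ψ P M R n t ω) < ∞) ∧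
      ∀ η : ℝ≥0∞, 0 < η → ∃ n₀ : ℕ, ∀ m n : ℕ, n₀ ≤ m → n₀ ≤ n →
        holderNorm γ (cube N R) (fun t => partialSeries α H ψ P M R m t ω -
          partialSeries α H ψ P M R n t ω) ≤ η := by
  filter_upwards [ae_exists_isHolderBound_partialSeries hM hα0 hα2 hψ hH hR] with ω hω γ hγ
  obtain ⟨S, ε, hS, hε0, hε, hbound, hdiff⟩ := hω γ γ.coe_nonneg hγ
  refine ⟨fun n => (hbound n).holderNorm_lt_top hS, fun η hη => ?_⟩
  obtain ⟨n₀, hn₀⟩ :=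
    eventually_atTop.1 ((tendsto_ofReal_add_ofReal hε).eventually_lt_const hη)
  refine ⟨n₀, fun m n hm hn => ?_⟩
  rcases le_total n m with hnm | hmn
  · exact ((hdiff n m hnm).holderNorm_le (hε0 n)).trans (hn₀ n hn).le
  · exact ((hdiff m n hmn).sub_comm.holderNorm_le (hε0 m)).trans (hn₀ m hm).le

end PartialSeries

/-! ### The wavelet expansion of the one-dimensional kernel -/

section FourierBasis

open scoped FourierTransform SchwartzMap

theorem fourier_comp_mul_sub {F : Type*} [NormedAddCommGroup F] [NormedSpace ℂ F] (f : ℝ → F)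
    {a : ℝ} (ha : a ≠ 0) (b ν : ℝ) :
    𝓕 (fun x => f (a * x - b)) ν = |a⁻¹| •
      Complex.exp (-(Complex.I * (b * a⁻¹ * (2 * Real.pi * ν) : ℝ))) • 𝓕 f (a⁻¹ * ν) := by
  set g : ℝ → F := fun y =>
    Complex.exp (((-2 * Real.pi * (a⁻¹ * (y + b)) * ν : ℝ) : ℂ) * Complex.I) • f y
  calc 𝓕 (fun x => f (a * x - b)) ν = ∫ x, g (a * x - b) := by
        rw [Real.fourier_real_eq_integral_exp_smul]
        refine integral_congr_ae (Eventually.of_forall fun x => ?_)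
        simp only [g, sub_add_cancel, inv_mul_cancel_left₀ ha]
    _ = |a⁻¹| • ∫ y, g y := by
        rw [Measure.integral_comp_mul_left (fun y : ℝ => g (y - b)) a,
          integral_sub_right_eq_self]
    _ = _ := by
        rw [Real.fourier_real_eq_integral_exp_smul]
        congr 1
        rw [← integral_smul]
        refine integral_congr_ae (Eventually.of_forall fun y => ?_)
        simp only [g, smul_smul]
        rw [← Complex.exp_add]
        congr 2
        push_cast
        ring

/-- The wavelet `2^(j/2) ψ(2^j x - k)` with index `q = (j, k)` as a Schwartz function. -/
noncomputable def wavelet (ψ : SchwartzMap ℝ ℝ) (q : ℤ × ℤ) : 𝓢(ℝ, ℂ) :=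
  (((2 : ℝ) ^ ((q.1 : ℝ) / 2) : ℝ) : ℂ) • SchwartzMap.compCLMOfContinuousLinearEquiv ℂ
    (ContinuousLinearEquiv.smulLeft (R₁ := ℝ) (M₁ := ℝ)
      (Units.mk0 ((2 : ℝ) ^ q.1) (by positivity)))
    (SchwartzMap.compSubConstCLM ℂ (q.2 : ℝ) (toComplex ψ))

theorem wavelet_apply (ψ : SchwartzMap ℝ ℝ) (q : ℤ × ℤ) (x : ℝ) : wavelet ψ q x =
    (((2 : ℝ) ^ ((q.1 : ℝ) / 2) : ℝ) : ℂ) * toComplex ψ ((2 : ℝ) ^ q.1 * x - q.2) := rfl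

variable {α : ℝ}

/-- The factor between the Fourier transform of an `L²`-normalized wavelet of scale `j`, in
Mathlib's convention for `𝓕`, and `hatNormalized`. -/
noncomputable def normConst (α : ℝ) (j : ℤ) : ℝ :=
  Real.sqrt (2 * Real.pi) * (2 : ℝ) ^ ((j : ℝ) / α - j / 2)

theorem normConst_mul_rpow (α : ℝ) (j : ℤ) :
    normConst α j * (2 : ℝ) ^ (-((j : ℝ) / α)) * (Real.sqrt (2 * Real.pi))⁻¹ =
      (2 : ℝ) ^ ((j : ℝ) / 2) * ((2 : ℝ) ^ j)⁻¹ := by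
  have hexp : (2 : ℝ) ^ ((j : ℝ) / α - j / 2) * (2 : ℝ) ^ (-((j : ℝ) / α)) =
      (2 : ℝ) ^ ((j : ℝ) / 2) * ((2 : ℝ) ^ j)⁻¹ := by
    rw [← Real.rpow_intCast, ← Real.rpow_neg zero_le_two, ← Real.rpow_add two_pos,
      ← Real.rpow_add two_pos]
    ring_nf
  rw [normConst, mul_assoc (Real.sqrt _), hexp]
  field_simp

theorem normConst_sq_mul_rpow (α v : ℝ) (j : ℤ) :
    normConst α j ^ 2 * (2 * Real.pi)⁻¹ * (2 : ℝ) ^ ((j : ℝ) - 2 * (j / α) - j * v) =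
      (2 : ℝ) ^ (-((j : ℝ) * v)) := by
  have hexp : ((2 : ℝ) ^ ((j : ℝ) / α - j / 2)) ^ 2 * (2 : ℝ) ^ ((j : ℝ) - 2 * (j / α) - j * v) =
      (2 : ℝ) ^ (-((j : ℝ) * v)) := by
    rw [← Real.rpow_mul_natCast zero_le_two, ← Real.rpow_add two_pos]
    push_cast
    ring_nf
  rw [normConst, mul_pow, Real.sq_sqrt (by positivity), ← hexp]
  field_simp

theorem fourier_wavelet (α : ℝ) (ψ : SchwartzMap ℝ ℝ) (q : ℤ × ℤ) (ν : ℝ) :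
    (𝓕 (wavelet ψ q)) ν =
      (normConst α q.1 : ℂ) * hatNormalized α ψ q.1 q.2 (2 * Real.pi * ν) := by
  have hscale := fourier_comp_mul_sub (toComplex ψ) (a := (2 : ℝ) ^ q.1) (by positivity) q.2 ν
  have hsmul : (𝓕 (wavelet ψ q)) ν = (((2 : ℝ) ^ ((q.1 : ℝ) / 2) : ℝ) : ℂ) *
      𝓕 (fun x => toComplex ψ ((2 : ℝ) ^ q.1 * x - q.2)) ν := by
    rw [wavelet, FourierTransform.fourier_smul, smul_apply, smul_eq_mul,
      SchwartzMap.fourier_coe]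
    rfl
  have hfreq : (2 * Real.pi)⁻¹ * ((2 : ℝ) ^ (-q.1) * (2 * Real.pi * ν)) =
      ((2 : ℝ) ^ q.1)⁻¹ * ν := by
    rw [zpow_neg]
    field_simp
  have hconst := congrArg (fun r : ℝ => (r : ℂ)) (normConst_mul_rpow α q.1)
  simp only [Complex.ofReal_mul, Complex.ofReal_inv] at hconst
  rw [hsmul, hscale, hatNormalized, hat_eq_fourier, hfreq, abs_of_pos (by positivity),
    SchwartzMap.fourier_coe, Complex.real_smul, smul_eq_mul, Complex.ofReal_inv, ← mul_assoc,
    ← hconst, zpow_neg]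
  ring

theorem IsLemarieMeyer.exists_hilbertBasis_fourier {ψ : SchwartzMap ℝ ℝ} (hψ : IsLemarieMeyer ψ)
    (α : ℝ) : ∃ b : HilbertBasis (ℤ × ℤ) ℂ (Lp ℂ 2 (volume : Measure ℝ)),
      ∀ q, (b q : ℝ → ℂ) =ᵐ[volume]
        fun ν => (normConst α q.1 : ℂ) * hatNormalized α ψ q.1 q.2 (2 * Real.pi * ν) := by
  obtain ⟨b, hb⟩ := hψ.hilbertBasis
  refine ⟨HilbertBasis.ofRepr ((Lp.fourierTransformₗᵢ ℝ ℂ).symm.trans b.repr), fun q => ?_⟩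
  have hfourier : HilbertBasis.ofRepr ((Lp.fourierTransformₗᵢ ℝ ℂ).symm.trans b.repr) q =
      𝓕 (b q) := rfl
  have hwavelet : b q = (wavelet ψ q).toLp 2 := by
    refine Lp.ext ?_
    filter_upwards [hb q.1 q.2, (wavelet ψ q).coeFn_toLp 2 volume] with x hbx hcoe
    rw [hcoe, wavelet_apply, toComplex_apply, ← Complex.ofReal_mul]
    exact hbx
  rw [hfourier, hwavelet, SchwartzMap.toLp_fourier_eq]
  filter_upwards [(𝓕 (wavelet ψ q)).coeFn_toLp 2 volume] with ν hcoe
  rw [hcoe, fourier_wavelet α]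

theorem exists_seq_ae_tendsto_sum_inner_mul {ι X 𝕜 : Type*} [Countable ι] [MeasurableSpace X]
    [RCLike 𝕜] {μ : Measure X} (b : HilbertBasis ι 𝕜 (Lp 𝕜 2 μ)) {e : ι → X → 𝕜}
    (hbe : ∀ i, (b i : X → 𝕜) =ᵐ[μ] e i) {F : ℕ → Finset ι} (hF : Tendsto F atTop atTop)
    (f : Lp 𝕜 2 μ) :
    ∃ s : ℕ → ℕ, StrictMono s ∧ ∀ᵐ x ∂μ,
      Tendsto (fun n => ∑ i ∈ F (s n), inner 𝕜 (b i) f * e i x) atTop (𝓝 (f x)) := by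
  have hsum := (b.hasSum_repr f).comp hF
  obtain ⟨s, hs, hlim⟩ := (tendstoInMeasure_of_tendsto_Lp hsum).exists_seq_tendsto_ae
  have hterm : ∀ᵐ x ∂μ, ∀ i, (b.repr f i • b i : Lp 𝕜 2 μ) x = inner 𝕜 (b i) f * e i x := by
    refine ae_all_iff.2 fun i => ?_
    filter_upwards [hbe i, Lp.coeFn_smul (b.repr f i) (b i)] with x hbx hcoe
    rw [hcoe, Pi.smul_apply, hbx, smul_eq_mul, b.repr_apply_apply]
  have hpartial : ∀ᵐ x ∂μ, ∀ n, (∑ i ∈ F n, b.repr f i • b i : Lp 𝕜 2 μ) x =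
      ∑ i ∈ F n, inner 𝕜 (b i) f * e i x := by
    refine ae_all_iff.2 fun n => ?_
    filter_upwards [hterm, Lp.coeFn_fun_finsetSum (F n) fun i => b.repr f i • b i]
      with x hx hcoe
    rw [hcoe]
    exact Finset.sum_congr rfl fun i _ => hx i
  refine ⟨s, hs, ?_⟩
  filter_upwards [hlim, hpartial] with x hx hpartial
  exact hx.congr fun n => hpartial (s n)

end FourierBasis

section Kernel

variable {α : ℝ}

/-- The one-dimensional factor `(exp(itξ) - 1) / |ξ|^(v + 1/α)` of the integrand of the sheet. -/
noncomputable def kernel (α v t ξ : ℝ) : ℂ :=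
  (Complex.exp (Complex.I * (t * ξ : ℝ)) - 1) / ((|ξ| ^ (v + 1 / α) : ℝ) : ℂ)

theorem measurable_kernel (α v t : ℝ) : Measurable (kernel α v t) := by
  unfold kernel
  fun_prop

theorem norm_kernel_le (α v t ξ : ℝ) : ‖kernel α v t ξ‖ ≤ 2 * (|ξ| ^ (v + 1 / α))⁻¹ := by
  rw [kernel, norm_div, Complex.norm_real, Real.norm_of_nonneg (by positivity), div_eq_mul_inv]
  gcongr
  calc _ ≤ ‖Complex.exp (Complex.I * (t * ξ : ℝ))‖ + ‖(1 : ℂ)‖ := norm_sub_le _ _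
    _ = 2 := by rw [norm_exp_I_mul_ofReal, norm_one, one_add_one_eq_two]

theorem integrable_fracPrim_integrand {ψ : SchwartzMap ℝ ℝ} (hψ : IsLemarieMeyer ψ) (v y : ℝ) :
    Integrable fun η : ℝ => Complex.exp (Complex.I * (y * η : ℝ)) *
      (hat ψ η / ((|η| ^ (v + 1 / α) : ℝ) : ℂ)) := by
  have hsupp : HasCompactSupport fun η : ℝ => hat ψ η / ((|η| ^ (v + 1 / α) : ℝ) : ℂ) := by
    simp only [div_eq_mul_inv]
    exact hψ.hasCompactSupport_hat.mul_right
  have hcont := (contDiff_hat_div_rpow hψ (v + 1 / α)).continuous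
  exact Continuous.integrable_of_hasCompactSupport (by fun_prop) hsupp.mul_left

theorem waveInc_fracPrim_eq_integral {ψ : SchwartzMap ℝ ℝ} (hψ : IsLemarieMeyer ψ)
    (v t : ℝ) (q : ℤ × ℤ) :
    waveInc (fracPrim α ψ v) q t = ∫ η : ℝ, (Complex.exp (Complex.I * (2 ^ q.1 * t * η : ℝ)) - 1) *
      Complex.exp (-(Complex.I * (q.2 * η : ℝ))) *
        (hat ψ η / ((|η| ^ (v + 1 / α) : ℝ) : ℂ)) := by
  rw [waveInc, fracPrim, fracPrim, ← integral_sub (integrable_fracPrim_integrand hψ _ _)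
    (integrable_fracPrim_integrand hψ _ _)]
  refine integral_congr_ae (Eventually.of_forall fun η => ?_)
  simp only
  rw [← sub_mul, sub_mul _ 1, one_mul, ← Complex.exp_add]
  congr 3 <;> (push_cast; ring)

theorem kernel_mul_hatNormalized_two_zpow_mul (ψ : SchwartzMap ℝ ℝ) (v t : ℝ) (q : ℤ × ℤ)
    (η : ℝ) :
    (2 : ℝ) ^ q.1 • (kernel α v t (2 ^ q.1 * η) * hatNormalized α ψ q.1 q.2 (2 ^ q.1 * η)) =
      (((2 : ℝ) ^ ((q.1 : ℝ) - 2 * (q.1 / α) - q.1 * v) : ℝ) : ℂ) *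
        ((Complex.exp (Complex.I * (2 ^ q.1 * t * η : ℝ)) - 1) *
          Complex.exp (-(Complex.I * (q.2 * η : ℝ))) *
          (hat ψ η / ((|η| ^ (v + 1 / α) : ℝ) : ℂ))) := by
  have hj : (0 : ℝ) < 2 ^ q.1 := by positivity
  have hexp : (2 : ℝ) ^ q.1 * (2 : ℝ) ^ (-((q.1 : ℝ) / α)) * (((2 : ℝ) ^ q.1) ^ (v + 1 / α))⁻¹ =
      (2 : ℝ) ^ ((q.1 : ℝ) - 2 * (q.1 / α) - q.1 * v) := by
    rw [← Real.rpow_intCast, ← Real.rpow_mul zero_le_two, ← Real.rpow_neg zero_le_two,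
      ← Real.rpow_add two_pos, ← Real.rpow_add two_pos]
    ring_nf
  rw [kernel, hatNormalized, abs_mul, abs_of_pos hj, Real.mul_rpow hj.le (abs_nonneg _), zpow_neg,
    inv_mul_cancel_left₀ hj.ne', mul_assoc (q.2 : ℝ), inv_mul_cancel_left₀ hj.ne',
    show t * ((2 : ℝ) ^ q.1 * η) = (2 : ℝ) ^ q.1 * t * η by ring, ← hexp, Complex.real_smul]
  simp only [Complex.ofReal_mul, Complex.ofReal_inv, div_eq_mul_inv, mul_inv]
  ring

theorem integral_kernel_mul_hatNormalized {ψ : SchwartzMap ℝ ℝ} (hψ : IsLemarieMeyer ψ)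
    (v t : ℝ) (q : ℤ × ℤ) :
    ∫ ξ, kernel α v t ξ * hatNormalized α ψ q.1 q.2 ξ =
      (((2 : ℝ) ^ ((q.1 : ℝ) - 2 * (q.1 / α) - q.1 * v) : ℝ) : ℂ) *
        waveInc (fracPrim α ψ v) q t := by
  have hj : (0 : ℝ) < 2 ^ q.1 := by positivity
  have hscale := Measure.integral_comp_mul_left
    (fun ξ => kernel α v t ξ * hatNormalized α ψ q.1 q.2 ξ) ((2 : ℝ) ^ q.1)
  rw [abs_of_pos (inv_pos.2 hj), eq_inv_smul_iff₀ hj.ne', ← integral_smul] at hscale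
  rw [← hscale, waveInc_fracPrim_eq_integral hψ, ← integral_const_mul]
  exact integral_congr_ae
    (Eventually.of_forall fun η => kernel_mul_hatNormalized_two_zpow_mul ψ v t q η)

/-- The term with index `q` of the expansion of `kernel α v t` along the functions
`conj (hatNormalized α ψ j k)`. -/
noncomputable def kernelTerm (α : ℝ) (ψ : SchwartzMap ℝ ℝ) (v t : ℝ) (q : ℤ × ℤ) (ξ : ℝ) : ℂ :=
  (((2 : ℝ) ^ (-((q.1 : ℝ) * v)) : ℝ) : ℂ) * waveInc (fracPrim α ψ v) q t *
    starRingEnd ℂ (hatNormalized α ψ q.1 q.2 ξ)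

theorem continuous_kernelTerm (α : ℝ) (ψ : SchwartzMap ℝ ℝ) (v t : ℝ) (q : ℤ × ℤ) :
    Continuous (kernelTerm α ψ v t q) :=
  continuous_const.mul (Complex.continuous_conj.comp (continuous_hatNormalized ψ q.1 q.2))

theorem abs_mem_Icc_of_kernelTerm_ne_zero {ψ : SchwartzMap ℝ ℝ} (hψ : IsLemarieMeyer ψ)
    {v t : ℝ} {q : ℤ × ℤ} {ξ : ℝ} (hq : kernelTerm α ψ v t q ξ ≠ 0) :
    |ξ| ∈ Set.Icc ((2 : ℝ) ^ q.1) (9 * 2 ^ q.1) :=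
  abs_mem_Icc_of_hatNormalized_ne_zero hψ ((map_ne_zero _).1 (right_ne_zero_of_mul hq))

/-- The frequencies `ν`, in Mathlib's convention for `𝓕`, with `a ≤ |2πν| ≤ A`. -/
def freqRing (a A : ℝ) : Set ℝ := (fun ν => |2 * Real.pi * ν|) ⁻¹' Set.Icc a A

theorem measurableSet_freqRing (a A : ℝ) : MeasurableSet (freqRing a A) :=
  measurableSet_Icc.preimage (by fun_prop)

theorem volume_freqRing_ne_top (a A : ℝ) : volume (freqRing a A) ≠ ∞ := by
  refine ((measure_mono (t := Set.Icc (-A) A) fun ν hν => ?_).trans_lt measure_Icc_lt_top).ne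
  refine abs_le.1 (le_trans ?_ hν.2)
  change |ν| ≤ |2 * Real.pi * ν|
  rw [abs_mul, abs_of_pos Real.two_pi_pos]
  exact le_mul_of_one_le_left (abs_nonneg ν) (by linarith [Real.pi_gt_three])

/-- The conjugate kernel in the variable of `𝓕`, cut off to a ring so as to be in `L²`. -/
noncomputable def cutKernel (α v t a A : ℝ) : ℝ → ℂ :=
  (freqRing a A).indicator fun ν => starRingEnd ℂ (kernel α v t (2 * Real.pi * ν))

theorem memLp_cutKernel {v : ℝ} (hv : 0 ≤ v + 1 / α) (t : ℝ) {a : ℝ} (ha : 0 < a) (A : ℝ)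
    (p : ℝ≥0∞) : MemLp (cutKernel α v t a A) p volume := by
  have hmeas : Measurable (fun ν : ℝ => starRingEnd ℂ (kernel α v t (2 * Real.pi * ν))) :=
    Complex.continuous_conj.measurable.comp ((measurable_kernel α v t).comp (by fun_prop))
  have htop : MemLp (cutKernel α v t a A) ∞ volume := by
    refine memLp_top_of_bound (hmeas.indicator (measurableSet_freqRing a A)).aestronglyMeasurable
      (2 * (a ^ (v + 1 / α))⁻¹) (Eventually.of_forall fun ν => ?_)
    by_cases hν : ν ∈ freqRing a A
    · rw [cutKernel, Set.indicator_of_mem hν, RCLike.norm_conj]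
      refine (norm_kernel_le α v t _).trans ?_
      gcongr
      exact hν.1
    · rw [cutKernel, Set.indicator_of_notMem hν, norm_zero]
      positivity
  exact htop.mono_exponent_of_measure_support_ne_top
    (fun ν hν => Set.indicator_of_notMem hν _) (volume_freqRing_ne_top a A) le_top

theorem inner_toLp_cutKernel {ψ : SchwartzMap ℝ ℝ} (hψ : IsLemarieMeyer ψ) {q : ℤ × ℤ}
    {e : Lp ℂ 2 (volume : Measure ℝ)} (he : (e : ℝ → ℂ) =ᵐ[volume]
      fun ν => (normConst α q.1 : ℂ) * hatNormalized α ψ q.1 q.2 (2 * Real.pi * ν))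
    {v t a A : ℝ} (h : MemLp (cutKernel α v t a A) 2 volume) (ha : a ≤ 2 ^ q.1)
    (hA : 9 * 2 ^ q.1 ≤ A) :
    inner ℂ e (h.toLp _) = starRingEnd ℂ (((normConst α q.1 * (2 * Real.pi)⁻¹ : ℝ) : ℂ) *
      ∫ ξ, kernel α v t ξ * hatNormalized α ψ q.1 q.2 ξ) := by
  have hscale := Measure.integral_comp_mul_left
    (fun ξ => kernel α v t ξ * hatNormalized α ψ q.1 q.2 ξ) (2 * Real.pi)
  rw [abs_of_pos (inv_pos.2 Real.two_pi_pos), Complex.real_smul] at hscale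
  rw [Complex.ofReal_mul, mul_assoc, ← hscale, ← integral_const_mul, ← integral_conj, L2.inner_def]
  refine integral_congr_ae ?_
  filter_upwards [he, h.coeFn_toLp] with ν heν hcoe
  rw [heν, hcoe, cutKernel]
  by_cases hne : hatNormalized α ψ q.1 q.2 (2 * Real.pi * ν) = 0
  · simp only [hne, mul_zero, inner_zero_left, map_zero]
  · obtain ⟨hlower, hupper⟩ := abs_mem_Icc_of_hatNormalized_ne_zero hψ hne
    rw [Set.indicator_of_mem (show ν ∈ freqRing a A from ⟨ha.trans hlower, hupper.trans hA⟩)]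
    simp only [RCLike.inner_apply, map_mul]
    ring

theorem inner_toLp_cutKernel_mul {ψ : SchwartzMap ℝ ℝ} (hψ : IsLemarieMeyer ψ) {q : ℤ × ℤ}
    {e : Lp ℂ 2 (volume : Measure ℝ)} (he : (e : ℝ → ℂ) =ᵐ[volume]
      fun ν => (normConst α q.1 : ℂ) * hatNormalized α ψ q.1 q.2 (2 * Real.pi * ν))
    {v t a A : ℝ} (h : MemLp (cutKernel α v t a A) 2 volume) {ξ : ℝ}
    (hξ : |ξ| ∈ Set.Icc (9 * a) (A / 9)) :
    inner ℂ e (h.toLp _) * ((normConst α q.1 : ℂ) * hatNormalized α ψ q.1 q.2 ξ) =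
      starRingEnd ℂ (kernelTerm α ψ v t q ξ) := by
  rcases eq_or_ne (hatNormalized α ψ q.1 q.2 ξ) 0 with hzero | hne
  · simp only [kernelTerm, hzero, mul_zero, map_zero]
  obtain ⟨hlower, hupper⟩ := abs_mem_Icc_of_hatNormalized_ne_zero hψ hne
  have hconst := congrArg (fun r : ℝ => (r : ℂ)) (normConst_sq_mul_rpow α v q.1)
  simp only [Complex.ofReal_mul, Complex.ofReal_pow] at hconst
  rw [inner_toLp_cutKernel hψ he h (by linarith [hξ.1]) (by linarith [hξ.2]),
    integral_kernel_mul_hatNormalized hψ, kernelTerm, ← hconst]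
  simp only [map_mul, map_pow, Complex.conj_ofReal, Complex.conj_conj, Complex.ofReal_mul]
  ring

end Kernel

section PointwiseExpansion

variable {α : ℝ} {ψ : SchwartzMap ℝ ℝ} {v : ℝ}

theorem tendsto_indexSet₁ {R : ℝ} (hR : 0 < R) :
    Tendsto (fun n => indexSet₁ n R) atTop atTop := by
  refine tendsto_atTop_finset_of_monotone (fun n m h => indexSet₁_mono hR.le h) fun q => ?_
  obtain ⟨n, hn⟩ := exists_nat_ge |(q.1 : ℝ)|
  obtain ⟨m, hm⟩ := pow_unbounded_of_one_lt (|(q.2 : ℝ)| / R) one_lt_two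
  rw [div_lt_iff₀ hR, mul_comm] at hm
  refine ⟨max n m, mem_indexSet₁.2 ⟨hn.trans (by exact_mod_cast le_max_left n m),
    hm.le.trans ?_⟩⟩
  gcongr
  · exact one_le_two
  · exact (le_max_right n m).trans (Nat.le_succ _)

theorem exists_seq_ae_tendsto_sum_kernelTerm (hψ : IsLemarieMeyer ψ) (hv : 0 ≤ v + 1 / α)
    (t : ℝ) {R : ℝ} (hR : 0 < R) {a : ℝ} (ha : 0 < a) (A : ℝ) :
    ∃ s : ℕ → ℕ, StrictMono s ∧ ∀ᵐ ν : ℝ, |2 * Real.pi * ν| ∈ Set.Icc (9 * a) (A / 9) →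
      Tendsto (fun n => ∑ q ∈ indexSet₁ (s n) R, kernelTerm α ψ v t q (2 * Real.pi * ν)) atTop
        (𝓝 (kernel α v t (2 * Real.pi * ν))) := by
  obtain ⟨b, hb⟩ := hψ.exists_hilbertBasis_fourier α
  have hmem := memLp_cutKernel hv t ha A 2
  obtain ⟨s, hs, hlim⟩ :=
    exists_seq_ae_tendsto_sum_inner_mul b hb (tendsto_indexSet₁ hR) (hmem.toLp _)
  refine ⟨s, hs, ?_⟩
  filter_upwards [hlim, hmem.coeFn_toLp] with ν hlim hcoe hν
  have hring : ν ∈ freqRing a A :=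
    ⟨by linarith [hν.1], by linarith [hν.2, abs_nonneg (2 * Real.pi * ν)]⟩
  rw [hcoe, show cutKernel α v t a A ν = _ from Set.indicator_of_mem hring _] at hlim
  simp only [inner_toLp_cutKernel_mul hψ (hb _) hmem hν, ← map_sum] at hlim
  simpa only [Function.comp_def, Complex.conj_conj] using
    (Complex.continuous_conj.tendsto _).comp hlim

theorem ae_of_ae_comp_mul_left {a : ℝ} (ha : a ≠ 0) {p : ℝ → Prop} (h : ∀ᵐ ν, p (a * ν)) :
    ∀ᵐ ξ, p ξ := by
  have hscale : Measure.QuasiMeasurePreserving (fun ξ : ℝ => a⁻¹ * ξ) volume volume := by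
    refine ⟨by fun_prop, ?_⟩
    rw [Real.map_volume_mul_left (inv_ne_zero ha)]
    exact Measure.smul_absolutelyContinuous
  filter_upwards [hscale.ae h] with ξ hξ
  rwa [mul_inv_cancel_left₀ ha] at hξ

theorem ae_exists_seq_tendsto_sum_kernelTerm (hψ : IsLemarieMeyer ψ) (hv : 0 ≤ v + 1 / α)
    (t : ℝ) {R : ℝ} (hR : 0 < R) :
    ∀ᵐ ξ : ℝ, ∃ s : ℕ → ℕ, StrictMono s ∧
      Tendsto (fun n => ∑ q ∈ indexSet₁ (s n) R, kernelTerm α ψ v t q ξ) atTop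
        (𝓝 (kernel α v t ξ)) := by
  have hring : ∀ᵐ ξ : ℝ, ∀ m : ℕ, |ξ| ∈ Set.Icc (9 * (1 / ((m : ℝ) + 1))) (9 * (m : ℝ) / 9) →
      ∃ s : ℕ → ℕ, StrictMono s ∧
        Tendsto (fun n => ∑ q ∈ indexSet₁ (s n) R, kernelTerm α ψ v t q ξ) atTop
          (𝓝 (kernel α v t ξ)) := by
    refine ae_all_iff.2 fun m => ae_of_ae_comp_mul_left Real.two_pi_pos.ne' ?_
    obtain ⟨s, hs, hlim⟩ := exists_seq_ae_tendsto_sum_kernelTerm hψ hv t hR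
      (Nat.one_div_pos_of_nat (α := ℝ) (n := m)) (9 * m)
    filter_upwards [hlim] with ν hν hmem
    exact ⟨s, hs, hν hmem⟩
  filter_upwards [hring, Measure.ae_ne volume (0 : ℝ)] with ξ hξ hne
  obtain ⟨m, hm⟩ := exists_nat_ge (max |ξ| (9 / |ξ|))
  obtain ⟨hle, hge⟩ := max_le_iff.1 hm
  refine hξ m ⟨?_, by linarith⟩
  have hpos : 0 < |ξ| := abs_pos.2 hne
  rw [div_le_iff₀ hpos] at hge
  rw [mul_one_div, div_le_iff₀ (by positivity)]
  linarith [mul_add_one |ξ| (m : ℝ)]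

/-- Up to a constant, the function `min(1, |ξ|) / |ξ|^s` dominates the kernel of exponent `s` and
its wavelet expansion. -/
noncomputable def kernelBound (s ξ : ℝ) : ℝ := min 1 |ξ| * (|ξ| ^ s)⁻¹

theorem kernelBound_nonneg (s ξ : ℝ) : 0 ≤ kernelBound s ξ := by
  unfold kernelBound
  positivity

theorem mem_Icc_log_of_mem_Icc {x : ℝ} {j : ℤ} (hx : x ∈ Set.Icc ((2 : ℝ) ^ j) (9 * 2 ^ j)) :
    j ∈ Finset.Icc (Int.log 2 x - 3) (Int.log 2 x) := by
  have hpos : 0 < x := (by positivity : (0 : ℝ) < 2 ^ j).trans_le hx.1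
  have hle : j ≤ Int.log 2 x :=
    (Int.zpow_le_iff_le_log one_lt_two hpos).1 (by exact_mod_cast hx.1)
  have hlt : Int.log 2 x < j + 4 := by
    refine (Int.lt_zpow_iff_log_lt one_lt_two hpos).1 (hx.2.trans_lt ?_)
    rw [Nat.cast_ofNat, zpow_add₀ two_ne_zero, mul_comm]
    gcongr
    norm_num
  rw [Finset.mem_Icc]
  omega

theorem two_rpow_neg_mul_le {s : ℝ} (hs : 0 ≤ s) {x : ℝ} {j : ℤ}
    (hx : x ∈ Set.Icc ((2 : ℝ) ^ j) (9 * 2 ^ j)) :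
    (2 : ℝ) ^ (-((j : ℝ) * s)) ≤ 9 ^ s * (x ^ s)⁻¹ := by
  have hj : (0 : ℝ) < 2 ^ j := by positivity
  have hpos : 0 < x := hj.trans_le hx.1
  have hpow : x ^ s ≤ 9 ^ s * ((2 : ℝ) ^ j) ^ s := by
    rw [← Real.mul_rpow (by norm_num) hj.le]
    exact Real.rpow_le_rpow hpos.le hx.2 hs
  rw [Real.rpow_neg zero_le_two, Real.rpow_mul zero_le_two, Real.rpow_intCast, ← div_eq_mul_inv,
    inv_le_iff_one_le_mul₀ (by positivity), div_mul_eq_mul_div, one_le_div (by positivity)]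
  exact hpow

theorem min_one_mul_le {d x b : ℝ} (hd : 0 ≤ d) (hdx : d ≤ x) (hb : 0 ≤ b) :
    min 1 (d * b) ≤ (1 + b) * min 1 x := by
  rcases le_total 1 x with hx | hx
  · rw [min_eq_left hx]
    exact (min_le_left _ _).trans (by linarith)
  · rw [min_eq_right hx]
    refine (min_le_right _ _).trans ?_
    nlinarith

theorem exists_norm_waveInc_fracPrim_le (hψ : IsLemarieMeyer ψ) (α v t : ℝ) :
    ∃ C : ℝ, 0 ≤ C ∧ ∀ (q : ℤ × ℤ) (x : ℝ), (2 : ℝ) ^ q.1 ≤ x →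
      ‖waveInc (fracPrim α ψ v) q t‖ ≤
        C * min 1 x * (decay 2 ((2 : ℝ) ^ q.1 * t - q.2) + decay 2 (0 - q.2)) := by
  obtain ⟨Φ, hΦ⟩ := exists_schwartzMap_eq_fracPrim hψ α v
  obtain ⟨C, hC, hinc⟩ := exists_norm_waveInc_sub_le Φ 2
  refine ⟨C * (1 + |t|), by positivity, fun q x hqx => ?_⟩
  have hinc0 := hinc q t 0
  rw [waveInc_zero, sub_zero, sub_zero, mul_zero] at hinc0
  rw [funext hΦ, mul_assoc C]
  refine hinc0.trans ?_
  have := min_one_mul_le (by positivity) hqx (abs_nonneg t)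
  have := add_nonneg (decay_nonneg 2 ((2 : ℝ) ^ q.1 * t - q.2)) (decay_nonneg 2 (0 - q.2))
  gcongr

theorem exists_norm_kernelTerm_le (hψ : IsLemarieMeyer ψ) (hv : 0 ≤ v + 1 / α) (t : ℝ) :
    ∃ C : ℝ, 0 ≤ C ∧ ∀ (q : ℤ × ℤ) (ξ : ℝ), ‖kernelTerm α ψ v t q ξ‖ ≤
      C * kernelBound (v + 1 / α) ξ *
        (decay 2 ((2 : ℝ) ^ q.1 * t - q.2) + decay 2 (0 - q.2)) := by
  obtain ⟨B, hB, hhat⟩ := hψ.exists_norm_hat_le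
  obtain ⟨C, hC, hinc⟩ := exists_norm_waveInc_fracPrim_le hψ α v t
  refine ⟨9 ^ (v + 1 / α) * C * B, by positivity, fun q ξ => ?_⟩
  have hdecay := add_nonneg (decay_nonneg 2 ((2 : ℝ) ^ q.1 * t - q.2)) (decay_nonneg 2 (0 - q.2))
  set d := decay 2 ((2 : ℝ) ^ q.1 * t - q.2) + decay 2 (0 - q.2)
  have := kernelBound_nonneg (v + 1 / α) ξ
  rcases eq_or_ne (kernelTerm α ψ v t q ξ) 0 with hzero | hne
  · rw [hzero, norm_zero]
    positivity
  have hξ := abs_mem_Icc_of_kernelTerm_ne_zero hψ hne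
  have hpow := two_rpow_neg_mul_le hv hξ
  calc ‖kernelTerm α ψ v t q ξ‖
      = (2 : ℝ) ^ (-((q.1 : ℝ) * (v + 1 / α))) * ‖waveInc (fracPrim α ψ v) q t‖ *
          ‖hat ψ ((2 : ℝ) ^ (-q.1) * ξ)‖ := by
        rw [kernelTerm, norm_mul, norm_mul, RCLike.norm_conj, norm_hatNormalized,
          Complex.norm_real, Real.norm_of_nonneg (by positivity), mul_add, neg_add,
          Real.rpow_add two_pos, mul_one_div]
        ring
    _ ≤ (9 ^ (v + 1 / α) * (|ξ| ^ (v + 1 / α))⁻¹) * (C * min 1 |ξ| * d) * B := by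
        gcongr
        · exact hinc q |ξ| hξ.1
        · exact hhat _
    _ = _ := by
        rw [kernelBound]
        ring

theorem exists_sum_norm_kernelTerm_le (hψ : IsLemarieMeyer ψ) (hv : 0 ≤ v + 1 / α) (t : ℝ) :
    ∃ C : ℝ, 0 ≤ C ∧ ∀ (ξ : ℝ) (F : Finset (ℤ × ℤ)),
      ∑ q ∈ F, ‖kernelTerm α ψ v t q ξ‖ ≤ C * kernelBound (v + 1 / α) ξ := by
  obtain ⟨C, hC, hterm⟩ := exists_norm_kernelTerm_le hψ hv t
  obtain ⟨D, hD, hsum⟩ := exists_sum_decay_two_sub_intCast_le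
  refine ⟨4 * (C * (D + D)), by positivity, fun ξ F => ?_⟩
  set I := Finset.Icc (Int.log 2 |ξ| - 3) (Int.log 2 |ξ|)
  set G := C * kernelBound (v + 1 / α) ξ
  have hG : 0 ≤ G := mul_nonneg hC (kernelBound_nonneg _ _)
  have hI : (I.card : ℝ) = 4 := by
    rw [Int.card_Icc, show Int.log 2 |ξ| + 1 - (Int.log 2 |ξ| - 3) = 4 by ring]
    exact Nat.cast_ofNat
  calc ∑ q ∈ F, ‖kernelTerm α ψ v t q ξ‖
      = ∑ q ∈ F.filter (fun q => q.1 ∈ I), ‖kernelTerm α ψ v t q ξ‖ := by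
        rw [Finset.sum_filter_of_ne]
        exact fun q _ hq => mem_Icc_log_of_mem_Icc
          (abs_mem_Icc_of_kernelTerm_ne_zero hψ (norm_ne_zero_iff.1 hq))
    _ ≤ ∑ q ∈ I ×ˢ F.image Prod.snd, ‖kernelTerm α ψ v t q ξ‖ := by
        refine Finset.sum_le_sum_of_subset_of_nonneg (fun q hq => ?_) fun _ _ _ => norm_nonneg _
        rw [Finset.mem_filter] at hq
        exact Finset.mem_product.2 ⟨hq.2, Finset.mem_image_of_mem _ hq.1⟩
    _ ≤ ∑ q ∈ I ×ˢ F.image Prod.snd,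
          G * (decay 2 ((2 : ℝ) ^ q.1 * t - q.2) + decay 2 (0 - q.2)) :=
        Finset.sum_le_sum fun q _ => hterm q ξ
    _ = ∑ j ∈ I, G * (∑ k ∈ F.image Prod.snd, decay 2 ((2 : ℝ) ^ j * t - k) +
          ∑ k ∈ F.image Prod.snd, decay 2 (0 - k)) := by
        rw [Finset.sum_product]
        refine Finset.sum_congr rfl fun j _ => ?_
        rw [← Finset.sum_add_distrib, Finset.mul_sum]
    _ ≤ I.card • (G * (D + D)) :=
        Finset.sum_le_card_nsmul _ _ _ fun _ _ =>
          mul_le_mul_of_nonneg_left (add_le_add (hsum _ _) (hsum _ _)) hG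
    _ = _ := by
        rw [nsmul_eq_mul, hI]
        ring

theorem ae_tendsto_sum_kernelTerm (hψ : IsLemarieMeyer ψ) (hv : 0 ≤ v + 1 / α) (t : ℝ) {R : ℝ}
    (hR : 0 < R) :
    ∀ᵐ ξ : ℝ, Tendsto (fun n => ∑ q ∈ indexSet₁ n R, kernelTerm α ψ v t q ξ) atTop
      (𝓝 (kernel α v t ξ)) := by
  obtain ⟨C, -, hbound⟩ := exists_sum_norm_kernelTerm_le hψ hv t
  filter_upwards [ae_exists_seq_tendsto_sum_kernelTerm hψ hv t hR] with ξ ⟨s, hs, hsubseq⟩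
  have hsummable : Summable fun q => kernelTerm α ψ v t q ξ :=
    (summable_of_sum_le (fun _ => norm_nonneg _) (hbound ξ)).of_norm
  have hlim := hsummable.hasSum.comp (tendsto_indexSet₁ hR)
  rwa [tendsto_nhds_unique (hlim.comp hs.tendsto_atTop) hsubseq] at hlim

theorem inv_rpow_add_one_div_rpow (hα : α ≠ 0) (v : ℝ) {y : ℝ} (hy : 0 ≤ y) :
    ((y ^ (v + 1 / α))⁻¹) ^ α = y ^ (-(v * α + 1)) := by
  rw [← Real.rpow_neg hy, ← Real.rpow_mul hy]
  congr 1
  field_simp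

theorem integrable_kernelBound_rpow (hα : 0 < α) (hv0 : 0 < v) (hv1 : v < 1) :
    Integrable fun ξ : ℝ => kernelBound (v + 1 / α) ξ ^ α := by
  have hnear : IntegrableOn (fun y : ℝ => (min 1 y * (y ^ (v + 1 / α))⁻¹) ^ α)
      (Set.Ioc 0 1) := by
    have hpow : IntegrableOn (fun y : ℝ => y ^ (α - (v * α + 1))) (Set.Ioc 0 1) := by
      rw [← intervalIntegrable_iff_integrableOn_Ioc_of_le zero_le_one]
      exact intervalIntegral.intervalIntegrable_rpow' (by nlinarith)
    refine hpow.congr_fun (fun y hy => ?_) measurableSet_Ioc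
    have := hy.1.le
    simp only
    rw [min_eq_right hy.2, Real.mul_rpow hy.1.le (by positivity),
      inv_rpow_add_one_div_rpow hα.ne' v hy.1.le, ← Real.rpow_add hy.1, sub_eq_add_neg]
  have hfar : IntegrableOn (fun y : ℝ => (min 1 y * (y ^ (v + 1 / α))⁻¹) ^ α) (Set.Ioi 1) := by
    refine (integrableOn_Ioi_rpow_of_lt (a := -(v * α + 1)) (by linarith [mul_pos hv0 hα])
      one_pos).congr_fun (fun y hy => ?_) measurableSet_Ioi
    simp only
    rw [min_eq_left (le_of_lt hy), one_mul,
      inv_rpow_add_one_div_rpow hα.ne' v (one_pos.trans hy).le]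
  refine (integrable_fun_norm_addHaar (volume : Measure ℝ)
    (f := fun y : ℝ => (min 1 y * (y ^ (v + 1 / α))⁻¹) ^ α)).2 ?_
  simpa only [Module.finrank_self, tsub_self, pow_zero, one_smul,
    Set.Ioc_union_Ioi_eq_Ioi (zero_le_one' ℝ)] using hnear.union hfar

theorem memLp_kernelBound (hα : 0 < α) (hv0 : 0 < v) (hv1 : v < 1) :
    MemLp (kernelBound (v + 1 / α)) (ENNReal.ofReal α) volume := by
  have hmeas : Measurable (kernelBound (v + 1 / α)) := by
    unfold kernelBound
    fun_prop
  rw [← integrable_norm_rpow_iff hmeas.aestronglyMeasurable (ENNReal.ofReal_pos.2 hα).ne'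
    ENNReal.ofReal_ne_top, ENNReal.toReal_ofReal hα.le]
  simpa only [Real.norm_of_nonneg (kernelBound_nonneg _ _)] using
    integrable_kernelBound_rpow hα hv0 hv1

end PointwiseExpansion

section DominatedConvergence

variable {X F : Type*} [MeasurableSpace X] {μ : Measure X} [NormedAddCommGroup F] {p : ℝ≥0∞}
  {f : ℕ → X → F} {G : X → ℝ}

theorem tendsto_eLpNorm_zero_of_dominated (hp : p ≠ ∞) (hf : ∀ n, AEStronglyMeasurable (f n) μ)
    (hG : MemLp G p μ) (hbound : ∀ n, ∀ᵐ x ∂μ, ‖f n x‖ ≤ G x)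
    (hlim : ∀ᵐ x ∂μ, Tendsto (fun n => f n x) atTop (𝓝 0)) :
    Tendsto (fun n => eLpNorm (f n) p μ) atTop (𝓝 0) := by
  rcases eq_or_ne p 0 with rfl | hp0
  · simp only [eLpNorm_exponent_zero, tendsto_const_nhds]
  have hpr : 0 < p.toReal := ENNReal.toReal_pos hp0 hp
  have hlintegral : Tendsto (fun n => ∫⁻ x, ‖f n x‖ₑ ^ p.toReal ∂μ) atTop
      (𝓝 (∫⁻ _, 0 ∂μ)) := by
    refine tendsto_lintegral_of_dominated_convergence' (fun x => ‖G x‖ₑ ^ p.toReal)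
      (fun n => (hf n).enorm.pow_const _) (fun n => ?_)
      (lintegral_rpow_enorm_lt_top_of_eLpNorm_lt_top hp0 hp hG.2).ne ?_
    · filter_upwards [hbound n] with x hx
      gcongr
      exact enorm_le_iff_norm_le.2 (hx.trans (le_abs_self _))
    · filter_upwards [hlim] with x hx
      simpa only [enorm_zero, ENNReal.zero_rpow_of_pos hpr] using hx.enorm.ennrpow_const p.toReal
  rw [lintegral_zero] at hlintegral
  simpa only [eLpNorm_eq_lintegral_rpow_enorm_toReal hp0 hp,
    ENNReal.zero_rpow_of_pos (one_div_pos.2 hpr)] using hlintegral.ennrpow_const (1 / p.toReal)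

theorem tendsto_eLpNorm_sub_of_dominated {g : X → F} (hp : p ≠ ∞)
    (hf : ∀ n, AEStronglyMeasurable (f n) μ) (hG : MemLp G p μ)
    (hbound : ∀ n, ∀ᵐ x ∂μ, ‖f n x‖ ≤ G x)
    (hlim : ∀ᵐ x ∂μ, Tendsto (fun n => f n x) atTop (𝓝 (g x))) :
    Tendsto (fun n => eLpNorm (f n - g) p μ) atTop (𝓝 0) := by
  have hg : AEStronglyMeasurable g μ := aestronglyMeasurable_of_tendsto_ae atTop hf hlim
  refine tendsto_eLpNorm_zero_of_dominated hp (fun n => (hf n).sub hg) (hG.const_mul 2)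
    (fun n => ?_) ?_
  · filter_upwards [hlim, ae_all_iff.2 hbound] with x hx hle
    have hgG : ‖g x‖ ≤ G x := le_of_tendsto hx.norm (Eventually.of_forall hle)
    rw [two_mul]
    exact (norm_sub_le _ _).trans (add_le_add (hle n) hgG)
  · filter_upwards [hlim] with x hx
    simpa only [Pi.sub_apply, sub_self] using hx.sub_const (g x)

end DominatedConvergence

/-! ### Identification of the limit with the sheet -/

section ProductKernel

variable {N : ℕ}

theorem quasiMeasurePreserving_coord (l : Fin N) :
    Measure.QuasiMeasurePreserving (fun x : E N => x l) volume volume :=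
  (Measure.quasiMeasurePreserving_eval (fun _ : Fin N => (volume : Measure ℝ)) l).comp
    (EuclideanSpace.volume_preserving_symm_measurableEquiv_toLp (Fin N)).quasiMeasurePreserving

theorem memLp_prod_coord {𝕜 : Type*} [NormedField 𝕜] {p : ℝ≥0∞} (hp0 : p ≠ 0) (hp : p ≠ ∞)
    {f : Fin N → ℝ → 𝕜} (hf : ∀ l, MemLp (f l) p volume) :
    MemLp (fun x : E N => ∏ l, f l (x l)) p volume := by
  have hmeas : AEStronglyMeasurable (fun x : E N => ∏ l, f l (x l)) volume :=
    Finset.aestronglyMeasurable_fun_prod _ fun l _ =>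
      (hf l).1.comp_quasiMeasurePreserving (quasiMeasurePreserving_coord l)
  have hpi : Integrable fun x : Fin N → ℝ => ∏ l, ‖f l (x l)‖ ^ p.toReal :=
    Integrable.fintype_prod (f := fun l ξ => ‖f l ξ‖ ^ p.toReal) fun l =>
      (hf l).integrable_norm_rpow hp0 hp
  rw [← integrable_norm_rpow_iff hmeas hp0 hp]
  simp only [norm_prod, ← Real.finsetProd_rpow _ _ fun _ _ => norm_nonneg _]
  exact (EuclideanSpace.volume_preserving_symm_measurableEquiv_toLp
    (Fin N)).integrable_comp_of_integrable hpi

variable {α : ℝ} {ψ : SchwartzMap ℝ ℝ}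

theorem sum_coeffKernel_eq_prod (α : ℝ) (ψ : SchwartzMap ℝ ℝ) (H : Fin N → ℝ) (R : ℝ) (n : ℕ)
    (t x : E N) :
    ∑ p ∈ indexSet N n R, ((((2 : ℝ) ^ (-(∑ l, (p.1 l : ℝ) * H l)) : ℝ) : ℂ) *
      ∏ l, waveInc (fracPrim α ψ (H l)) (p.1 l, p.2 l) (t l)) * coeffKernel α ψ p.1 p.2 x =
    ∏ l, ∑ q ∈ indexSet₁ n R, kernelTerm α ψ (H l) (t l) q (x l) := by
  rw [← sum_indexSet_prod n R fun l q => kernelTerm α ψ (H l) (t l) q (x l)]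
  refine Finset.sum_congr rfl fun p _ => ?_
  simp only [kernelTerm, Finset.prod_mul_distrib, coeffKernel, map_prod]
  rw [← Finset.sum_neg_distrib, ← Complex.ofReal_prod, Real.rpow_sum_of_pos two_pos]

variable {H : Fin N → ℝ}

theorem tendsto_eLpNorm_prod_sub_prod_kernel (hα0 : 0 < α) (hψ : IsLemarieMeyer ψ)
    (hH : ∀ l, 0 < H l ∧ H l < 1) {R : ℝ} (hR : 0 < R) (t : E N) :
    MemLp (fun x : E N => ∏ l, kernel α (H l) (t l) (x l)) (ENNReal.ofReal α) volume ∧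
    Tendsto (fun n => eLpNorm ((fun x : E N =>
      ∏ l, ∑ q ∈ indexSet₁ n R, kernelTerm α ψ (H l) (t l) q (x l)) -
        fun x => ∏ l, kernel α (H l) (t l) (x l)) (ENNReal.ofReal α) volume) atTop (𝓝 0) := by
  have hexp : ∀ l, 0 ≤ H l + 1 / α := fun l => add_nonneg (hH l).1.le (by positivity)
  choose C _ hle using fun l => exists_sum_norm_kernelTerm_le hψ (hexp l) (t l)
  have hbound : MemLp (fun x : E N => ∏ l, C l * kernelBound (H l + 1 / α) (x l))
      (ENNReal.ofReal α) volume :=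
    memLp_prod_coord (ENNReal.ofReal_pos.2 hα0).ne' ENNReal.ofReal_ne_top fun l =>
      (memLp_kernelBound hα0 (hH l).1 (hH l).2).const_mul (C l)
  have hpartial_le : ∀ (n : ℕ) (x : E N), ‖∏ l, ∑ q ∈ indexSet₁ n R,
      kernelTerm α ψ (H l) (t l) q (x l)‖ ≤ ∏ l, C l * kernelBound (H l + 1 / α) (x l) := by
    intro n x
    rw [norm_prod]
    exact Finset.prod_le_prod (fun _ _ => norm_nonneg _) fun l _ =>
      (norm_sum_le _ _).trans (hle l _ _)
  have hlim : ∀ᵐ x : E N, Tendsto (fun n => ∏ l, ∑ q ∈ indexSet₁ n R,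
      kernelTerm α ψ (H l) (t l) q (x l)) atTop (𝓝 (∏ l, kernel α (H l) (t l) (x l))) := by
    filter_upwards [ae_all_iff.2 fun l => (quasiMeasurePreserving_coord l).ae
      (ae_tendsto_sum_kernelTerm hψ (hexp l) (t l) hR)] with x hx
    exact tendsto_finsetProd _ fun l _ => hx l
  have hmeas : ∀ n, AEStronglyMeasurable (fun x : E N => ∏ l, ∑ q ∈ indexSet₁ n R,
      kernelTerm α ψ (H l) (t l) q (x l)) volume := fun n =>
    (continuous_finsetProd _ fun l _ => continuous_finsetSum _ fun q _ =>
      (continuous_kernelTerm α ψ (H l) (t l) q).comp (by fun_prop)).aestronglyMeasurable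
  refine ⟨hbound.of_le (aestronglyMeasurable_of_tendsto_ae atTop hmeas hlim) ?_,
    tendsto_eLpNorm_sub_of_dominated ENNReal.ofReal_ne_top hmeas hbound
      (fun n => Eventually.of_forall (hpartial_le n)) hlim⟩
  filter_upwards [hlim] with x hx
  exact (le_of_tendsto hx.norm (Eventually.of_forall fun n => hpartial_le n x)).trans
    (le_abs_self _)

variable {Ω : Type*} [MeasurableSpace Ω] {P : Measure Ω} [IsProbabilityMeasure P]
  {M : Set (E N) → Ω → ℂ}

theorem limitField_ae_eq_sheet (hM : IsIsotropicStableMeasure α P M) (hα0 : 0 < α) (hα2 : α < 2)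
    (hψ : IsLemarieMeyer ψ) (hH : ∀ l, 0 < H l ∧ H l < 1) {R : ℝ} (hR : 0 < R) {t : E N}
    (ht : t ∈ cube N R) : ∀ᵐ ω ∂P, limitField α H ψ P M R t ω = sheet α H P M t ω := by
  obtain ⟨hmem, hlim⟩ := tendsto_eLpNorm_prod_sub_prod_kernel hα0 hψ hH hR t
  have hpartial : ∀ n, IsStableIntegral α P M
      (fun x => ∏ l, ∑ q ∈ indexSet₁ n R, kernelTerm α ψ (H l) (t l) q (x l))
      (fun ω => ∑ p ∈ indexSet N n R, ((((2 : ℝ) ^ (-(∑ l, (p.1 l : ℝ) * H l)) : ℝ) : ℂ) *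
        ∏ l, waveInc (fracPrim α ψ (H l)) (p.1 l, p.2 l) (t l)) * coeff α ψ P M p.1 p.2 ω) := by
    intro n
    simpa only [sum_coeffKernel_eq_prod] using IsStableIntegral.sum hM hα0 (indexSet N n R)
      (fun p => (((2 : ℝ) ^ (-(∑ l, (p.1 l : ℝ) * H l)) : ℝ) : ℂ) *
        ∏ l, waveInc (fracPrim α ψ (H l)) (p.1 l, p.2 l) (t l))
      fun p _ => isStableIntegral_coeff hM hα0 hψ p.1 p.2
  obtain ⟨s, hs, hsubseq⟩ := (IsStableIntegral.tendstoInMeasure hM hα0 hpartial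
    (isStableIntegral_stableIntegral hM hα0 hmem) hlim).exists_seq_tendsto_ae
  filter_upwards [hsubseq, ae_tendsto_limitField hM hα0 hα2 hψ hH hR] with ω hω hlimit
  refine tendsto_nhds_unique ((hlimit t ht).comp hs.tendsto_atTop)
    (((Complex.continuous_re.tendsto _).comp hω).congr fun n => ?_)
  simp only [Function.comp_apply, partialSeries]
  congr 1
  refine Finset.sum_congr rfl fun p _ => ?_
  rw [mul_right_comm]
  rfl

end ProductKernel

end HFSS

theorem mainTheorem2 {N : ℕ} (hN : 0 < N) (α : ℝ) (hα0 : 0 < α) (hα2 : α < 2)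
    (H : Fin N → ℝ) (hH : ∀ l, 0 < H l ∧ H l < 1)
    (ψ : SchwartzMap ℝ ℝ) (hψ : HFSS.IsLemarieMeyer ψ)
    {Ω : Type*} [MeasurableSpace Ω] (P : Measure Ω) [IsProbabilityMeasure P]
    (M : Set (HFSS.E N) → Ω → ℂ) (hM : HFSS.IsIsotropicStableMeasure α P M)
    (R : ℝ) (hR : 0 < R) :
    -- almost surely, the truncated series form a Cauchy sequence in every `C^γ([-R, R]^N)`
    (∀ᵐ ω ∂P, ∀ γ : ℝ≥0, 0 < γ → (∀ l, (γ : ℝ) < H l) →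
      (∀ n, HFSS.holderNorm γ (HFSS.cube N R)
        (fun t => HFSS.partialSeries α H ψ P M R n t ω) < ∞) ∧
      ∀ η : ℝ≥0∞, 0 < η → ∃ n₀ : ℕ, ∀ m n : ℕ, n₀ ≤ m → n₀ ≤ n →
        HFSS.holderNorm γ (HFSS.cube N R)
          (fun t => HFSS.partialSeries α H ψ P M R m t ω -
            HFSS.partialSeries α H ψ P M R n t ω) ≤ η) ∧
    -- the limit `U` is a random field that is a version of the sheet on `[-R, R]^N`
    ∃ U : HFSS.E N → Ω → ℝ,
      (∀ t ∈ HFSS.cube N R, Measurable (U t)) ∧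
      (∀ᵐ ω ∂P, ∀ γ : ℝ≥0, 0 < γ → (∀ l, (γ : ℝ) < H l) →
        HFSS.holderNorm γ (HFSS.cube N R) (fun t => U t ω) < ∞ ∧
        Tendsto (fun n => HFSS.holderNorm γ (HFSS.cube N R)
          (fun t => HFSS.partialSeries α H ψ P M R n t ω - U t ω)) atTop (𝓝 0)) ∧
      ∀ t ∈ HFSS.cube N R, ∀ᵐ ω ∂P, U t ω = HFSS.sheet α H P M t ω := by
  refine ⟨?_, HFSS.limitField α H ψ P M R, fun t _ => HFSS.measurable_limitField H ψ R t, ?_,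
    fun t ht => HFSS.limitField_ae_eq_sheet hM hα0 hα2 hψ hH hR ht⟩
  · filter_upwards [HFSS.ae_partialSeries_cauchy hM hα0 hα2 hψ (fun l => (hH l).2) hR]
      with ω hω γ _ using hω γ
  · filter_upwards [HFSS.ae_limitField_holder hM hα0 hα2 hψ hH hR] with ω hω γ _ using hω γ
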